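/- Let $G$ be a compact topological group. A 2-cocycle is a Borel function $\lambda\colon G\times G\to\mathbb T$ with $\lambda_{g,1}=\lambda_{1,g}=1$ and $\lambda_{g,h}\lambda_{gh,k}=\lambda_{g,hk}\lambda_{h,k}$. A $\lambda$-representation is a Borel map $\pi\colon G\to U(H)$, $H$ a finite-dimensional Hilbert space, with $\pi(g)\pi(h)=\lambda_{g,h}\pi(gh)$; $R^\lambda(G)$ denotes the Grothendieck group of the semigroup (under direct sum) of unitary equivalence classes of $\lambda$-representations. For a point-norm continuous action $\alpha$ of $G$ on a unital C*-algebra $A$ by $*$-automorphisms, let $K_0^\lambda(\alpha)$ be the Grothendieck group of the semigroup (under direct sum) of classes $[(p,\pi)]$, where $\pi$ is a $\lambda$-representation on $H$ and $p\in L(H)\otimes A$ is a projection invariant under $\mathrm{Ad}\,\pi\otimes\alpha$; here $(p_1,\pi_1)\sim(p_2,\pi_2)$ if there is a $G$-invariant $u\in L(H_1,H_2)\otimes A$ with $u^*u=p_1$, $uu^*=p_2$. Let $K_0^\lambda(\alpha)_+$ be the set of the classes $[(p,\pi)]$. There are biadditive partial actions $R^{\lambda_1}(G)\times K_0^{\lambda_2}(\alpha)\to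 K_0^{\lambda_1\lambda_2}(\alpha)$, $([\pi_1],[(p,\pi_2)])\mapsto[(p\otimes1,\pi_2\otimes\pi_1)]$. With $\pi_t$ the one-dimensional trivial representation, put $[1_\alpha]=[(1_A,\pi_t)]$ and $D(\alpha)=\{[(p,\pi_t)] : p\in A \text{ an invariant projection}\}$, both in $K_0^1(\alpha)$ (trivial cocycle). A homomorphism $\Gamma\colon Ell(\alpha)\to Ell(\beta)$ is a family of group homomorphisms $\Gamma^\lambda\colon K_0^\lambda(\alpha)\to K_0^\lambda(\beta)$, one for each 2-cocycle $\lambda$, with $\Gamma^\lambda(K_0^\lambda(\alpha)_+)\subseteq K_0^\lambda(\beta)_+$ and commuting with all partial actions: $\Gamma^{\lambda_1\lambda_2}(r\cdot x)=r\cdot\Gamma^{\lambda_2}(x)$. It is unital if $\Gamma^1([1_\alpha])=[1_\beta]$ and contractive if $\Gamma^1(D(\alpha))\subseteq D(\beta)$. An equivariant $*$-homomorphism $T\colon A\to B$ (not assumed unital) induces $T_*\colon Ell(\alpha)\to Ell(\beta)$, $[(p,\pi)]\mapsto[((\mathrm{id}\otimes T)(p),\pi)]$. The action $\alpha$ is spectrally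 trivial if it acts trivially on the spectrum of $A$, i.e. $\rho\circ\alpha_g$ is unitarily equivalent to $\rho$ for every irreducible representation $\rho$ of $A$ and every $g\in G$. **Proposition.** Let $A$, $B$ be finite-dimensional C*-algebras and let $\alpha\colon G\curvearrowright A$, $\beta\colon G\curvearrowright B$ be actions. Assume either that $\alpha$ and $\beta$ are spectrally trivial, or that $A\cong M_n(\mathbb C)$ and $B\cong M_k(\mathbb C)$ are full matrix algebras. Then: 1. for every contractive homomorphism $\Gamma\colon Ell(\alpha)\to Ell(\beta)$ there is an equivariant $*$-homomorphism $T\colon A\to B$ with $T_*=\Gamma$; 2. for every unital homomorphism $\Gamma\colon Ell(\alpha)\to Ell(\beta)$ there is a unital equivariant $*$-homomorphism $T\colon A\to B$ with $T_*=\Gamma$; 3. if $T_1,T_2\colon A\to B$ are equivariant $*$-homomorphisms with $(T_1)_*=(T_2)_*$, then there is a unitary $U\in B$, fixed by $\beta$, with $T_2(a)=U\,T_1(a)\,U^*$ for all $a\in A$. -/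

import Mathlib

open Matrix
open scoped Kronecker

noncomputable section

universe w u v

/-! ### Actions on C*-algebras -/

/-- A point-norm continuous action of a topological group on a unital C*-algebra by
`*`-automorphisms. -/
structure CStarAction (G : Type w) [Group G] [TopologicalSpace G] (A : Type u)
    [CStarAlgebra A] where
  aut : G →* (A ≃⋆ₐ[ℂ] A)
  continuous_aut : ∀ a : A, Continuous fun g => aut g a

/-- A unital `*`-representation of `A` on a Hilbert space `H` is irreducible if `H ≠ 0` and the
only closed invariant subspaces are `0` and `H`. -/
def IsIrreducibleRep {A : Type u} [CStarAlgebra A] {H : Type*} [NormedAddCommGroup H]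
    [InnerProductSpace ℂ H] [CompleteSpace H] (π : A →⋆ₐ[ℂ] (H →L[ℂ] H)) : Prop :=
  Nontrivial H ∧ ∀ W : Submodule ℂ H, IsClosed (W : Set H) →
    (∀ a : A, ∀ x ∈ W, π a x ∈ W) → W = ⊥ ∨ W = ⊤

/-- Unitary equivalence of `*`-representations. -/
def UnitarilyEquivalent {A : Type u} [CStarAlgebra A] {H K : Type*} [NormedAddCommGroup H]
    [InnerProductSpace ℂ H] [CompleteSpace H] [NormedAddCommGroup K]
    [InnerProductSpace ℂ K] [CompleteSpace K]
    (π : A →⋆ₐ[ℂ] (H →L[ℂ] H)) (σ : A →⋆ₐ[ℂ] (K →L[ℂ] K)) : Prop :=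
  ∃ U : H ≃ₗᵢ[ℂ] K, ∀ (a : A) (x : H), U (π a x) = σ a (U x)

/-- The action fixes every point of the spectrum of `A` (the set of unitary equivalence classes of
irreducible representations).  Irreducible representations of a finite-dimensional C*-algebra are
finite-dimensional, so Hilbert spaces in `Type` give the whole spectrum. -/
def CStarAction.SpectrallyTrivial {G : Type w} [Group G] [TopologicalSpace G] {A : Type u}
    [CStarAlgebra A] (α : CStarAction G A) : Prop :=
  ∀ (H : Type) [NormedAddCommGroup H] [InnerProductSpace ℂ H] [CompleteSpace H]
    (π : A →⋆ₐ[ℂ] (H →L[ℂ] H)), IsIrreducibleRep π →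
    ∀ g : G, UnitarilyEquivalent (π.comp (α.aut g : A →⋆ₐ[ℂ] A)) π

/-- `A` is `*`-isomorphic to the full matrix algebra `M_n` for some `n`. -/
def IsFullMatrixAlgebra (A : Type u) [CStarAlgebra A] : Prop :=
  ∃ n : ℕ, Nonempty (A ≃⋆ₐ[ℂ] Matrix (Fin n) (Fin n) ℂ)

/-! ### 2-cocycles and cocycle representations -/

/-- A normalized Borel 2-cocycle on `G` with values in the circle. -/
@[ext]
structure TwoCocycle (G : Type w) [Group G] [TopologicalSpace G] where
  toFun : G → G → Circle
  measurable_toFun : @Measurable (G × G) Circle (borel (G × G)) (borel Circle) fun p => toFun p.1 p.2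
  one_right : ∀ g, toFun g 1 = 1
  one_left : ∀ g, toFun 1 g = 1
  cocycle : ∀ g h k, toFun g h * toFun (g * h) k = toFun g (h * k) * toFun h k

namespace TwoCocycle

variable {G : Type w} [Group G] [TopologicalSpace G]

/-- The trivial cocycle. -/
instance : One (TwoCocycle G) where
  one :=
    { toFun := fun _ _ => 1
      measurable_toFun := @measurable_const _ _ (borel Circle) (borel (G × G)) 1
      one_right := fun _ => rfl
      one_left := fun _ => rfl
      cocycle := fun _ _ _ => rfl }

/-- Pointwise product of cocycles. -/
instance : Mul (TwoCocycle G) where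
  mul a b :=
    { toFun := fun g h => a.toFun g h * b.toFun g h
      measurable_toFun := by
        let _ : MeasurableSpace (G × G) := borel (G × G)
        let _ : MeasurableSpace Circle := borel Circle
        have _ : BorelSpace Circle := ⟨rfl⟩
        exact a.measurable_toFun.mul b.measurable_toFun
      one_right := fun g => by simp [a.one_right, b.one_right]
      one_left := fun g => by simp [a.one_left, b.one_left]
      cocycle := fun g h k => by
        rw [mul_mul_mul_comm, a.cocycle, b.cocycle, mul_mul_mul_comm] }

@[simp] theorem one_apply (g h : G) : (1 : TwoCocycle G).toFun g h = 1 := rfl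

@[simp] theorem mul_apply (a b : TwoCocycle G) (g h : G) :
    (a * b).toFun g h = a.toFun g h * b.toFun g h := rfl

end TwoCocycle

/-- A finite-dimensional (unitary) `lam`-representation: a Borel map `π` from `G` to the unitaries
of `ℂ^ι`, for a finite index set `ι`, such that `π g * π h = lam g h • π (g * h)`. -/
structure CocycleRep {G : Type w} [Group G] [TopologicalSpace G] (lam : TwoCocycle G) where
  ι : Type
  [fintype : Fintype ι]
  [decEq : DecidableEq ι]
  mat : G → Matrix ι ι ℂ
  unitary_mat : ∀ g, mat g ∈ Matrix.unitaryGroup ι ℂ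
  measurable_mat : ∀ i j, @Measurable G ℂ (borel G) _ fun g => mat g i j
  mat_mul : ∀ g h, mat g * mat h = (lam.toFun g h : ℂ) • mat (g * h)

attribute [instance] CocycleRep.fintype CocycleRep.decEq

namespace CocycleRep

variable {G : Type w} [Group G] [TopologicalSpace G] {lam mu : TwoCocycle G}

theorem mat_mul_conjTranspose (π : CocycleRep lam) (g : G) : π.mat g * (π.mat g)ᴴ = 1 :=
  Matrix.mem_unitaryGroup_iff.1 (π.unitary_mat g)

theorem conjTranspose_mul_mat (π : CocycleRep lam) (g : G) : (π.mat g)ᴴ * π.mat g = 1 :=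
  Matrix.mem_unitaryGroup_iff'.1 (π.unitary_mat g)

/-- The zero-dimensional representation. -/
abbrev zero (lam : TwoCocycle G) : CocycleRep lam where
  ι := Empty
  mat := fun _ => 1
  unitary_mat := fun _ => one_mem _
  measurable_mat := fun i => i.elim
  mat_mul := fun g h => by ext i; exact i.elim

/-- Direct sum. -/
abbrev directSum (π σ : CocycleRep lam) : CocycleRep lam where
  ι := π.ι ⊕ σ.ι
  mat := fun g => fromBlocks (π.mat g) 0 0 (σ.mat g)
  unitary_mat := fun g => by
    rw [Matrix.mem_unitaryGroup_iff, star_eq_conjTranspose, fromBlocks_conjTranspose,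
      fromBlocks_multiply]
    simp [mat_mul_conjTranspose]
  measurable_mat := by
    rintro (i | i) (j | j)
    · exact π.measurable_mat i j
    · exact @measurable_const _ _ _ (borel G) 0
    · exact @measurable_const _ _ _ (borel G) 0
    · exact σ.measurable_mat i j
  mat_mul := fun g h => by
    rw [fromBlocks_multiply, fromBlocks_smul]
    simp [π.mat_mul, σ.mat_mul]

/-- The tensor product `σ ⊗ π` of a `lam`-representation `π` and a `mu`-representation `σ`. -/
abbrev tensor (π : CocycleRep lam) (σ : CocycleRep mu) : CocycleRep (lam * mu) where
  ι := σ.ι × π.ι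
  mat := fun g => σ.mat g ⊗ₖ π.mat g
  unitary_mat := fun g => by
    rw [Matrix.mem_unitaryGroup_iff, star_eq_conjTranspose, conjTranspose_kronecker,
      ← mul_kronecker_mul, mat_mul_conjTranspose, mat_mul_conjTranspose, one_kronecker_one]
  measurable_mat := fun i j => by
    let _ : MeasurableSpace G := borel G
    exact (σ.measurable_mat i.1 j.1).mul (π.measurable_mat i.2 j.2)
  mat_mul := fun g h => by
    rw [← mul_kronecker_mul, π.mat_mul, σ.mat_mul, smul_kronecker, kronecker_smul, smul_smul,
      TwoCocycle.mul_apply, Circle.coe_mul, mul_comm]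

/-- The one-dimensional trivial representation. -/
abbrev trivial (G : Type w) [Group G] [TopologicalSpace G] : CocycleRep (1 : TwoCocycle G) where
  ι := Unit
  mat := fun _ => 1
  unitary_mat := fun _ => one_mem _
  measurable_mat := fun i j =>
    @measurable_const _ _ _ (borel G) ((1 : Matrix Unit Unit ℂ) i j)
  mat_mul := fun g h => by simp

/-- Unitary equivalence of `lam`-representations. -/
def Equivalent (π σ : CocycleRep lam) : Prop :=
  ∃ W : Matrix σ.ι π.ι ℂ, Wᴴ * W = 1 ∧ W * Wᴴ = 1 ∧ ∀ g, σ.mat g * W = W * π.mat g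

theorem equivalent_equivalence : Equivalence (Equivalent (lam := lam)) where
  refl π := ⟨1, by simp, by simp, by simp⟩
  symm := by
    rintro π σ ⟨W, h1, h2, h3⟩
    refine ⟨Wᴴ, by simpa using h2, by simpa using h1, fun g => ?_⟩
    calc π.mat g * Wᴴ = (Wᴴ * W) * π.mat g * Wᴴ := by rw [h1, Matrix.one_mul]
      _ = Wᴴ * (W * π.mat g) * Wᴴ := by simp only [Matrix.mul_assoc]
      _ = Wᴴ * σ.mat g * (W * Wᴴ) := by rw [← h3]; simp only [Matrix.mul_assoc]
      _ = Wᴴ * σ.mat g := by rw [h2, Matrix.mul_one]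
  trans := by
    rintro π σ τ ⟨W, h1, h2, h3⟩ ⟨X, k1, k2, k3⟩
    refine ⟨X * W, ?_, ?_, fun g => ?_⟩
    · rw [conjTranspose_mul, Matrix.mul_assoc, ← Matrix.mul_assoc Xᴴ, k1, Matrix.one_mul, h1]
    · rw [conjTranspose_mul, Matrix.mul_assoc, ← Matrix.mul_assoc W, h2, Matrix.one_mul, k2]
    · rw [← Matrix.mul_assoc, k3, Matrix.mul_assoc, h3, Matrix.mul_assoc]

/-- Relabelling the basis gives an equivalent representation. -/
theorem equivalent_of_equiv {π σ : CocycleRep lam} (e : π.ι ≃ σ.ι)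
    (h : ∀ g, σ.mat g = (π.mat g).submatrix e.symm e.symm) : Equivalent π σ := by
  refine ⟨(1 : Matrix π.ι π.ι ℂ).submatrix e.symm id, ?_, ?_, fun g => ?_⟩
  · rw [conjTranspose_submatrix, submatrix_mul_equiv _ _ _ e.symm]; simp
  · rw [conjTranspose_submatrix]
    have := submatrix_mul_equiv (1 : Matrix π.ι π.ι ℂ) (1 : Matrix π.ι π.ι ℂ)ᴴ e.symm
      (Equiv.refl _) e.symm
    simp only [Equiv.coe_refl] at this
    rw [this]; simp
  · have := submatrix_mul_equiv (1 : Matrix π.ι π.ι ℂ) (π.mat g) e.symm (Equiv.refl _) id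
    simp only [Equiv.coe_refl, submatrix_id_id] at this
    rw [h, submatrix_mul_equiv _ _ _ e.symm, this]; simp

theorem directSum_congr {π π' σ σ' : CocycleRep lam} (h : Equivalent π π')
    (k : Equivalent σ σ') : Equivalent (directSum π σ) (directSum π' σ') := by
  obtain ⟨W, h1, h2, h3⟩ := h
  obtain ⟨X, k1, k2, k3⟩ := k
  refine ⟨fromBlocks W 0 0 X, ?_, ?_, fun g => ?_⟩
  · rw [fromBlocks_conjTranspose, fromBlocks_multiply]; simp [h1, k1, directSum]
  · rw [fromBlocks_conjTranspose, fromBlocks_multiply]; simp [h2, k2, directSum]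
  · simp only [directSum]
    rw [fromBlocks_multiply, fromBlocks_multiply]; simp [h3, k3]

/-- Equivalence of `lam`-representations as a setoid. -/
instance setoid (lam : TwoCocycle G) : Setoid (CocycleRep lam) :=
  ⟨Equivalent, equivalent_equivalence⟩

end CocycleRep

/-- The semigroup `V^lam(G)` of equivalence classes of `lam`-representations. -/
def RepClass {G : Type w} [Group G] [TopologicalSpace G] (lam : TwoCocycle G) :=
  Quotient (CocycleRep.setoid lam)

namespace RepClass

variable {G : Type w} [Group G] [TopologicalSpace G] {lam : TwoCocycle G}

/-- The class of a representation. -/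
def mk (π : CocycleRep lam) : RepClass lam := Quotient.mk _ π

/-- Addition is induced by the direct sum. -/
instance : Add (RepClass lam) :=
  ⟨Quotient.map₂ CocycleRep.directSum fun _ _ h _ _ k => CocycleRep.directSum_congr h k⟩

instance : Zero (RepClass lam) := ⟨mk (CocycleRep.zero lam)⟩

theorem mk_add (π σ : CocycleRep lam) : mk π + mk σ = mk (π.directSum σ) := rfl

theorem add_comm' (x y : RepClass lam) : x + y = y + x := by
  induction x using Quotient.inductionOn with | _ π
  induction y using Quotient.inductionOn with | _ σ
  refine Quotient.sound (CocycleRep.equivalent_of_equiv (Equiv.sumComm _ _) fun g => ?_)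
  ext (i | i) (j | j) <;> rfl

theorem zero_add' (x : RepClass lam) : 0 + x = x := by
  induction x using Quotient.inductionOn with | _ π
  refine Quotient.sound (CocycleRep.equivalent_of_equiv (Equiv.emptySum Empty _) fun g => ?_)
  ext i j; rfl

instance : AddCommMonoid (RepClass lam) where
  add_assoc x y z := by
    induction x using Quotient.inductionOn with | _ π
    induction y using Quotient.inductionOn with | _ σ
    induction z using Quotient.inductionOn with | _ τ
    refine Quotient.sound (CocycleRep.equivalent_of_equiv (Equiv.sumAssoc _ _ _) fun g => ?_)
    ext (i | i | i) (j | j | j) <;> rfl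
  zero_add := zero_add'
  add_zero x := by rw [add_comm', zero_add']
  add_comm := add_comm'
  nsmul := nsmulRec

end RepClass

/-- The `lam`-representation group `R^lam(G)`: the Grothendieck group of `V^lam(G)`. -/
abbrev RepGroup {G : Type w} [Group G] [TopologicalSpace G] (lam : TwoCocycle G) :=
  Algebra.GrothendieckAddGroup (RepClass lam)

/-! ### Matrices over a C*-algebra

For `H₁ = ℂ^κ` and `H₂ = ℂ^ι` the space `L(H₁, H₂) ⊗ A` is identified with `ι × κ` matrices over
`A`. -/

section matrices

variable {A : Type u} [CStarAlgebra A] {B : Type v} [CStarAlgebra B]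

/-- A scalar matrix viewed as a matrix over `A`. -/
def scalarMat {ι κ : Type*} (A : Type u) [CStarAlgebra A] (M : Matrix ι κ ℂ) : Matrix ι κ A :=
  M.map (algebraMap ℂ A)

/-- The element `x ⊗ M` of `L(H₁ ⊗ H₃, H₂ ⊗ H₄) ⊗ A`, for `x` in `L(H₁, H₂) ⊗ A` and a linear map
`M` from `H₃` to `H₄`. -/
def tensorMat {ι κ m n : Type*} (x : Matrix ι κ A) (M : Matrix m n ℂ) :
    Matrix (ι × m) (κ × n) A :=
  kroneckerMap (fun a z => z • a) x M

theorem scalarMat_mul {ι κ m : Type*} [Fintype κ] (M : Matrix ι κ ℂ) (N : Matrix κ m ℂ) :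
    scalarMat A (M * N) = scalarMat A M * scalarMat A N :=
  Matrix.map_mul

theorem scalarMat_one {ι : Type*} [DecidableEq ι] :
    scalarMat A (1 : Matrix ι ι ℂ) = 1 := by
  simp [scalarMat]

theorem scalarMat_conjTranspose {ι κ : Type*} (M : Matrix ι κ ℂ) :
    (scalarMat A M)ᴴ = scalarMat A Mᴴ := by
  ext i j; exact (algebraMap_star_comm (M j i)).symm

theorem tensorMat_mul {ι κ m n p q : Type*} [Fintype κ] [Fintype n]
    (x : Matrix ι κ A) (M : Matrix m n ℂ) (y : Matrix κ p A) (N : Matrix n q ℂ) :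
    tensorMat x M * tensorMat y N = tensorMat (x * y) (M * N) := by
  ext ⟨i, k⟩ ⟨j, l⟩
  simp only [tensorMat, Matrix.mul_apply, kroneckerMap_apply, Fintype.sum_prod_type,
    smul_mul_smul_comm, Finset.sum_smul, Finset.smul_sum]

theorem tensorMat_conjTranspose {ι κ m n : Type*} (x : Matrix ι κ A) (M : Matrix m n ℂ) :
    (tensorMat x M)ᴴ = tensorMat xᴴ Mᴴ := by
  ext ⟨i, k⟩ ⟨j, l⟩; simp [tensorMat, star_smul]

theorem tensorMat_scalarMat {ι κ m n : Type*} (M : Matrix ι κ ℂ) (N : Matrix m n ℂ) :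
    tensorMat (scalarMat A M) N = scalarMat A (M ⊗ₖ N) := by
  ext ⟨i, k⟩ ⟨j, l⟩
  simp [tensorMat, scalarMat, Algebra.algebraMap_eq_smul_one, smul_smul, mul_comm]

end matrices

/-! ### Twisted equivariant K-theory -/

section ktheory

variable {G : Type w} [Group G] [TopologicalSpace G] {A : Type u} [CStarAlgebra A]
  {B : Type v} [CStarAlgebra B] {lam mu : TwoCocycle G}

/-- The diagonal action of `g` on `L(H₁, H₂) ⊗ A`: `t ⊗ a ↦ π₂(g) t π₁(g)⁻¹ ⊗ α_g(a)`. -/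
def diagAct (α : CStarAction G A) (π₁ π₂ : CocycleRep lam) (g : G) (x : Matrix π₂.ι π₁.ι A) :
    Matrix π₂.ι π₁.ι A :=
  scalarMat A (π₂.mat g) * x.map (α.aut g) * scalarMat A (π₁.mat g)ᴴ

/-- Invariance under the diagonal action. -/
def IsGInvariant (α : CStarAction G A) (π₁ π₂ : CocycleRep lam) (x : Matrix π₂.ι π₁.ι A) : Prop :=
  ∀ g, diagAct α π₁ π₂ g x = x

theorem diagAct_mul (α : CStarAction G A) (π₁ π₂ π₃ : CocycleRep lam) (g : G)
    (x : Matrix π₂.ι π₁.ι A) (y : Matrix π₃.ι π₂.ι A) :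
    diagAct α π₁ π₃ g (y * x) = diagAct α π₂ π₃ g y * diagAct α π₁ π₂ g x := by
  have h : scalarMat A (π₂.mat g)ᴴ * scalarMat A (π₂.mat g) = 1 := by
    rw [← scalarMat_mul, π₂.conjTranspose_mul_mat, scalarMat_one]
  have hm : (y * x).map (α.aut g) = y.map (α.aut g) * x.map (α.aut g) := Matrix.map_mul
  unfold diagAct
  have h' : ∀ z : Matrix π₂.ι π₁.ι A,
      scalarMat A (π₂.mat g)ᴴ * (scalarMat A (π₂.mat g) * z) = z := fun z => by
    rw [← Matrix.mul_assoc, h, Matrix.one_mul]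
  rw [hm]
  simp only [Matrix.mul_assoc, h']

theorem diagAct_conjTranspose (α : CStarAction G A) (π₁ π₂ : CocycleRep lam) (g : G)
    (x : Matrix π₂.ι π₁.ι A) : (diagAct α π₁ π₂ g x)ᴴ = diagAct α π₂ π₁ g xᴴ := by
  have hm : (x.map (α.aut g))ᴴ = xᴴ.map (α.aut g) := by
    ext i j; exact (map_star (α.aut g) (x j i)).symm
  unfold diagAct
  rw [conjTranspose_mul, conjTranspose_mul, scalarMat_conjTranspose, scalarMat_conjTranspose, hm,
    conjTranspose_conjTranspose, Matrix.mul_assoc]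

theorem IsGInvariant.mul {α : CStarAction G A} {π₁ π₂ π₃ : CocycleRep lam}
    {x : Matrix π₂.ι π₁.ι A} {y : Matrix π₃.ι π₂.ι A} (hy : IsGInvariant α π₂ π₃ y)
    (hx : IsGInvariant α π₁ π₂ x) : IsGInvariant α π₁ π₃ (y * x) := fun g => by
  rw [diagAct_mul α π₁ π₂ π₃, hx g, hy g]

theorem IsGInvariant.conjTranspose {α : CStarAction G A} {π₁ π₂ : CocycleRep lam}
    {x : Matrix π₂.ι π₁.ι A} (hx : IsGInvariant α π₁ π₂ x) : IsGInvariant α π₂ π₁ xᴴ := fun g => by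
  rw [← diagAct_conjTranspose, hx g]

theorem IsGInvariant.fromBlocks {α : CStarAction G A} {π₁ π₂ σ₁ σ₂ : CocycleRep lam}
    {x : Matrix π₂.ι π₁.ι A} {y : Matrix σ₂.ι σ₁.ι A} (hx : IsGInvariant α π₁ π₂ x)
    (hy : IsGInvariant α σ₁ σ₂ y) :
    IsGInvariant α (π₁.directSum σ₁) (π₂.directSum σ₂) (Matrix.fromBlocks x 0 0 y) := fun g => by
  have h1 := hx g
  have h2 := hy g
  unfold diagAct scalarMat at h1 h2 ⊢
  simp only [CocycleRep.directSum, fromBlocks_conjTranspose, fromBlocks_map, fromBlocks_multiply]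
  simp [h1, h2]

theorem IsGInvariant.tensorMat {α : CStarAction G A} {ρ₁ ρ₂ : CocycleRep mu}
    {π₁ π₂ : CocycleRep lam} {x : Matrix π₂.ι π₁.ι A} (hx : IsGInvariant α π₁ π₂ x)
    {W : Matrix ρ₂.ι ρ₁.ι ℂ} (hW : ∀ g, ρ₂.mat g * W = W * ρ₁.mat g) :
    IsGInvariant α (ρ₁.tensor π₁) (ρ₂.tensor π₂) (tensorMat x W) := fun g => by
  have h1 : ρ₂.mat g * W * (ρ₁.mat g)ᴴ = W := by
    rw [hW, Matrix.mul_assoc, ρ₁.mat_mul_conjTranspose, Matrix.mul_one]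
  have h2 : (_root_.tensorMat x W).map (α.aut g) = _root_.tensorMat (x.map (α.aut g)) W := by
    ext ⟨i, k⟩ ⟨j, l⟩; simp [_root_.tensorMat]
  have h3 := hx g
  unfold diagAct at h3 ⊢
  simp only [CocycleRep.tensor, conjTranspose_kronecker]
  rw [← tensorMat_scalarMat, ← tensorMat_scalarMat, h2, tensorMat_mul, tensorMat_mul, h3, h1]

/-- The set `P^lam(G, A, α)` of pairs `(p, π)` of a `lam`-representation `π` on `H` and an
invariant projection `p` in `L(H) ⊗ A`. -/
structure ProjPair (lam : TwoCocycle G) (α : CStarAction G A) where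
  rep : CocycleRep lam
  proj : Matrix rep.ι rep.ι A
  isProj : IsStarProjection proj
  invariant : IsGInvariant α rep rep proj

namespace ProjPair

variable {α : CStarAction G A}

theorem conjTranspose_proj (P : ProjPair lam α) : P.projᴴ = P.proj := P.isProj.isSelfAdjoint

theorem proj_mul_proj (P : ProjPair lam α) : P.proj * P.proj = P.proj :=
  P.isProj.isIdempotentElem

/-- The zero pair on the zero-dimensional representation. -/
abbrev zero (lam : TwoCocycle G) (α : CStarAction G A) : ProjPair lam α where
  rep := CocycleRep.zero lam
  proj := 0
  isProj := IsStarProjection.zero _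
  invariant := fun _ => by ext i; exact i.elim

/-- `(p₁, π₁) ⊕ (p₂, π₂) = (diag(p₁, p₂), π₁ ⊕ π₂)`. -/
abbrev directSum (P Q : ProjPair lam α) : ProjPair lam α where
  rep := P.rep.directSum Q.rep
  proj := fromBlocks P.proj 0 0 Q.proj
  isProj := by
    refine ⟨?_, ?_⟩
    · change fromBlocks P.proj 0 0 Q.proj * fromBlocks P.proj 0 0 Q.proj = _
      rw [fromBlocks_multiply]; simp [proj_mul_proj]
    · change (fromBlocks P.proj 0 0 Q.proj)ᴴ = _
      rw [fromBlocks_conjTranspose]; simp [conjTranspose_proj]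
  invariant := P.invariant.fromBlocks Q.invariant

/-- Murray-von Neumann equivalence through an invariant element of `L(H₁, H₂) ⊗ A`. -/
def Equivalent (P Q : ProjPair lam α) : Prop :=
  ∃ U : Matrix Q.rep.ι P.rep.ι A, IsGInvariant α P.rep Q.rep U ∧ Uᴴ * U = P.proj ∧
    U * Uᴴ = Q.proj

theorem equivalent_equivalence : Equivalence (Equivalent (α := α) (lam := lam)) where
  refl P := ⟨P.proj, P.invariant, by rw [conjTranspose_proj, proj_mul_proj],
    by rw [conjTranspose_proj, proj_mul_proj]⟩
  symm := by
    rintro P Q ⟨U, h1, h2, h3⟩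
    exact ⟨Uᴴ, h1.conjTranspose, by rwa [conjTranspose_conjTranspose],
      by rwa [conjTranspose_conjTranspose]⟩
  trans := by
    rintro P Q R ⟨U, h1, h2, h3⟩ ⟨V, k1, k2, k3⟩
    refine ⟨V * U, k1.mul h1, ?_, ?_⟩
    · rw [conjTranspose_mul]
      calc Uᴴ * Vᴴ * (V * U) = Uᴴ * (Vᴴ * V) * U := by simp only [Matrix.mul_assoc]
        _ = (Uᴴ * U) * (Uᴴ * U) := by rw [k2, ← h3]; simp only [Matrix.mul_assoc]
        _ = P.proj := by rw [h2, proj_mul_proj]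
    · rw [conjTranspose_mul]
      calc V * U * (Uᴴ * Vᴴ) = V * (U * Uᴴ) * Vᴴ := by simp only [Matrix.mul_assoc]
        _ = (V * Vᴴ) * (V * Vᴴ) := by rw [h3, ← k2]; simp only [Matrix.mul_assoc]
        _ = R.proj := by rw [k3, proj_mul_proj]

theorem equivalent_of_equiv {P Q : ProjPair lam α} (e : P.rep.ι ≃ Q.rep.ι)
    (h : ∀ g, Q.rep.mat g = (P.rep.mat g).submatrix e.symm e.symm)
    (hp : Q.proj = P.proj.submatrix e.symm e.symm) : Equivalent P Q := by
  refine ⟨P.proj.submatrix e.symm id, fun g => ?_, ?_, ?_⟩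
  · have h1 := P.invariant g
    unfold diagAct scalarMat at h1 ⊢
    rw [h, ← submatrix_map, ← submatrix_map, submatrix_mul_equiv _ _ _ e.symm]
    have := submatrix_mul_equiv
      ((P.rep.mat g).map (algebraMap ℂ A) * P.proj.map (α.aut g))
      ((P.rep.mat g)ᴴ.map (algebraMap ℂ A)) e.symm (Equiv.refl _) id
    simp only [Equiv.coe_refl, submatrix_id_id] at this
    rw [this, h1]
  · rw [conjTranspose_submatrix, submatrix_mul_equiv _ _ _ e.symm, conjTranspose_proj,
      proj_mul_proj, submatrix_id_id]
  · rw [conjTranspose_submatrix, conjTranspose_proj]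
    have := submatrix_mul_equiv P.proj P.proj e.symm (Equiv.refl _) e.symm
    simp only [Equiv.coe_refl] at this
    rw [this, proj_mul_proj, hp]

theorem directSum_congr {P P' Q Q' : ProjPair lam α} (h : Equivalent P P')
    (k : Equivalent Q Q') : Equivalent (directSum P Q) (directSum P' Q') := by
  obtain ⟨U, h1, h2, h3⟩ := h
  obtain ⟨V, k1, k2, k3⟩ := k
  refine ⟨fromBlocks U 0 0 V, h1.fromBlocks k1, ?_, ?_⟩
  · change (fromBlocks U 0 0 V)ᴴ * fromBlocks U 0 0 V = fromBlocks P.proj 0 0 Q.proj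
    rw [fromBlocks_conjTranspose, fromBlocks_multiply]; simp [h2, k2]
  · change fromBlocks U 0 0 V * (fromBlocks U 0 0 V)ᴴ = fromBlocks P'.proj 0 0 Q'.proj
    rw [fromBlocks_conjTranspose, fromBlocks_multiply]; simp [h3, k3]

/-- The pair `(p ⊗ 1, π₂ ⊗ π₁)` attached to a `mu`-representation `π₁` and a pair `(p, π₂)`. -/
abbrev tensor (ρ : CocycleRep mu) (P : ProjPair lam α) : ProjPair (mu * lam) α where
  rep := ρ.tensor P.rep
  proj := tensorMat P.proj (1 : Matrix ρ.ι ρ.ι ℂ)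
  isProj := by
    refine ⟨?_, ?_⟩
    · change tensorMat P.proj (1 : Matrix ρ.ι ρ.ι ℂ) * tensorMat P.proj 1 = _
      rw [tensorMat_mul, proj_mul_proj, Matrix.mul_one]
    · change (tensorMat P.proj (1 : Matrix ρ.ι ρ.ι ℂ))ᴴ = _
      rw [tensorMat_conjTranspose, conjTranspose_proj, conjTranspose_one]
  invariant := P.invariant.tensorMat fun g => by simp

theorem tensor_congr {ρ ρ' : CocycleRep mu} {P P' : ProjPair lam α}
    (h : CocycleRep.Equivalent ρ ρ') (k : Equivalent P P') :
    Equivalent (tensor ρ P) (tensor ρ' P') := by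
  obtain ⟨W, h1, h2, h3⟩ := h
  obtain ⟨U, k1, k2, k3⟩ := k
  refine ⟨tensorMat U W, k1.tensorMat h3, ?_, ?_⟩
  · change (tensorMat U W)ᴴ * tensorMat U W = tensorMat P.proj 1
    rw [tensorMat_conjTranspose, tensorMat_mul, h1, k2]
  · change tensorMat U W * (tensorMat U W)ᴴ = tensorMat P'.proj 1
    rw [tensorMat_conjTranspose, tensorMat_mul, h2, k3]

/-- The pair `(p, π_t)` attached to an invariant projection `p` of `A`, where `π_t` is the
one-dimensional trivial representation. -/
abbrev ofInvariant (α : CStarAction G A) (p : A) (hp : IsStarProjection p)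
    (hinv : ∀ g, α.aut g p = p) : ProjPair (1 : TwoCocycle G) α where
  rep := CocycleRep.trivial G
  proj := (Matrix.of fun _ _ => p : Matrix Unit Unit A)
  isProj := by
    refine ⟨?_, ?_⟩
    · change (Matrix.of fun _ _ => p : Matrix Unit Unit A) * Matrix.of (fun _ _ => p) = _
      ext i j; simpa [Matrix.mul_apply] using hp.isIdempotentElem.eq
    · change (Matrix.of fun _ _ => p : Matrix Unit Unit A)ᴴ = _
      ext i j; simpa using hp.isSelfAdjoint.star_eq
  invariant := fun g => by
    change scalarMat A (1 : Matrix Unit Unit ℂ) *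
      (Matrix.of fun _ _ => p : Matrix Unit Unit A).map (α.aut g) *
      scalarMat A (1 : Matrix Unit Unit ℂ)ᴴ = _
    rw [conjTranspose_one, scalarMat_one, Matrix.one_mul, Matrix.mul_one]
    ext i j; simp [hinv]

/-- Murray-von Neumann equivalence as a setoid. -/
instance setoid (lam : TwoCocycle G) (α : CStarAction G A) : Setoid (ProjPair lam α) :=
  ⟨Equivalent, equivalent_equivalence⟩

end ProjPair

/-- The semigroup `V^lam(G, A, α)` of equivalence classes of pairs. -/
def ProjClass (lam : TwoCocycle G) (α : CStarAction G A) := Quotient (ProjPair.setoid lam α)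

namespace ProjClass

variable {α : CStarAction G A}

/-- The class of a pair. -/
def mk (P : ProjPair lam α) : ProjClass lam α := Quotient.mk _ P

/-- Addition is induced by the direct sum of pairs. -/
instance : Add (ProjClass lam α) :=
  ⟨Quotient.map₂ ProjPair.directSum fun _ _ h _ _ k => ProjPair.directSum_congr h k⟩

instance : Zero (ProjClass lam α) := ⟨mk (ProjPair.zero lam α)⟩

theorem mk_add (P Q : ProjPair lam α) : mk P + mk Q = mk (P.directSum Q) := rfl

theorem add_comm' (x y : ProjClass lam α) : x + y = y + x := by
  induction x using Quotient.inductionOn with | _ P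
  induction y using Quotient.inductionOn with | _ Q
  refine Quotient.sound (ProjPair.equivalent_of_equiv (Equiv.sumComm _ _) (fun g => ?_) ?_)
  · ext (i | i) (j | j) <;> rfl
  · ext (i | i) (j | j) <;> rfl

theorem zero_add' (x : ProjClass lam α) : 0 + x = x := by
  induction x using Quotient.inductionOn with | _ P
  refine Quotient.sound (ProjPair.equivalent_of_equiv (Equiv.emptySum Empty _) (fun g => ?_) ?_)
  · ext i j; rfl
  · ext i j; rfl

instance : AddCommMonoid (ProjClass lam α) where
  add_assoc x y z := by
    induction x using Quotient.inductionOn with | _ P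
    induction y using Quotient.inductionOn with | _ Q
    induction z using Quotient.inductionOn with | _ R
    refine Quotient.sound
      (ProjPair.equivalent_of_equiv (Equiv.sumAssoc _ _ _) (fun g => ?_) ?_)
    · ext (i | i | i) (j | j | j) <;> rfl
    · ext (i | i | i) (j | j | j) <;> rfl
  zero_add := zero_add'
  add_zero x := by rw [add_comm', zero_add']
  add_comm := add_comm'
  nsmul := nsmulRec

/-- The pairing `V^mu(G) × V^lam(G, A, α) → V^(mu lam)(G, A, α)`,
`([π₁], [(p, π₂)]) ↦ [(p ⊗ 1, π₂ ⊗ π₁)]`. -/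
def tensor : RepClass mu → ProjClass lam α → ProjClass (mu * lam) α :=
  Quotient.map₂ ProjPair.tensor fun _ _ h _ _ k => ProjPair.tensor_congr h k

theorem tensor_mk (ρ : CocycleRep mu) (P : ProjPair lam α) :
    tensor (RepClass.mk ρ) (mk P) = mk (ProjPair.tensor ρ P) := rfl

theorem tensor_add (r : RepClass mu) (x y : ProjClass lam α) :
    tensor r (x + y) = tensor r x + tensor r y := by
  induction r using Quotient.inductionOn with | _ ρ
  induction x using Quotient.inductionOn with | _ P
  induction y using Quotient.inductionOn with | _ Q
  refine Quotient.sound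
    (ProjPair.equivalent_of_equiv (Equiv.sumProdDistrib _ _ _) (fun g => ?_) ?_)
  · ext (⟨i, k⟩ | ⟨i, k⟩) (⟨j, l⟩ | ⟨j, l⟩) <;>
      simp [ProjPair.tensor, ProjPair.directSum, CocycleRep.tensor, CocycleRep.directSum]
  · ext (⟨i, k⟩ | ⟨i, k⟩) (⟨j, l⟩ | ⟨j, l⟩) <;>
      simp [ProjPair.tensor, ProjPair.directSum, tensorMat]

theorem add_tensor (r s : RepClass mu) (x : ProjClass lam α) :
    tensor (r + s) x = tensor r x + tensor s x := by
  induction r using Quotient.inductionOn with | _ ρ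
  induction s using Quotient.inductionOn with | _ σ
  induction x using Quotient.inductionOn with | _ P
  refine Quotient.sound
    (ProjPair.equivalent_of_equiv (Equiv.prodSumDistrib _ _ _) (fun g => ?_) ?_)
  · ext (⟨i, k⟩ | ⟨i, k⟩) (⟨j, l⟩ | ⟨j, l⟩) <;>
      simp [ProjPair.tensor, ProjPair.directSum, CocycleRep.tensor, CocycleRep.directSum]
  · ext (⟨i, k⟩ | ⟨i, k⟩) (⟨j, l⟩ | ⟨j, l⟩) <;>
      simp [ProjPair.tensor, ProjPair.directSum, tensorMat, CocycleRep.directSum,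
        Matrix.one_apply]

theorem tensor_zero (r : RepClass mu) : tensor r (0 : ProjClass lam α) = 0 := by
  induction r using Quotient.inductionOn with | _ ρ
  refine Quotient.sound (ProjPair.equivalent_of_equiv
    ⟨fun x => x.1, fun x => x.elim, fun x => x.1.elim, fun x => x.elim⟩ (fun g => ?_) ?_)
  · ext i; exact i.elim
  · ext i; exact i.elim

theorem zero_tensor (x : ProjClass lam α) : tensor (0 : RepClass mu) x = 0 := by
  induction x using Quotient.inductionOn with | _ P
  refine Quotient.sound (ProjPair.equivalent_of_equiv
    ⟨fun x => x.2, fun x => x.elim, fun x => x.2.elim, fun x => x.elim⟩ (fun g => ?_) ?_)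
  · ext i; exact i.elim
  · ext i; exact i.elim

/-- The pairing of `tensor` as a biadditive map. -/
def tensorHom (mu lam : TwoCocycle G) (α : CStarAction G A) :
    RepClass mu →+ ProjClass lam α →+ ProjClass (mu * lam) α where
  toFun r :=
    { toFun := tensor r
      map_zero' := tensor_zero r
      map_add' := tensor_add r }
  map_zero' := AddMonoidHom.ext zero_tensor
  map_add' r s := AddMonoidHom.ext (add_tensor r s)

end ProjClass

theorem grothendieck_lift_of {M N : Type*} [AddCommMonoid M] [AddCommGroup N] (f : M →+ N)
    (x : M) : Algebra.GrothendieckAddGroup.lift f (Algebra.GrothendieckAddGroup.of x) = f x :=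
  DFunLike.congr_fun (Algebra.GrothendieckAddGroup.lift.symm_apply_apply f) x

theorem grothendieck_hom_ext {M N : Type*} [AddCommMonoid M] [AddCommGroup N]
    {f g : Algebra.GrothendieckAddGroup M →+ N}
    (h : ∀ x, f (Algebra.GrothendieckAddGroup.of x) = g (Algebra.GrothendieckAddGroup.of x)) :
    f = g :=
  Algebra.GrothendieckAddGroup.lift.symm.injective (AddMonoidHom.ext h)

/-- The twisted equivariant K-group `K₀^lam(α)`: the Grothendieck group of `V^lam(G, A, α)`. -/
abbrev TwistedK (lam : TwoCocycle G) (α : CStarAction G A) :=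
  Algebra.GrothendieckAddGroup (ProjClass lam α)

namespace TwistedK

/-- The class of a pair in `K₀^lam(α)`. -/
def cls {α : CStarAction G A} (P : ProjPair lam α) : TwistedK lam α :=
  Algebra.GrothendieckAddGroup.of (ProjClass.mk P)

/-- The positive cone `K₀^lam(α)₊`: the classes of pairs. -/
def positiveCone (lam : TwoCocycle G) (α : CStarAction G A) : Set (TwistedK lam α) :=
  Set.range cls

/-- The partial action `R^mu(G) × K₀^lam(α) → K₀^(mu lam)(α)`, the biadditive extension of
`([π₁], [(p, π₂)]) ↦ [(p ⊗ 1, π₂ ⊗ π₁)]`. -/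
def partialAction (mu lam : TwoCocycle G) (α : CStarAction G A) :
    RepGroup mu →+ TwistedK lam α →+ TwistedK (mu * lam) α :=
  Algebra.GrothendieckAddGroup.lift
    { toFun := fun r => Algebra.GrothendieckAddGroup.lift
        (Algebra.GrothendieckAddGroup.of.comp (ProjClass.tensorHom mu lam α r))
      map_zero' := grothendieck_hom_ext fun x => by
        rw [grothendieck_lift_of, map_zero, AddMonoidHom.zero_apply, AddMonoidHom.comp_apply,
          AddMonoidHom.zero_apply, map_zero]
      map_add' := fun r s => grothendieck_hom_ext fun x => by
        rw [AddMonoidHom.add_apply, grothendieck_lift_of, grothendieck_lift_of,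
          grothendieck_lift_of, map_add, AddMonoidHom.comp_apply, AddMonoidHom.add_apply,
          map_add, AddMonoidHom.comp_apply, AddMonoidHom.comp_apply] }

theorem partialAction_of {α : CStarAction G A} (r : RepClass mu) (x : ProjClass lam α) :
    partialAction mu lam α (Algebra.GrothendieckAddGroup.of r)
      (Algebra.GrothendieckAddGroup.of x) =
      Algebra.GrothendieckAddGroup.of (ProjClass.tensor r x) := by
  unfold partialAction
  rw [grothendieck_lift_of]
  exact grothendieck_lift_of _ x

/-- The element `[1_α]`. -/
def unitClass (α : CStarAction G A) : TwistedK (1 : TwoCocycle G) α :=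
  cls (ProjPair.ofInvariant α 1 (IsStarProjection.one A) fun g => map_one (α.aut g))

/-- The scale `D(α)`: the classes `[(p, π_t)]` of invariant projections `p` of `A`. -/
def scale (α : CStarAction G A) : Set (TwistedK (1 : TwoCocycle G) α) :=
  {x | ∃ (p : A) (hp : IsStarProjection p) (hinv : ∀ g, α.aut g p = p),
    x = cls (ProjPair.ofInvariant α p hp hinv)}

end TwistedK

/-! ### The invariant `Ell` and its homomorphisms -/

/-- A homomorphism `Ell(α) → Ell(β)`: positive group homomorphisms `K₀^lam(α) → K₀^lam(β)`, one for
each 2-cocycle, commuting with all partial actions. -/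
@[ext]
structure EllHom (α : CStarAction G A) (β : CStarAction G B) where
  toHom : ∀ lam : TwoCocycle G, TwistedK lam α →+ TwistedK lam β
  map_positive : ∀ lam, ∀ x ∈ TwistedK.positiveCone lam α,
    toHom lam x ∈ TwistedK.positiveCone lam β
  map_partialAction : ∀ (mu lam : TwoCocycle G) (r : RepGroup mu) (x : TwistedK lam α),
    toHom (mu * lam) (TwistedK.partialAction mu lam α r x) =
      TwistedK.partialAction mu lam β r (toHom lam x)

/-- `Γ` is unital if it sends `[1_α]` to `[1_β]`. -/
def EllHom.Unital {α : CStarAction G A} {β : CStarAction G B} (Γ : EllHom α β) : Prop :=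
  Γ.toHom 1 (TwistedK.unitClass α) = TwistedK.unitClass β

/-- `Γ` is contractive if it maps the scale of `α` into the scale of `β`. -/
def EllHom.Contractive {α : CStarAction G A} {β : CStarAction G B} (Γ : EllHom α β) : Prop :=
  ∀ x ∈ TwistedK.scale α, Γ.toHom 1 x ∈ TwistedK.scale β

/-- An equivariant (not necessarily unital) `*`-homomorphism. -/
structure EquivariantHom (α : CStarAction G A) (β : CStarAction G B) where
  toHom : A →⋆ₙₐ[ℂ] B
  equivariant : ∀ g a, toHom (α.aut g a) = β.aut g (toHom a)

namespace EquivariantHom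

variable {α : CStarAction G A} {β : CStarAction G B} (T : EquivariantHom α β)

theorem map_mul' {ι κ m : Type*} [Fintype κ] (x : Matrix ι κ A) (y : Matrix κ m A) :
    (x * y).map T.toHom = x.map T.toHom * y.map T.toHom := by
  ext i j; simp [Matrix.mul_apply]

theorem map_conjTranspose {ι κ : Type*} (x : Matrix ι κ A) :
    (x.map T.toHom)ᴴ = xᴴ.map T.toHom := by
  ext i j; exact (map_star T.toHom (x j i)).symm

theorem map_invariant {π₁ π₂ : CocycleRep lam} {x : Matrix π₂.ι π₁.ι A}
    (hx : IsGInvariant α π₁ π₂ x) : IsGInvariant β π₁ π₂ (x.map T.toHom) := fun g => by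
  have h1 : ∀ {ι κ m : Type} [Fintype κ] (M : Matrix ι κ ℂ) (y : Matrix κ m A),
      (scalarMat A M * y).map T.toHom = scalarMat B M * y.map T.toHom := by
    intro ι κ m _ M y
    ext i j; simp [Matrix.mul_apply, scalarMat, Algebra.algebraMap_eq_smul_one]
  have h2 : ∀ {ι κ m : Type} [Fintype κ] (M : Matrix κ m ℂ) (y : Matrix ι κ A),
      (y * scalarMat A M).map T.toHom = y.map T.toHom * scalarMat B M := by
    intro ι κ m _ M y
    ext i j; simp [Matrix.mul_apply, scalarMat, Algebra.algebraMap_eq_smul_one]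
  have h3 : (x.map (α.aut g)).map T.toHom = (x.map T.toHom).map (β.aut g) := by
    ext i j; simp [T.equivariant]
  have h4 := congrArg (fun y => y.map T.toHom) (hx g)
  unfold diagAct at h4 ⊢
  simp only [h1, h2, h3] at h4
  exact h4

/-- `(p, π) ↦ ((id ⊗ T)(p), π)`. -/
abbrev mapPair (P : ProjPair lam α) : ProjPair lam β where
  rep := P.rep
  proj := P.proj.map T.toHom
  isProj := by
    refine ⟨?_, ?_⟩
    · change P.proj.map T.toHom * P.proj.map T.toHom = _
      rw [← map_mul', P.proj_mul_proj]
    · change (P.proj.map T.toHom)ᴴ = _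
      rw [map_conjTranspose, P.conjTranspose_proj]
  invariant := T.map_invariant P.invariant

theorem mapPair_congr {P Q : ProjPair lam α} (h : ProjPair.Equivalent P Q) :
    ProjPair.Equivalent (T.mapPair P) (T.mapPair Q) := by
  obtain ⟨U, h1, h2, h3⟩ := h
  refine ⟨U.map T.toHom, T.map_invariant h1, ?_, ?_⟩
  · rw [map_conjTranspose, ← map_mul', h2]
  · rw [map_conjTranspose, ← map_mul', h3]

/-- The induced map `V^lam(α) → V^lam(β)`. -/
def mapClass (lam : TwoCocycle G) : ProjClass lam α →+ ProjClass lam β where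
  toFun := Quotient.map T.mapPair fun _ _ h => T.mapPair_congr h
  map_zero' := Quotient.sound
    (ProjPair.equivalent_of_equiv (Equiv.refl _) (fun _ => rfl) (by ext i; exact i.elim))
  map_add' x y := by
    induction x using Quotient.inductionOn with | _ P
    induction y using Quotient.inductionOn with | _ Q
    refine Quotient.sound
      (ProjPair.equivalent_of_equiv (Equiv.refl _) (fun _ => rfl) ?_)
    ext (i | i) (j | j) <;> simp [mapPair, ProjPair.directSum]

/-- The induced map `K₀^lam(α) → K₀^lam(β)`. -/
def mapK (lam : TwoCocycle G) : TwistedK lam α →+ TwistedK lam β :=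
  Algebra.GrothendieckAddGroup.lift (Algebra.GrothendieckAddGroup.of.comp (T.mapClass lam))

theorem mapK_of (x : ProjClass lam α) : T.mapK lam (Algebra.GrothendieckAddGroup.of x) =
    Algebra.GrothendieckAddGroup.of (T.mapClass lam x) :=
  grothendieck_lift_of _ x

theorem mapClass_tensor (r : RepClass mu) (x : ProjClass lam α) :
    T.mapClass (mu * lam) (ProjClass.tensor r x) =
      ProjClass.tensor r (T.mapClass lam x) := by
  induction r using Quotient.inductionOn with | _ ρ
  induction x using Quotient.inductionOn with | _ P
  refine Quotient.sound (ProjPair.equivalent_of_equiv (Equiv.refl _) (fun _ => rfl) ?_)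
  ext ⟨i, k⟩ ⟨j, l⟩; simp [mapPair, ProjPair.tensor, tensorMat]

/-- The homomorphism `T_* : Ell(α) → Ell(β)` induced by an equivariant homomorphism. -/
def ell : EllHom α β where
  toHom := T.mapK
  map_positive := by
    rintro lam _ ⟨P, rfl⟩
    exact ⟨T.mapPair P, (T.mapK_of (ProjClass.mk P)).symm⟩
  map_partialAction mu lam r x := by
    have key : ((AddMonoidHom.compHom (T.mapK (mu * lam))).comp
          (TwistedK.partialAction mu lam α)) =
        (AddMonoidHom.compHom.flip (T.mapK lam)).comp (TwistedK.partialAction mu lam β) := by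
      refine grothendieck_hom_ext fun r => grothendieck_hom_ext fun x => ?_
      change T.mapK (mu * lam) (TwistedK.partialAction mu lam α _ _) =
        TwistedK.partialAction mu lam β _ (T.mapK lam _)
      rw [TwistedK.partialAction_of, mapK_of, mapK_of, TwistedK.partialAction_of,
        mapClass_tensor]
    exact DFunLike.congr_fun (DFunLike.congr_fun key r) x

end EquivariantHom

end ktheory

/-! ### Projections in finite-dimensional star algebras -/

section StarAlgebra

variable {M : Type*} [Ring M] [StarRing M] [Algebra ℂ M] [StarModule ℂ M]

/-! A finite-dimensional `A` is an orthogonal sum of matrix blocks. The hypothesis forces the action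
to fix each block unit: a spectrally trivial action moves no block, and a full matrix algebra has
only one. On block `i` the action is then `Ad u i` for a Borel projective representation `u i` with
some cocycle `lam i`, which yields a `BlockDecomposition`.

The representation `conj (u i) ⊗ u i` has an invariant unit vector. The projection onto it, read in
matrices over block `i`, is the pair `gen i`, with cocycle the inverse of `lam i`. These pairs
generate the invariant under the partial actions: a pair `(p, π)` living on block `i` is a
projection that commutes with `π ⊗ u i`, and if `σ` is the representation on its range then `[(p,
π)] = [σ] · [gen i]` (`exists_equivalent_tensor_gen`, a form of Frobenius reciprocity). Hence a
homomorphism is determined by its values on the `gen i` (`ellHom_ext`). The choice `σ = u i` gives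
`[1_α] = ∑ [u i] · [gen i]`.

The other ingredient is cancellation: over a finite-dimensional algebra, pairs with the same K-class
are equivalent (`TwistedK.cls_eq_iff`). Morphisms between pairs form a semisimple category, where
the dimensions of the morphism spaces determine an object, and these dimensions are additive, so
they can be read off the K-class.

Existence (`EllHom.exists_equivariantHom`): by positivity `Γ [gen i] = [Q i]`. If `Γ [1_α] = [p]`
for an invariant projection `p` of `B`, then `[p] = ∑ [u i] · [Q i]`, and cancellation turns this
into orthogonal invariant partial isometries `w i` that identify `p` with the sum of the `Q i ⊗ u
i`. The formula `a ↦ ∑ w i (Q i ⊗ a i) (w i)ᴴ` is an equivariant homomorphism that sends `gen i` to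
the class of `Q i`, so it induces `Γ`. Contractivity provides some `p`; unitality provides `p = 1`.

Uniqueness (`EquivariantHom.exists_unitary`): equal classes of the images of `gen i` give an
invariant partial isometry in matrices over `B`, whose rescaled trace intertwines `T₁` and `T₂` on
block `i`. The sum of these is completed to a unitary by cancellation applied to `1 - T₁ 1` and `1 -
T₂ 1`. -/

theorem commute_aeval {M : Type*} [Ring M] [Algebra ℂ M] {a b : M} (h : Commute a b)
    (p : Polynomial ℂ) : Commute (Polynomial.aeval a p) b := by
  induction p using Polynomial.induction_on' with
  | add p q hp hq => rw [map_add]; exact hp.add_left hq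
  | monomial n c =>
    rw [Polynomial.aeval_monomial]
    exact (show Commute _ b from Algebra.commutes c b).mul_left (h.pow_left n)

theorem aeval_mul_of_mul_eq_smul {M : Type*} [Ring M] [Algebra ℂ M] {a x : M} {t : ℂ}
    (h : a * x = t • x) (p : Polynomial ℂ) :
    Polynomial.aeval a p * x = p.eval t • x := by
  induction p using Polynomial.induction_on' with
  | add p q hp hq => simp [add_mul, add_smul, hp, hq]
  | monomial n c =>
    have hn : ∀ n : ℕ, a ^ n * x = t ^ n • x := by
      intro n
      induction n with
      | zero => simp
      | succ n ih => rw [pow_succ, mul_assoc, h, mul_smul_comm, ih, smul_smul, pow_succ, mul_comm]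
    rw [Polynomial.aeval_monomial, Polynomial.eval_monomial, ← Algebra.smul_def,
      smul_mul_assoc, hn, smul_smul]

/-- Left multiplication by `a` preserves `a M ≠ 0` and has an eigenvector `x = a y` there. The
eigenvalue `t` is nonzero, since otherwise `star x * x = star y * (a * x) = 0`, and it is real
because `a` is self-adjoint. Dividing the minimal polynomial of `a` by `X - t` and evaluating at `a`
gives `e ≠ 0` with `a e = t e`, and `f` is a multiple of `star e * e`. No norm is needed, so the
result also serves for invariant matrices over `A`. -/
theorem exists_spectral_projection [FiniteDimensional ℂ M] (hM : ∀ x : M, star x * x = 0 → x = 0)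
    {a : M} (ha : IsSelfAdjoint a) (ha0 : a ≠ 0) :
    ∃ (t : ℂ) (f : M), t ≠ 0 ∧ f ≠ 0 ∧ IsStarProjection f ∧ a * f = t • f ∧ f * a = t • f := by
  have hsa : star a = a := ha
  let L : Module.End ℂ M := LinearMap.mulLeft ℂ a
  let W : Submodule ℂ M := LinearMap.range L
  have hW : ∀ x ∈ W, L x ∈ W := fun x _ => ⟨x, rfl⟩
  have : Nontrivial W := ⟨⟨⟨a, 1, by simp [L]⟩, 0, fun h => ha0 (congrArg Subtype.val h)⟩⟩
  obtain ⟨t, ht⟩ := Module.End.exists_eigenvalue (L.restrict hW)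
  obtain ⟨⟨x, y, hy⟩, hx⟩ := ht.exists_hasEigenvector
  have hx0 : x ≠ 0 := fun h => hx.2 (Subtype.ext h)
  have hxt : a * x = t • x := congrArg Subtype.val hx.apply_eq_smul
  have hyx : a * y = x := hy
  have hxx : star x * x ≠ 0 := fun h => hx0 (hM x h)
  have ht0 : t ≠ 0 := by
    rintro rfl
    apply hxx
    rw [zero_smul] at hxt
    calc star x * x = star y * (a * x) := by rw [← hyx, star_mul, hsa]; simp only [mul_assoc]
      _ = 0 := by rw [hxt, mul_zero]
  have htr : star t = t := by
    have h1 : star x * (a * x) = t • (star x * x) := by rw [hxt, mul_smul_comm]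
    have h2 := congrArg star h1
    rw [star_smul, star_mul, star_mul, star_mul, star_star, hsa, mul_assoc, h1] at h2
    exact (smul_left_injective ℂ hxx h2).symm
  have hint : IsIntegral ℂ a := Algebra.IsIntegral.isIntegral a
  have hroot : (minpoly ℂ a).IsRoot t := by
    have h1 := aeval_mul_of_mul_eq_smul hxt (minpoly ℂ a)
    rw [minpoly.aeval, zero_mul] at h1
    exact (smul_eq_zero.1 h1.symm).resolve_right hx0
  obtain ⟨h, hh⟩ := Polynomial.dvd_iff_isRoot.2 hroot
  have hh0 : h ≠ 0 := by rintro rfl; exact minpoly.ne_zero hint (by rw [hh, mul_zero])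
  set e := Polynomial.aeval a h with he
  have he0 : e ≠ 0 := by
    intro h0
    have h1 := Polynomial.natDegree_le_of_dvd (minpoly.dvd ℂ a h0) hh0
    rw [hh, Polynomial.natDegree_mul (Polynomial.X_sub_C_ne_zero t) hh0,
      Polynomial.natDegree_X_sub_C] at h1
    omega
  have hae : a * e = t • e := by
    have h1 := minpoly.aeval ℂ a
    rw [hh, map_mul, map_sub, Polynomial.aeval_X, Polynomial.aeval_C, sub_mul, sub_eq_zero,
      ← Algebra.smul_def] at h1
    exact h1
  have hcomm : ∀ b : M, Commute a b → Commute e b := fun b hb => commute_aeval hb h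
  have hsea : star e * a = a * star e := by
    have h1 := congrArg star (hcomm a (Commute.refl a)).eq
    rwa [star_mul, star_mul, hsa, eq_comm] at h1
  have hese : e * star e = star e * e := (hcomm _ hsea.symm).eq
  set f₀ := star e * e with hf₀
  have hf0 : f₀ ≠ 0 := fun h => he0 (hM e h)
  have hsf : star f₀ = f₀ := by rw [hf₀, star_mul, star_star]
  have haf : a * f₀ = t • f₀ := by rw [hf₀, ← mul_assoc, ← hsea, mul_assoc, hae, mul_smul_comm]
  have hef : e * f₀ = h.eval t • f₀ := aeval_mul_of_mul_eq_smul haf h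
  have hfe : f₀ * star e = star (h.eval t) • f₀ := by
    have h1 := congrArg star hef
    rwa [star_mul, star_smul, hsf] at h1
  have hef' : star e * f₀ = f₀ * star e := by
    rw [hf₀, mul_assoc (star e) e, hese, hf₀]
  set s : ℂ := star (h.eval t) * h.eval t with hs
  have hff : f₀ * f₀ = s • f₀ := by
    calc f₀ * f₀ = star e * (e * f₀) := by rw [hf₀]; simp only [mul_assoc]
      _ = s • f₀ := by rw [hef, mul_smul_comm, hef', hfe, smul_smul, mul_comm]
  have hs0 : s ≠ 0 := by
    intro h0
    rw [h0, zero_smul] at hff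
    exact hf0 (hM f₀ (by rw [hsf, hff]))
  have hsr : star s = s := by rw [hs, star_mul, star_star]
  have haf' : f₀ * a = t • f₀ := by
    have h1 := congrArg star haf
    rwa [star_mul, star_smul, hsf, hsa, htr] at h1
  refine ⟨t, s⁻¹ • f₀, ht0, smul_ne_zero (inv_ne_zero hs0) hf0, ⟨?_, ?_⟩, ?_, ?_⟩
  · change s⁻¹ • f₀ * s⁻¹ • f₀ = s⁻¹ • f₀
    rw [smul_mul_smul_comm, hff, smul_smul, mul_assoc, inv_mul_cancel₀ hs0, mul_one]
  · change star (s⁻¹ • f₀) = _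
    rw [star_smul, hsf, star_inv₀, hsr]
  · rw [mul_smul_comm, haf, smul_comm]
  · rw [smul_mul_assoc, haf', smul_comm]

/-- Among the nonzero projections below `p`, take `c` with `c M c` of least dimension. A nonzero
self-adjoint `b` in `c M c` has a spectral projection `f ≤ c`; minimality gives `f M f = c M c`, so
`c = f` and `b` is a multiple of `c`. A general element is split into real and imaginary parts. -/
theorem exists_minimal_projection [FiniteDimensional ℂ M] (hM : ∀ x : M, star x * x = 0 → x = 0)
    {p : M} (hp : IsStarProjection p) (hp0 : p ≠ 0) :
    ∃ c : M, IsStarProjection c ∧ c ≠ 0 ∧ p * c = c ∧ ∀ a, ∃ t : ℂ, c * a * c = t • c := by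
  let F : M → M →ₗ[ℂ] M := fun c => LinearMap.mulLeft ℂ c ∘ₗ LinearMap.mulRight ℂ c
  have hF : ∀ c x, F c x = c * x * c := fun c x => (mul_assoc c x c).symm
  let d : M → ℕ := fun c => Module.finrank ℂ (LinearMap.range (F c))
  let S : Set M := {c | IsStarProjection c ∧ c ≠ 0 ∧ p * c = c}
  obtain ⟨c, ⟨hc, hc0, hpc⟩, hmin⟩ := (InvImage.wf d Nat.lt_wfRel.wf).has_min S
    ⟨p, hp, hp0, hp.isIdempotentElem⟩
  have hcc : c * c = c := hc.isIdempotentElem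
  have hsc : star c = c := hc.isSelfAdjoint
  have key : ∀ b : M, IsSelfAdjoint b → c * b = b → b * c = b → ∃ t : ℂ, b = t • c := by
    intro b hb hcb hbc
    by_cases hb0 : b = 0
    · exact ⟨0, by simp [hb0]⟩
    obtain ⟨t, f, ht0, hf0, hf, hbf, hfb⟩ := exists_spectral_projection hM hb hb0
    have hff : f * f = f := hf.isIdempotentElem
    have hcf : c * f = f := by
      have h1 : c * (b * f) = b * f := by rw [← mul_assoc, hcb]
      rw [hbf, mul_smul_comm] at h1
      exact smul_right_injective M ht0 h1
    have hfc : f * c = f := by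
      have h1 : f * b * c = f * b := by rw [mul_assoc, hbc]
      rw [hfb, smul_mul_assoc] at h1
      exact smul_right_injective M ht0 h1
    have hle : LinearMap.range (F f) ≤ LinearMap.range (F c) := by
      rintro _ ⟨x, rfl⟩
      refine ⟨F f x, ?_⟩
      rw [hF, hF, mul_assoc, mul_assoc, hfc, ← mul_assoc, ← mul_assoc, hcf]
    have hge : ¬ LinearMap.range (F f) < LinearMap.range (F c) := fun hlt =>
      hmin f ⟨hf, hf0, by rw [← hcf, ← mul_assoc, hpc]⟩ (Submodule.finrank_lt_finrank_of_lt hlt)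
    have hmem : c ∈ LinearMap.range (F f) := by
      rw [eq_of_le_of_not_lt hle hge]
      exact ⟨c, by rw [hF, hcc, hcc]⟩
    obtain ⟨x, hx⟩ := hmem
    have hcf' : c = f := by
      rw [← hcf, ← hx, hF]
      simp only [mul_assoc, hff]
    exact ⟨t, by rw [← hbc, hcf', hbf]⟩
  refine ⟨c, hc, hc0, hpc, fun a => ?_⟩
  set b := c * a * c with hb
  have hcb : c * b = b := by rw [hb, ← mul_assoc, ← mul_assoc, hcc]
  have hbc : b * c = b := by rw [hb, mul_assoc, hcc]
  have hcb' : c * star b = star b := by rw [← hsc, ← star_mul, hbc]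
  have hbc' : star b * c = star b := by nth_rw 1 [← hsc]; rw [← star_mul, hcb]
  obtain ⟨t₁, h₁⟩ := key (b + star b) (by simp [IsSelfAdjoint, add_comm])
    (by rw [mul_add, hcb, hcb']) (by rw [add_mul, hbc, hbc'])
  -- The factor `I` makes the skew-adjoint part self-adjoint; `2 b` is then recovered as `(b + star
  -- b) + (b - star b)`.
  obtain ⟨t₂, h₂⟩ := key (Complex.I • (b - star b)) (by
      simp only [IsSelfAdjoint, star_smul, star_sub, star_star, Complex.star_def, Complex.conj_I]
      rw [neg_smul, ← smul_neg, neg_sub])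
    (by rw [mul_smul_comm, mul_sub, hcb, hcb']) (by rw [smul_mul_assoc, sub_mul, hbc, hbc'])
  refine ⟨(1 / 2 : ℂ) * (t₁ - Complex.I * t₂), ?_⟩
  have h3 : b - star b = -(Complex.I * t₂) • c := by
    rw [neg_smul, mul_smul, ← h₂, smul_smul, Complex.I_mul_I, neg_one_smul, neg_neg]
  have h4 : (2 : ℂ) • b = (t₁ - Complex.I * t₂) • c := by
    rw [sub_eq_add_neg, add_smul, ← h₁, ← h3, two_smul]; abel
  rw [mul_smul, ← h4, smul_smul]; norm_num

/-- If `s = t • c` is self-adjoint, nonzero and no sum `s + y⋆y` vanishes, then `t > 0`. -/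
theorem exists_pos_of_eq_smul_projection {c s : M} {t : ℂ} (hc : IsStarProjection c)
    (hs : IsSelfAdjoint s) (hst : s = t • c) (hs0 : s ≠ 0)
    (hpos : ∀ y : M, s + star y * y = 0 → s = 0) : ∃ r : ℝ, 0 < r ∧ t = (r : ℂ) := by
  have hc0 : c ≠ 0 := by rintro rfl; exact hs0 (by rw [hst, smul_zero])
  have hsc : star c = c := hc.isSelfAdjoint
  have htr : star t = t := by
    have h1 : star s = s := hs
    rw [hst, star_smul, hsc] at h1
    exact smul_left_injective ℂ hc0 h1
  obtain ⟨r, rfl⟩ := Complex.conj_eq_iff_real.1 htr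
  refine ⟨r, ?_, rfl⟩
  by_contra! hr
  -- If `t = r ≤ 0`, then `y = √(-r) c` has `star y * y = -r c`, which cancels `s`.
  refine hs0 (hpos ((Real.sqrt (-r) : ℂ) • c) ?_)
  rw [star_smul, hsc, smul_mul_smul_comm, hc.isIdempotentElem.eq, hst, ← add_smul,
    Complex.star_def, Complex.conj_ofReal, ← Complex.ofReal_mul, Real.mul_self_sqrt (by linarith)]
  simp

end StarAlgebra

/-! ### Positivity of matrices over a C*-algebra -/

section

variable {A : Type u} [CStarAlgebra A]

theorem eq_zero_of_sum_star_mul_self_eq_zero {ι : Type*} {s : Finset ι} {x : ι → A}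
    (h : ∑ i ∈ s, star (x i) * x i = 0) : ∀ i ∈ s, x i = 0 := by
  let _ : PartialOrder A := CStarAlgebra.spectralOrder A
  have _ : StarOrderedRing A := CStarAlgebra.spectralOrderedRing A
  intro i hi
  have := (Finset.sum_eq_zero_iff_of_nonneg fun i _ => star_mul_self_nonneg (x i)).1 h i hi
  exact CStarRing.star_mul_self_eq_zero_iff _ |>.1 this

/-- The diagonal entry at `j` is a sum of terms `star a * a` over the `j`-th columns of `x` and `y`,
so positivity in `A` suffices and matrices over `A` need neither a norm nor an order. -/
theorem eq_zero_of_conjTranspose_mul_add {κ κ' ι : Type*} [Fintype κ] [Fintype κ']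
    {x : Matrix κ ι A} {y : Matrix κ' ι A} (h : xᴴ * x + yᴴ * y = 0) : x = 0 := by
  ext i j
  have h1 := congrFun (congrFun h j) j
  simp only [Matrix.add_apply, Matrix.mul_apply, conjTranspose_apply, Matrix.zero_apply] at h1
  have h2 : ∑ k : κ ⊕ κ', star (Sum.elim (fun i => x i j) (fun i => y i j) k) *
      Sum.elim (fun i => x i j) (fun i => y i j) k = 0 := by
    rw [Fintype.sum_sum_type]; exact h1
  exact eq_zero_of_sum_star_mul_self_eq_zero h2 (Sum.inl i) (Finset.mem_univ _)

theorem eq_zero_of_conjTranspose_mul_self {κ ι : Type*} [Fintype κ]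
    {x : Matrix κ ι A} (h : xᴴ * x = 0) : x = 0 :=
  eq_zero_of_conjTranspose_mul_add (y := (0 : Matrix Empty ι A)) (by rw [h]; simp)

end

/-! ### Invariant intertwiners -/

section

variable {G : Type w} [Group G] [TopologicalSpace G] {A : Type u} [CStarAlgebra A]
  {lam mu : TwoCocycle G} {α : CStarAction G A}

theorem IsGInvariant.zero (π₁ π₂ : CocycleRep lam) : IsGInvariant α π₁ π₂ 0 := fun g => by
  have h : (0 : Matrix π₂.ι π₁.ι A).map (α.aut g) = 0 := by ext i j; simp
  rw [diagAct, h, Matrix.mul_zero, Matrix.zero_mul]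

theorem IsGInvariant.add {π₁ π₂ : CocycleRep lam} {x y : Matrix π₂.ι π₁.ι A}
    (hx : IsGInvariant α π₁ π₂ x) (hy : IsGInvariant α π₁ π₂ y) :
    IsGInvariant α π₁ π₂ (x + y) := fun g => by
  have h : (x + y).map (α.aut g) = x.map (α.aut g) + y.map (α.aut g) := by ext i j; simp
  have h1 := hx g
  have h2 := hy g
  unfold diagAct at h1 h2 ⊢
  rw [h, Matrix.mul_add, Matrix.add_mul, h1, h2]

theorem IsGInvariant.smul {π₁ π₂ : CocycleRep lam} {x : Matrix π₂.ι π₁.ι A} (t : ℂ)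
    (hx : IsGInvariant α π₁ π₂ x) : IsGInvariant α π₁ π₂ (t • x) := fun g => by
  have h : (t • x).map (α.aut g) = t • x.map (α.aut g) := by ext i j; simp
  have h1 := hx g
  unfold diagAct at h1 ⊢
  rw [h, Matrix.mul_smul, Matrix.smul_mul, h1]

theorem IsGInvariant.sub {π₁ π₂ : CocycleRep lam} {x y : Matrix π₂.ι π₁.ι A}
    (hx : IsGInvariant α π₁ π₂ x) (hy : IsGInvariant α π₁ π₂ y) :
    IsGInvariant α π₁ π₂ (x - y) := by
  rw [sub_eq_add_neg, ← neg_one_smul ℂ y]; exact hx.add (hy.smul _)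

theorem IsGInvariant.scalarMat {π₁ π₂ : CocycleRep lam} {W : Matrix π₂.ι π₁.ι ℂ}
    (hW : ∀ g, π₂.mat g * W = W * π₁.mat g) :
    IsGInvariant α π₁ π₂ (scalarMat A W) := fun g => by
  have h : (_root_.scalarMat A W).map (α.aut g) = _root_.scalarMat A W := by
    ext i j; simp [_root_.scalarMat, Algebra.algebraMap_eq_smul_one]
  rw [diagAct, h, ← scalarMat_mul, ← scalarMat_mul, hW, Matrix.mul_assoc,
    π₁.mat_mul_conjTranspose, Matrix.mul_one]

theorem IsGInvariant.one (π : CocycleRep lam) : IsGInvariant α π π 1 := by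
  rw [← scalarMat_one]; exact IsGInvariant.scalarMat fun g => by simp

/-- The `*`-algebra of invariant elements of `L(H) ⊗ A`. -/
def invariantSubalgebra (α : CStarAction G A) (π : CocycleRep lam) :
    StarSubalgebra ℂ (Matrix π.ι π.ι A) where
  carrier := {x | IsGInvariant α π π x}
  mul_mem' hx hy := hx.mul hy
  add_mem' hx hy := hx.add hy
  algebraMap_mem' t := by
    rw [Algebra.algebraMap_eq_smul_one]; exact (IsGInvariant.one π).smul t
  star_mem' hx := hx.conjTranspose

instance [FiniteDimensional ℂ A] (π : CocycleRep lam) :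
    FiniteDimensional ℂ (invariantSubalgebra α π) :=
  FiniteDimensional.finiteDimensional_submodule
    (Subalgebra.toSubmodule (invariantSubalgebra α π).toSubalgebra)

/-- Expanding `(U p - U)ᴴ (U p - U)` gives `p - p - p + p = 0`. -/
theorem mul_eq_self_of_conjTranspose_mul {ι κ : Type*} [Fintype ι] [Fintype κ]
    {U : Matrix κ ι A} {p : Matrix ι ι A} (hp : IsStarProjection p) (h : Uᴴ * U = p) :
    U * p = U := by
  have hpp : p * p = p := hp.isIdempotentElem
  have hsp : pᴴ = p := hp.isSelfAdjoint
  have h1 : (U * p - U)ᴴ * (U * p - U) = 0 := by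
    rw [conjTranspose_sub, conjTranspose_mul, hsp, Matrix.sub_mul, Matrix.mul_sub, Matrix.mul_sub,
      Matrix.mul_assoc p, ← Matrix.mul_assoc Uᴴ U, h, hpp, hpp, Matrix.mul_assoc p, h, hpp]
    simp
  exact sub_eq_zero.1 (eq_zero_of_conjTranspose_mul_self h1)

/-! ### Morphism spaces between pairs and orthogonal sums. -/

namespace ProjPair

/-- The invariant elements `x` of `L(H₁, H₂) ⊗ A` with `x = p₂ x p₁`. -/
def homs (P Q : ProjPair lam α) : Submodule ℂ (Matrix Q.rep.ι P.rep.ι A) where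
  carrier := {x | IsGInvariant α P.rep Q.rep x ∧ Q.proj * x = x ∧ x * P.proj = x}
  add_mem' := by
    rintro x y ⟨h1, h2, h3⟩ ⟨k1, k2, k3⟩
    exact ⟨h1.add k1, by rw [Matrix.mul_add, h2, k2], by rw [Matrix.add_mul, h3, k3]⟩
  zero_mem' := ⟨IsGInvariant.zero _ _, Matrix.mul_zero _, Matrix.zero_mul _⟩
  smul_mem' := by
    rintro t x ⟨h1, h2, h3⟩
    exact ⟨h1.smul t, by rw [Matrix.mul_smul, h2], by rw [Matrix.smul_mul, h3]⟩

theorem homs_mul {P Q R : ProjPair lam α} {x : Matrix Q.rep.ι P.rep.ι A}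
    {y : Matrix R.rep.ι Q.rep.ι A} (hx : x ∈ homs P Q) (hy : y ∈ homs Q R) :
    y * x ∈ homs P R :=
  ⟨hy.1.mul hx.1, by rw [← Matrix.mul_assoc, hy.2.1], by rw [Matrix.mul_assoc, hx.2.2]⟩

theorem homs_conjTranspose {P Q : ProjPair lam α} {x : Matrix Q.rep.ι P.rep.ι A}
    (hx : x ∈ homs P Q) : xᴴ ∈ homs Q P :=
  ⟨hx.1.conjTranspose, by
    rw [← P.conjTranspose_proj, ← conjTranspose_mul, hx.2.2], by
    nth_rw 1 [← Q.conjTranspose_proj]; rw [← conjTranspose_mul, hx.2.1]⟩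

theorem proj_mem_homs (P : ProjPair lam α) : P.proj ∈ homs P P :=
  ⟨P.invariant, P.proj_mul_proj, P.proj_mul_proj⟩

theorem mem_homs_of_partialIsometry {P Q : ProjPair lam α} {U : Matrix Q.rep.ι P.rep.ι A}
    (h : IsGInvariant α P.rep Q.rep U) (h1 : Uᴴ * U = P.proj) (h2 : Q.proj * U = U) :
    U ∈ homs P Q :=
  ⟨h, h2, mul_eq_self_of_conjTranspose_mul P.isProj h1⟩

theorem mem_homs_of_equivalent {P Q : ProjPair lam α} {U : Matrix Q.rep.ι P.rep.ι A}
    (h : IsGInvariant α P.rep Q.rep U) (h1 : Uᴴ * U = P.proj) (h2 : U * Uᴴ = Q.proj) :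
    U ∈ homs P Q := by
  refine mem_homs_of_partialIsometry h h1 ?_
  rw [← h2, Matrix.mul_assoc, h1]
  exact mul_eq_self_of_conjTranspose_mul P.isProj h1

/-- `V` and `W` exhibit `R` as the orthogonal sum of copies of `P` and `Q`. -/
structure IsOrthogonalSum (P Q R : ProjPair lam α) (V : Matrix R.rep.ι P.rep.ι A)
    (W : Matrix R.rep.ι Q.rep.ι A) : Prop where
  left_mem : V ∈ homs P R
  right_mem : W ∈ homs Q R
  left_isometry : Vᴴ * V = P.proj
  right_isometry : Wᴴ * W = Q.proj
  orthogonal : Vᴴ * W = 0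
  sum_eq : V * Vᴴ + W * Wᴴ = R.proj

theorem IsOrthogonalSum.orthogonal' {P Q R : ProjPair lam α} {V : Matrix R.rep.ι P.rep.ι A}
    {W : Matrix R.rep.ι Q.rep.ι A} (h : IsOrthogonalSum P Q R V W) : Wᴴ * V = 0 := by
  rw [← conjTranspose_conjTranspose V, ← conjTranspose_mul, h.orthogonal, conjTranspose_zero]

/-- The inclusion of the first summand. -/
def inl (P Q : ProjPair lam α) : Matrix (P.directSum Q).rep.ι P.rep.ι A :=
  Matrix.of (Sum.elim P.proj fun _ _ => 0)

/-- The inclusion of the second summand. -/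
def inr (P Q : ProjPair lam α) : Matrix (P.directSum Q).rep.ι Q.rep.ι A :=
  Matrix.of (Sum.elim (fun _ _ => 0) Q.proj)

theorem isOrthogonalSum_directSum (P Q : ProjPair lam α) :
    IsOrthogonalSum P Q (P.directSum Q) (inl P Q) (inr P Q) := by
  have e1 : inl P Q = Matrix.fromRows P.proj 0 := by ext (i | i) j <;> rfl
  have e2 : inr P Q = Matrix.fromRows 0 Q.proj := by ext (i | i) j <;> rfl
  have hl : IsGInvariant α P.rep (P.directSum Q).rep (inl P Q) := by
    -- `inl` factors as the scalar inclusion of the first summand, which intertwines the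
    -- representations, after the invariant matrix `P.proj`.
    have h1 : IsGInvariant α P.rep (P.rep.directSum Q.rep)
        (_root_.scalarMat A (Matrix.fromRows 1 0)) :=
      IsGInvariant.scalarMat fun g => by
        simp only [CocycleRep.directSum]
        rw [Matrix.fromRows_mul, fromBlocks_mul_fromRows]
        simp
    have h2 := h1.mul P.invariant
    convert h2 using 1
    rw [e1]
    ext (i | i) j <;> simp [_root_.scalarMat, Matrix.mul_apply, Matrix.one_apply]
  have hr : IsGInvariant α Q.rep (P.directSum Q).rep (inr P Q) := by
    have h1 : IsGInvariant α Q.rep (P.rep.directSum Q.rep)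
        (_root_.scalarMat A (Matrix.fromRows 0 1)) :=
      IsGInvariant.scalarMat fun g => by
        simp only [CocycleRep.directSum]
        rw [Matrix.fromRows_mul, fromBlocks_mul_fromRows]
        simp
    have h2 := h1.mul Q.invariant
    convert h2 using 1
    rw [e2]
    ext (i | i) j <;> simp [_root_.scalarMat, Matrix.mul_apply, Matrix.one_apply]
  have i1 : (inl P Q)ᴴ * inl P Q = P.proj := by
    rw [e1, conjTranspose_fromRows_eq_fromCols_conjTranspose, fromCols_mul_fromRows]
    simp [conjTranspose_proj, proj_mul_proj]
  have i2 : (inr P Q)ᴴ * inr P Q = Q.proj := by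
    rw [e2, conjTranspose_fromRows_eq_fromCols_conjTranspose, fromCols_mul_fromRows]
    simp [conjTranspose_proj, proj_mul_proj]
  refine ⟨mem_homs_of_partialIsometry hl i1 ?_, mem_homs_of_partialIsometry hr i2 ?_, i1, i2,
    ?_, ?_⟩
  · change fromBlocks P.proj 0 0 Q.proj * inl P Q = _
    rw [e1, fromBlocks_mul_fromRows]; simp [proj_mul_proj]
  · change fromBlocks P.proj 0 0 Q.proj * inr P Q = _
    rw [e2, fromBlocks_mul_fromRows]; simp [proj_mul_proj]
  · rw [e1, e2, conjTranspose_fromRows_eq_fromCols_conjTranspose, fromCols_mul_fromRows]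
    simp
  · change _ = fromBlocks P.proj 0 0 Q.proj
    rw [e1, e2, conjTranspose_fromRows_eq_fromCols_conjTranspose,
      conjTranspose_fromRows_eq_fromCols_conjTranspose, fromRows_mul_fromCols,
      fromRows_mul_fromCols, fromBlocks_add]
    simp [conjTranspose_proj, proj_mul_proj]

/-- The equivalence carries the summands of `P ⊕ Q` onto those of `R`: it is `V inlᴴ + W inrᴴ`,
whose cross terms vanish by orthogonality. -/
theorem IsOrthogonalSum.mk_eq {P Q R : ProjPair lam α} {V : Matrix R.rep.ι P.rep.ι A}
    {W : Matrix R.rep.ι Q.rep.ι A} (h : IsOrthogonalSum P Q R V W) :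
    ProjClass.mk R = ProjClass.mk P + ProjClass.mk Q := by
  rw [ProjClass.mk_add]
  have k := isOrthogonalSum_directSum P Q
  refine Eq.symm (Quotient.sound ⟨V * (inl P Q)ᴴ + W * (inr P Q)ᴴ,
    ((homs_mul (homs_conjTranspose k.left_mem) h.left_mem).1.add
      (homs_mul (homs_conjTranspose k.right_mem) h.right_mem).1), ?_, ?_⟩)
  · have h1 := k.left_mem.2.2
    have h2 := k.right_mem.2.2
    calc (V * (inl P Q)ᴴ + W * (inr P Q)ᴴ)ᴴ * (V * (inl P Q)ᴴ + W * (inr P Q)ᴴ)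
        = inl P Q * (Vᴴ * V) * (inl P Q)ᴴ + inl P Q * (Vᴴ * W) * (inr P Q)ᴴ +
          (inr P Q * (Wᴴ * V) * (inl P Q)ᴴ + inr P Q * (Wᴴ * W) * (inr P Q)ᴴ) := by
          rw [conjTranspose_add, conjTranspose_mul, conjTranspose_mul, conjTranspose_conjTranspose,
            conjTranspose_conjTranspose]
          simp only [Matrix.add_mul, Matrix.mul_add, Matrix.mul_assoc]
          abel
      _ = (P.directSum Q).proj := by
          rw [h.left_isometry, h.right_isometry, h.orthogonal, h.orthogonal', h1, h2, ← k.sum_eq]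
          simp
  · have h1 := h.left_mem.2.2
    have h2 := h.right_mem.2.2
    calc (V * (inl P Q)ᴴ + W * (inr P Q)ᴴ) * (V * (inl P Q)ᴴ + W * (inr P Q)ᴴ)ᴴ
        = V * ((inl P Q)ᴴ * inl P Q) * Vᴴ + V * ((inl P Q)ᴴ * inr P Q) * Wᴴ +
          (W * ((inr P Q)ᴴ * inl P Q) * Vᴴ + W * ((inr P Q)ᴴ * inr P Q) * Wᴴ) := by
          rw [conjTranspose_add, conjTranspose_mul, conjTranspose_mul, conjTranspose_conjTranspose,
            conjTranspose_conjTranspose]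
          simp only [Matrix.add_mul, Matrix.mul_add, Matrix.mul_assoc]
          abel
      _ = R.proj := by
          rw [k.left_isometry, k.right_isometry, k.orthogonal, k.orthogonal', h1, h2, ← h.sum_eq]
          simp

/-- The pair `(q, π)` for an invariant projection `q` over the representation of `P`. -/
abbrev withProj (P : ProjPair lam α) (q : Matrix P.rep.ι P.rep.ι A) (hq : IsStarProjection q)
    (hinv : IsGInvariant α P.rep P.rep q) : ProjPair lam α :=
  ⟨P.rep, q, hq, hinv⟩

/-- If `V` embeds `P` in `R` then `R` is the orthogonal sum of `P` and the complement. -/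
theorem exists_complement {P R : ProjPair lam α} {V : Matrix R.rep.ι P.rep.ι A}
    (hV : V ∈ homs P R) (h : Vᴴ * V = P.proj) :
    ∃ (hq : IsStarProjection (R.proj - V * Vᴴ))
      (hinv : IsGInvariant α R.rep R.rep (R.proj - V * Vᴴ)),
      IsOrthogonalSum P (R.withProj _ hq hinv) R V (R.proj - V * Vᴴ) := by
  have h1 : V * Vᴴ * (V * Vᴴ) = V * Vᴴ := by
    calc V * Vᴴ * (V * Vᴴ) = V * (Vᴴ * V) * Vᴴ := by simp only [Matrix.mul_assoc]
      _ = V * Vᴴ := by rw [h, hV.2.2]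
  have h2 : R.proj * (V * Vᴴ) = V * Vᴴ := by rw [← Matrix.mul_assoc, hV.2.1]
  have h3 : V * Vᴴ * R.proj = V * Vᴴ := by
    rw [Matrix.mul_assoc, (homs_conjTranspose hV).2.2]
  have h4 : (R.proj - V * Vᴴ)ᴴ = R.proj - V * Vᴴ := by
    rw [conjTranspose_sub, conjTranspose_mul, conjTranspose_conjTranspose, conjTranspose_proj]
  have h5 : (R.proj - V * Vᴴ) * (R.proj - V * Vᴴ) = R.proj - V * Vᴴ := by
    rw [Matrix.sub_mul, Matrix.mul_sub, Matrix.mul_sub, proj_mul_proj, h1, h2, h3]; simp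
  have h6 : IsGInvariant α R.rep R.rep (R.proj - V * Vᴴ) :=
    R.invariant.sub (hV.1.mul hV.1.conjTranspose)
  have h7 : R.proj * (R.proj - V * Vᴴ) = R.proj - V * Vᴴ := by
    rw [Matrix.mul_sub, proj_mul_proj, h2]
  refine ⟨⟨h5, h4⟩, h6, hV, ⟨h6, h7, h5⟩, h, by rw [h4, h5], ?_, ?_⟩
  · rw [Matrix.mul_sub, (homs_conjTranspose hV).2.2, ← Matrix.mul_assoc, h,
      (homs_conjTranspose hV).2.1, sub_self]
  · rw [h4, h5]; simp

/-! ### Dimensions of morphism spaces. -/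

section dimension

variable [FiniteDimensional ℂ A]

/-- The dimension of the space of morphisms from `D` to `P`. -/
def homDim (D P : ProjPair lam α) : ℕ := Module.finrank ℂ (homs D P)

/-- Composition with a partial isometry from `P` to `Q` is injective on morphisms into `P`, because
`Uᴴ U = P.proj` acts on them as the identity. Symmetry of equivalence upgrades this to equality. -/
theorem homDim_le {D P Q : ProjPair lam α} (h : Equivalent P Q) : homDim D P ≤ homDim D Q := by
  obtain ⟨U, h1, h2, h3⟩ := h
  have hU := mem_homs_of_equivalent h1 h2 h3
  refine LinearMap.finrank_le_finrank_of_injective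
    (f := ({ toFun := fun x => ⟨U * x.1, homs_mul x.2 hU⟩
             map_add' := fun x y => Subtype.ext (Matrix.mul_add _ _ _)
             map_smul' := fun t x => Subtype.ext (Matrix.mul_smul _ _ _) } :
      homs D P →ₗ[ℂ] homs D Q)) ?_
  intro x y hxy
  have h4 : U * x.1 = U * y.1 := congrArg Subtype.val hxy
  have h5 := congrArg (fun z => Uᴴ * z) h4
  simp only [← Matrix.mul_assoc, h2] at h5
  rw [x.2.2.1, y.2.2.1] at h5
  exact Subtype.ext h5

theorem homDim_directSum (D P Q : ProjPair lam α) :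
    homDim D (P.directSum Q) = homDim D P + homDim D Q := by
  have k := isOrthogonalSum_directSum P Q
  unfold homDim
  rw [← Module.finrank_prod]
  have hl := homs_conjTranspose k.left_mem
  have hr := homs_conjTranspose k.right_mem
  refine LinearEquiv.finrank_eq
    { toFun := fun x => (⟨(inl P Q)ᴴ * x.1, homs_mul x.2 hl⟩, ⟨(inr P Q)ᴴ * x.1, homs_mul x.2 hr⟩)
      map_add' := fun x y => Prod.ext (Subtype.ext (Matrix.mul_add _ _ _))
        (Subtype.ext (Matrix.mul_add _ _ _))
      map_smul' := fun t x => Prod.ext (Subtype.ext (Matrix.mul_smul _ _ _))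
        (Subtype.ext (Matrix.mul_smul _ _ _))
      invFun := fun y => ⟨inl P Q * y.1.1 + inr P Q * y.2.1,
        (homs D _).add_mem (homs_mul y.1.2 k.left_mem) (homs_mul y.2.2 k.right_mem)⟩
      left_inv := fun x => Subtype.ext ?_
      right_inv := fun y => Prod.ext (Subtype.ext ?_) (Subtype.ext ?_) }
  · change inl P Q * ((inl P Q)ᴴ * x.1) + inr P Q * ((inr P Q)ᴴ * x.1) = x.1
    rw [← Matrix.mul_assoc, ← Matrix.mul_assoc, ← Matrix.add_mul, k.sum_eq, x.2.2.1]
  · change (inl P Q)ᴴ * (inl P Q * y.1.1 + inr P Q * y.2.1) = y.1.1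
    rw [Matrix.mul_add, ← Matrix.mul_assoc, ← Matrix.mul_assoc, k.left_isometry, k.orthogonal,
      y.1.2.2.1, Matrix.zero_mul, add_zero]
  · change (inr P Q)ᴴ * (inl P Q * y.1.1 + inr P Q * y.2.1) = y.2.1
    rw [Matrix.mul_add, ← Matrix.mul_assoc, ← Matrix.mul_assoc, k.right_isometry, k.orthogonal',
      y.2.2.2.1, Matrix.zero_mul, zero_add]

end dimension

end ProjPair

namespace ProjClass

variable [FiniteDimensional ℂ A]

/-- `ProjPair.homDim` as an additive function of the class of its second argument. -/
def homDim (D : ProjPair lam α) : ProjClass lam α →+ ℤ where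
  toFun := Quotient.lift (fun P => (ProjPair.homDim D P : ℤ)) fun P Q h => by
    exact congrArg Nat.cast (le_antisymm (ProjPair.homDim_le h)
      (ProjPair.homDim_le (ProjPair.equivalent_equivalence.symm h)))
  map_zero' := by
    change ((ProjPair.homDim D (ProjPair.zero lam α) : ℕ) : ℤ) = 0
    have : Subsingleton (ProjPair.homs D (ProjPair.zero lam α)) :=
      ⟨fun x y => Subtype.ext (by ext i; exact i.elim)⟩
    exact_mod_cast Module.finrank_zero_of_subsingleton
  map_add' x y := by
    induction x using Quotient.inductionOn with | _ P
    induction y using Quotient.inductionOn with | _ Q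
    exact (congrArg Nat.cast (ProjPair.homDim_directSum D P Q)).trans (Nat.cast_add _ _)

theorem homDim_mk (D P : ProjPair lam α) : homDim D (mk P) = ProjPair.homDim D P := rfl

end ProjClass

namespace ProjPair

variable [FiniteDimensional ℂ A]

theorem IsOrthogonalSum.homDim_eq {P Q R : ProjPair lam α} {V : Matrix R.rep.ι P.rep.ι A}
    {W : Matrix R.rep.ι Q.rep.ι A} (h : IsOrthogonalSum P Q R V W) (D : ProjPair lam α) :
    homDim D R = homDim D P + homDim D Q := by
  have h1 := congrArg (ProjClass.homDim D) h.mk_eq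
  rw [map_add, ProjClass.homDim_mk, ProjClass.homDim_mk, ProjClass.homDim_mk] at h1
  exact_mod_cast h1

theorem homDim_ne_zero {D P : ProjPair lam α} {x : Matrix P.rep.ι D.rep.ι A} (hx : x ∈ homs D P)
    (h0 : x ≠ 0) : homDim D P ≠ 0 := by
  have : Nontrivial (homs D P) := ⟨⟨⟨x, hx⟩, 0, fun h => h0 (congrArg Subtype.val h)⟩⟩
  exact Module.finrank_pos.ne'

omit [FiniteDimensional ℂ A] in
theorem exists_of_homDim_ne_zero {D P : ProjPair lam α} (h : homDim D P ≠ 0) :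
    ∃ x ∈ homs D P, x ≠ 0 := by
  have := Module.nontrivial_of_finrank_pos (Nat.pos_of_ne_zero h)
  obtain ⟨x, hx⟩ := exists_ne (0 : homs D P)
  exact ⟨x.1, x.2, fun h => hx (Subtype.ext h)⟩

/-- A nonzero pair contains a pair whose invariant endomorphisms are scalar. -/
theorem exists_minimal (P : ProjPair lam α) (h : P.proj ≠ 0) :
    ∃ (c : Matrix P.rep.ι P.rep.ι A) (hc : IsStarProjection c)
      (hinv : IsGInvariant α P.rep P.rep c), c ≠ 0 ∧ c ∈ homs (P.withProj c hc hinv) P ∧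
      ∀ a, IsGInvariant α P.rep P.rep a → ∃ t : ℂ, c * a * c = t • c := by
  -- The invariant elements of `L(H) ⊗ A` form a finite-dimensional star algebra in which `star x *
  -- x = 0` forces `x = 0`, which is all that the abstract lemma asks for.
  obtain ⟨⟨c, hinv⟩, hc, hc0, hpc, hmin⟩ := exists_minimal_projection
    (M := invariantSubalgebra α P.rep)
    (fun x hx => Subtype.ext (eq_zero_of_conjTranspose_mul_self (congrArg Subtype.val hx)))
    (p := ⟨P.proj, P.invariant⟩)
    ⟨Subtype.ext P.proj_mul_proj, Subtype.ext P.conjTranspose_proj⟩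
    (fun h' => h (congrArg Subtype.val h'))
  have hc' : IsStarProjection c :=
    ⟨congrArg Subtype.val hc.isIdempotentElem, congrArg Subtype.val hc.isSelfAdjoint⟩
  refine ⟨c, hc', hinv, fun h' => hc0 (Subtype.ext h'),
    ⟨hinv, congrArg Subtype.val hpc, hc'.isIdempotentElem⟩, fun a ha => ?_⟩
  obtain ⟨t, ht⟩ := hmin ⟨a, ha⟩
  exact ⟨t, congrArg Subtype.val ht⟩

/-- This is cancellation, proved by peeling off minimal pieces. A minimal `c` inside `P` has a
nonzero morphism to `P`, hence a nonzero `x` to `Q`; `xᴴ x` is a positive multiple of `c`, so a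
rescaling of `x` embeds `c` isometrically in `Q`. The complements of `c` in `P` and in `Q` again
have equal dimensions, by additivity, and the induction applies to them. -/
theorem equivalent_of_homDim_eq (P Q : ProjPair lam α) (h : ∀ D, homDim D P = homDim D Q) :
    Equivalent P Q := by
  -- The induction runs on the dimension of the space of morphisms from `(1, π)` to `P = (p, π)`.
  -- Passing to a complement keeps `π`, so the test pair is unchanged, and the measure drops because
  -- `c` is itself a nonzero morphism from `(1, π)`.
  suffices key : ∀ (n : ℕ) (P Q : ProjPair lam α),
      homDim (P.withProj 1 (IsStarProjection.one _) (IsGInvariant.one _)) P = n →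
      (∀ D, homDim D P = homDim D Q) → Equivalent P Q from key _ P Q rfl h
  intro n
  induction n using Nat.strong_induction_on with | _ n ih
  intro P Q hn h
  by_cases hP : P.proj = 0
  · have hQ : Q.proj = 0 := by
      by_contra hQ
      refine homDim_ne_zero (proj_mem_homs Q) hQ ?_
      by_contra hne
      rw [← h] at hne
      obtain ⟨x, hx, hx0⟩ := exists_of_homDim_ne_zero hne
      exact hx0 (by rw [← hx.2.1, hP, Matrix.zero_mul])
    exact ⟨0, IsGInvariant.zero _ _, by simp [hP], by simp [hQ]⟩
  obtain ⟨c, hc, hinv, hc0, hcP, hmin⟩ := P.exists_minimal hP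
  obtain ⟨x, hx, hx0⟩ := exists_of_homDim_ne_zero
    (h (P.withProj c hc hinv) ▸ homDim_ne_zero hcP hc0)
  have hcc : c * c = c := hc.isIdempotentElem
  have hsc : cᴴ = c := hc.isSelfAdjoint
  obtain ⟨t, ht⟩ := hmin (xᴴ * x) (hx.1.conjTranspose.mul hx.1)
  have hxt : xᴴ * x = t • c := by
    rw [← ht, Matrix.mul_assoc, Matrix.mul_assoc, show x * c = x from hx.2.2, ← Matrix.mul_assoc,
      show c * xᴴ = xᴴ from (homs_conjTranspose hx).2.1]
  obtain ⟨r, hr, rfl⟩ := exists_pos_of_eq_smul_projection hc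
    (show (xᴴ * x)ᴴ = xᴴ * x by rw [conjTranspose_mul, conjTranspose_conjTranspose]) hxt
    (fun h0 => hx0 (eq_zero_of_conjTranspose_mul_self h0))
    (fun y hy => by rw [eq_zero_of_conjTranspose_mul_add hy, Matrix.mul_zero])
  set y : Matrix Q.rep.ι P.rep.ι A := ((Real.sqrt r : ℂ)⁻¹) • x with hy
  have hyQ : y ∈ homs (P.withProj c hc hinv) Q := (homs (P.withProj c hc hinv) Q).smul_mem _ hx
  have hyy : yᴴ * y = c := by
    rw [hy, conjTranspose_smul, Matrix.smul_mul, Matrix.mul_smul, hxt, smul_smul, smul_smul,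
      star_inv₀, Complex.star_def, Complex.conj_ofReal]
    have : (Real.sqrt r : ℂ)⁻¹ * (Real.sqrt r : ℂ)⁻¹ * (r : ℂ) = 1 := by
      rw [← mul_inv, ← Complex.ofReal_mul, Real.mul_self_sqrt hr.le,
        inv_mul_cancel₀ (by exact_mod_cast hr.ne')]
    rw [this, one_smul]
  obtain ⟨hp', hpinv, hP'⟩ := exists_complement hcP (show cᴴ * c = c by rw [hsc, hcc])
  obtain ⟨hq', hqinv, hQ'⟩ := exists_complement hyQ hyy
  have hlt : homDim (P.withProj 1 (IsStarProjection.one _) (IsGInvariant.one _))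
      (P.withProj _ hp' hpinv) < n := by
    have h1 := hP'.homDim_eq (P.withProj 1 (IsStarProjection.one _) (IsGInvariant.one _))
    have h2 : homDim (P.withProj 1 (IsStarProjection.one _) (IsGInvariant.one _))
        (P.withProj c hc hinv) ≠ 0 :=
      homDim_ne_zero (x := c) ⟨hinv, hcc, Matrix.mul_one _⟩ hc0
    omega
  have hrec := ih _ hlt (P.withProj _ hp' hpinv) (Q.withProj _ hq' hqinv) rfl fun D => by
    have h1 := hP'.homDim_eq D
    have h2 := hQ'.homDim_eq D
    have h3 := h D
    omega
  refine Quotient.exact (s := ProjPair.setoid lam α) ?_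
  change ProjClass.mk P = ProjClass.mk Q
  rw [hP'.mk_eq, hQ'.mk_eq]
  exact congrArg _ (Quotient.sound hrec)

end ProjPair

/-- The function `homDim D` is additive with values in the group `ℤ`, so it extends to the
Grothendieck group; equal K-classes therefore have equal dimensions against every `D`. -/
theorem TwistedK.cls_eq_iff [FiniteDimensional ℂ A] {P Q : ProjPair lam α} :
    TwistedK.cls P = TwistedK.cls Q ↔ ProjPair.Equivalent P Q := by
  refine ⟨fun h => ProjPair.equivalent_of_homDim_eq P Q fun D => ?_, fun h =>
    congrArg Algebra.GrothendieckAddGroup.of (Quotient.sound h)⟩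
  have h1 := congrArg (Algebra.GrothendieckAddGroup.lift (ProjClass.homDim D)) h
  unfold TwistedK.cls at h1
  rw [grothendieck_lift_of, grothendieck_lift_of] at h1
  exact Nat.cast_injective (R := ℤ) h1

end

/-! ### Matrix blocks of a finite-dimensional C*-algebra -/

section

variable {A : Type u} [CStarAlgebra A]

/-- A `*`-embedding of a matrix algebra onto a direct summand of `A`. -/
structure IsBlock {ι : Type*} [Fintype ι] [DecidableEq ι] (φ : Matrix ι ι ℂ →⋆ₙₐ[ℂ] A) :
    Prop where
  injective : Function.Injective φ
  exists_eq : ∀ x, ∃ m, φ 1 * x = φ m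

namespace IsBlock

variable {ι : Type*} [Fintype ι] [DecidableEq ι] {φ : Matrix ι ι ℂ →⋆ₙₐ[ℂ] A} (h : IsBlock φ)

theorem star_map_one (φ : Matrix ι ι ℂ →⋆ₙₐ[ℂ] A) : star (φ 1) = φ 1 := by
  rw [← map_star, star_one]

include h

/-- Since `φ 1 * y` lies in the range of `φ`, it equals `φ 1 * y * φ 1`. Taking adjoints gives the
same for `y * φ 1`. -/
theorem central (x : A) : φ 1 * x = x * φ 1 := by
  have key : ∀ y, φ 1 * y = φ 1 * y * φ 1 := fun y => by
    obtain ⟨m, hm⟩ := h.exists_eq y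
    rw [hm, ← map_mul, mul_one]
  have h2 := congrArg star (key (star x))
  rw [star_mul, star_mul, star_mul, star_star, star_map_one, ← mul_assoc] at h2
  rw [h2, ← key]

/-- The coordinates of `φ 1 * x` in the block. -/
def coordFun (x : A) : Matrix ι ι ℂ := (h.exists_eq x).choose

theorem map_coordFun (x : A) : φ (h.coordFun x) = φ 1 * x := (h.exists_eq x).choose_spec.symm

/-- The representation of `A` on the block. -/
def coord : A →⋆ₐ[ℂ] Matrix ι ι ℂ where
  toFun := h.coordFun
  map_one' := h.injective (by rw [map_coordFun, mul_one])
  map_mul' x y := h.injective (by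
    rw [map_coordFun, map_mul, map_coordFun, map_coordFun, mul_assoc, ← mul_assoc x,
      ← h.central x, ← mul_assoc, ← mul_assoc, ← mul_assoc, ← map_mul, mul_one])
  map_zero' := h.injective (by rw [map_coordFun, mul_zero, map_zero])
  map_add' x y := h.injective (by
    rw [map_coordFun, map_add, map_coordFun, map_coordFun, mul_add])
  commutes' t := h.injective (by
    rw [map_coordFun, Algebra.algebraMap_eq_smul_one, Algebra.algebraMap_eq_smul_one, map_smul,
      mul_smul_comm, mul_one])
  map_star' x := h.injective (by
    rw [map_coordFun, map_star, map_coordFun, star_mul, star_map_one, h.central])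

theorem map_coord (x : A) : φ (h.coord x) = φ 1 * x := h.map_coordFun x

theorem coord_map (m : Matrix ι ι ℂ) : h.coord (φ m) = m :=
  h.injective (by rw [map_coord, ← map_mul, one_mul])

end IsBlock

/-- A maximal orthonormal family in the column space `A c` of a minimal projection `c`. -/
theorem exists_orthonormal_columns [FiniteDimensional ℂ A] {c : A} (hc : IsStarProjection c)
    (hc0 : c ≠ 0) (hmin : ∀ a, ∃ t : ℂ, c * a * c = t • c) :
    ∃ (n : ℕ) (x : Fin (n + 1) → A), (∀ j, x j * c = x j) ∧
      (∀ j k, star (x j) * x k = if j = k then c else 0) ∧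
      ∀ y, y * c = y → (∀ j, star (x j) * y = 0) → y = 0 := by
  have hcc : c * c = c := hc.isIdempotentElem
  have hsc : star c = c := hc.isSelfAdjoint
  by_contra! hneg
  -- If no orthonormal family were maximal, a normalized new vector could always be adjoined,
  -- starting from `c` itself.
  have key : ∀ n : ℕ, ∃ x : Fin (n + 1) → A, (∀ j, x j * c = x j) ∧
      (∀ j k, star (x j) * x k = if j = k then c else 0) := by
    intro n
    induction n with
    | zero =>
      exact ⟨fun _ => c, fun _ => hcc, fun j k => by
        rw [hsc, hcc, if_pos (Subsingleton.elim (α := Fin 1) j k)]⟩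
    | succ n ih =>
      obtain ⟨x, h1, h2⟩ := ih
      obtain ⟨y, hyc, hxy, hy0⟩ := hneg n x h1 h2
      obtain ⟨t, ht⟩ := hmin (star y * y)
      have hyt : star y * y = t • c := by
        have h3 : c * star y = star y := by rw [← hsc, ← star_mul, hyc]
        rw [← ht, mul_assoc, mul_assoc, hyc, ← mul_assoc, h3]
      obtain ⟨r, hr, rfl⟩ := exists_pos_of_eq_smul_projection hc
        (IsSelfAdjoint.star_mul_self y) hyt
        (fun h0 => hy0 (CStarRing.star_mul_self_eq_zero_iff _ |>.1 h0))
        (fun z hz => by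
          have h4 := eq_zero_of_sum_star_mul_self_eq_zero (s := Finset.univ) (x := ![y, z])
            (by simpa using hz) 0 (Finset.mem_univ _)
          have h5 : y = 0 := h4
          exact absurd h5 hy0)
      have hs : star ((Real.sqrt r : ℂ)⁻¹) * (Real.sqrt r : ℂ)⁻¹ * (r : ℂ) = 1 := by
        rw [star_inv₀, Complex.star_def, Complex.conj_ofReal, ← mul_inv, ← Complex.ofReal_mul,
          Real.mul_self_sqrt hr.le, inv_mul_cancel₀ (by exact_mod_cast hr.ne')]
      have hyx : ∀ j, star y * x j = 0 := fun j => by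
        rw [← star_star (x j), ← star_mul, hxy, star_zero]
      refine ⟨Fin.cons ((Real.sqrt r : ℂ)⁻¹ • y) x, ?_, ?_⟩
      · intro j
        refine Fin.cases ?_ (fun j => ?_) j
        · simp [hyc]
        · simp [h1]
      · intro j k
        refine Fin.cases ?_ (fun j => ?_) j <;> refine Fin.cases ?_ (fun k => ?_) k
        · rw [Fin.cons_zero, star_smul, smul_mul_smul_comm, hyt, smul_smul, hs, one_smul, if_pos rfl]
        · rw [Fin.cons_zero, Fin.cons_succ, star_smul, smul_mul_assoc, hyx, smul_zero,
            if_neg (Fin.succ_ne_zero k).symm]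
        · rw [Fin.cons_zero, Fin.cons_succ, mul_smul_comm, hxy, smul_zero,
            if_neg (Fin.succ_ne_zero j)]
        · rw [Fin.cons_succ, Fin.cons_succ, h2]; simp [Fin.succ_inj]
  -- With `n` the dimension of `A`, the index type `Fin (n + 1)` already has one element too many
  -- for an independent family.
  obtain ⟨x, h1, h2⟩ := key (Module.finrank ℂ A)
  have hli : LinearIndependent ℂ x := by
    rw [Fintype.linearIndependent_iff]
    intro g hg i
    have h3 := congrArg (fun y => star (x i) * y) hg
    simp only [Finset.mul_sum, mul_smul_comm, h2, mul_zero] at h3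
    simpa [hc0] using h3
  have := hli.fintype_card_le_finrank
  simp at this

/-- For the row `X` of the orthonormal columns, `φ m = X m Xᴴ`; that is, `φ` sends the matrix unit
`e_jk` to `x j * star (x k)`. By maximality `φ 1` is the identity on `A c`, whence `φ 1 * y = φ 1 *
y * φ 1`. The latter is in the range of `φ`, because each `star (x j) * y * x k` lies in `c A c = ℂ
c`. The last clause ensures that blocks built from successive minimal projections are orthogonal. -/
theorem exists_block_of_minimal_projection [FiniteDimensional ℂ A] {c : A}
    (hc : IsStarProjection c) (hc0 : c ≠ 0) (hmin : ∀ a, ∃ t : ℂ, c * a * c = t • c) :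
    ∃ (n : ℕ) (φ : Matrix (Fin (n + 1)) (Fin (n + 1)) ℂ →⋆ₙₐ[ℂ] A), IsBlock φ ∧
      ∀ z, (∀ x, z * x = x * z) → z * c = 0 → ∀ m, z * φ m = 0 := by
  obtain ⟨n, x, hxc, hxx, hmax⟩ := exists_orthonormal_columns hc hc0 hmin
  have hsc : star c = c := hc.isSelfAdjoint
  let X : Matrix Unit (Fin (n + 1)) A := Matrix.of fun _ j => x j
  let D : Matrix (Fin (n + 1)) (Fin (n + 1)) A := Matrix.diagonal fun _ => c
  let o : A → Matrix Unit Unit A := fun y => Matrix.of fun _ _ => y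
  have hXX : Xᴴ * X = D := by
    ext j k; simp [X, D, Matrix.mul_apply, hxx, Matrix.diagonal_apply]
  have hSD : ∀ (m : Matrix (Fin (n + 1)) (Fin (n + 1)) ℂ) (j k : Fin (n + 1)),
      (scalarMat A m * D) j k = m j k • c := fun m j k => by
    simp [D, scalarMat, Algebra.algebraMap_eq_smul_one]
  have hDD : D * D = D := by
    simp [D, hc.isIdempotentElem.eq]
  have hXc : X * D = X := by
    ext j k; simp [X, D, hxc]
  have hcX : D * Xᴴ = Xᴴ := by
    have h1 := congrArg conjTranspose hXc
    rwa [conjTranspose_mul, ← hXX, conjTranspose_mul, conjTranspose_conjTranspose, hXX] at h1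
  have hcomm : ∀ m : Matrix (Fin (n + 1)) (Fin (n + 1)) ℂ,
      scalarMat A m * D = D * scalarMat A m :=
    fun m => by
      ext j k; simp [D, scalarMat, Algebra.commutes]
  let Φ : Matrix (Fin (n + 1)) (Fin (n + 1)) ℂ → Matrix Unit Unit A :=
    fun m => X * scalarMat A m * Xᴴ
  have hΦ : ∀ m m', Φ m * Φ m' = Φ (m * m') := fun m m' => by
    calc Φ m * Φ m' = X * scalarMat A m * (Xᴴ * X) * scalarMat A m' * Xᴴ := by
          simp only [Φ, Matrix.mul_assoc]
      _ = X * D * scalarMat A m * scalarMat A m' * Xᴴ := by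
          rw [hXX, Matrix.mul_assoc X, hcomm, ← Matrix.mul_assoc X]
      _ = Φ (m * m') := by
          rw [hXc, Matrix.mul_assoc X, ← scalarMat_mul]
  have hmul : ∀ P Q : Matrix Unit Unit A, (P * Q) () () = P () () * Q () () := fun P Q => by
    simp [Matrix.mul_apply]
  have hmul' : ∀ (P : Matrix (Fin (n + 1)) Unit A) (Q : Matrix Unit Unit A) (j : Fin (n + 1)),
      (P * Q) j () = P j () * Q () () := fun P Q j => by simp [Matrix.mul_apply]
  let φ : Matrix (Fin (n + 1)) (Fin (n + 1)) ℂ →⋆ₙₐ[ℂ] A :=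
    { toFun := fun m => Φ m () ()
      map_mul' := fun m m' => by rw [← hΦ, hmul]
      map_zero' := by simp [Φ, scalarMat]
      map_add' := fun m m' => by
        have : scalarMat A (m + m') = scalarMat A m + scalarMat A m' := by
          ext; simp [scalarMat]
        simp only [Φ, this, Matrix.mul_add, Matrix.add_mul, Matrix.add_apply]
      map_smul' := fun t m => by
        have : scalarMat A (t • m) = t • scalarMat A m := by
          ext; simp [scalarMat, Algebra.algebraMap_eq_smul_one, smul_smul]
        simp only [Φ, this, Matrix.mul_smul, Matrix.smul_mul, Matrix.smul_apply]
        rfl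
      map_star' := fun m => by
        have : Φ (star m) = (Φ m)ᴴ := by
          simp only [Φ, conjTranspose_mul, conjTranspose_conjTranspose, scalarMat_conjTranspose,
            star_eq_conjTranspose, Matrix.mul_assoc]
        rw [this]; rfl }
  have hφ : ∀ m, φ m = Φ m () () := fun _ => rfl
  have hφ1 : ∀ y, y * c = y → φ 1 * y = y := by
    intro y hy
    have h1 : ∀ j, star (x j) * φ 1 = star (x j) := fun j => by
      have h2 : Xᴴ * Φ 1 = Xᴴ := by
        simp only [Φ, scalarMat_one, Matrix.mul_one]
        rw [← Matrix.mul_assoc, hXX, hcX]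
      have h3 := congrFun (congrFun h2 j) ()
      rw [hmul'] at h3
      exact h3
    have h4 := hmax (y - φ 1 * y) (by rw [sub_mul, mul_assoc, hy]) fun j => by
      rw [mul_sub, ← mul_assoc, h1, sub_self]
    exact (sub_eq_zero.1 h4).symm
  -- The columns `y * x j` lie in `A c`, so `φ 1` fixes them; multiplying on the right by `Xᴴ`
  -- replaces `X` by `φ 1`.
  have hyX : ∀ y, φ 1 * y * φ 1 = y * φ 1 := fun y => by
    have h1 : o (φ 1) * (o y * X) =
        o y * X := by
      ext i j
      simp only [Matrix.mul_apply, X, o, Matrix.of_apply, Finset.univ_unique, Finset.sum_singleton]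
      exact hφ1 _ (by rw [mul_assoc, hxc])
    have h2 := congrArg (fun Z : Matrix Unit (Fin (n + 1)) A =>
      (Z * scalarMat A (1 : Matrix (Fin (n + 1)) (Fin (n + 1)) ℂ) * Xᴴ) () ()) h1
    simp only [Matrix.mul_assoc, hmul] at h2
    rw [← Matrix.mul_assoc X] at h2
    rw [mul_assoc]
    exact h2
  refine ⟨n, φ, ⟨?_, fun y => ?_⟩, fun z hz hzc m => ?_⟩
  · rw [injective_iff_map_eq_zero]
    intro m hm
    have h1 : Φ m = 0 := by ext i j; exact hm
    have h2 : Xᴴ * Φ m * X = scalarMat A m * D := by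
      calc Xᴴ * Φ m * X = (Xᴴ * X) * scalarMat A m * (Xᴴ * X) := by
            simp only [Φ, Matrix.mul_assoc]
        _ = _ := by
            rw [hXX, ← hcomm, Matrix.mul_assoc, hDD]
    rw [h1] at h2
    ext j k
    have h3 := congrFun (congrFun h2 j) k
    simp only [Matrix.mul_zero, Matrix.zero_mul, Matrix.zero_apply, D, Matrix.mul_diagonal, scalarMat,
      Matrix.map_apply, Algebra.algebraMap_eq_smul_one, smul_mul_assoc, one_mul] at h3
    exact (smul_eq_zero.1 h3.symm).resolve_right hc0
  · have h1 : φ 1 * y = φ 1 * y * φ 1 := by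
      have h2 := congrArg star (hyX (star y))
      rw [star_mul, star_mul, star_mul, star_star, IsBlock.star_map_one, ← mul_assoc] at h2
      exact h2.symm
    choose t ht using fun j k => hmin (star (x j) * y * x k)
    refine ⟨Matrix.of t, ?_⟩
    have h3 : Xᴴ * o y * X =
        scalarMat A (Matrix.of t) * D := by
      ext j k
      rw [hSD]
      simp only [Matrix.mul_apply, X, o, Matrix.of_apply, Finset.univ_unique, Finset.sum_singleton,
        Matrix.conjTranspose_apply]
      rw [← ht, mul_assoc c, mul_assoc _ (x k), hxc, ← mul_assoc, ← mul_assoc]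
      rw [show c * star (x j) = star (x j) by rw [← hsc, ← star_mul, hxc]]
    have h4 : Φ 1 * o y * Φ 1 = Φ (Matrix.of t) := by
      calc Φ 1 * o y * Φ 1
          = X * (Xᴴ * o y * X) * Xᴴ := by
            simp only [Φ, scalarMat_one, Matrix.one_mul, Matrix.mul_assoc]
        _ = Φ (Matrix.of t) := by
            rw [h3, ← Matrix.mul_assoc, Matrix.mul_assoc, hcX]
    rw [h1, hφ (Matrix.of t), ← h4, hmul, hmul]
    rfl
  · have h1 : o z * X = 0 := by
      ext i j
      simp only [Matrix.mul_apply, X, o, Matrix.of_apply, Finset.univ_unique, Finset.sum_singleton,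
        Matrix.zero_apply]
      rw [← hxc, ← mul_assoc, hz, mul_assoc, hzc, mul_zero]
    have h2 := congrArg (fun Z : Matrix Unit (Fin (n + 1)) A => (Z * scalarMat A m * Xᴴ) () ()) h1
    simp only [Matrix.mul_assoc, hmul, Matrix.zero_mul, Matrix.zero_apply] at h2
    rw [← Matrix.mul_assoc X] at h2
    exact h2

/-- A finite-dimensional C*-algebra is the orthogonal sum of finitely many matrix blocks. -/
theorem exists_blocks (A : Type u) [CStarAlgebra A] [FiniteDimensional ℂ A] :
    ∃ (k : ℕ) (b : Fin k → Σ n : ℕ, Matrix (Fin (n + 1)) (Fin (n + 1)) ℂ →⋆ₙₐ[ℂ] A),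
      (∀ i, IsBlock (b i).2) ∧ (∀ i j, i ≠ j → (b i).2 1 * (b j).2 1 = 0) ∧
      ∑ i, (b i).2 1 = 1 := by
  by_contra! hneg
  -- As long as the block units do not add up to `1`, one more orthogonal block can be found.
  have key : ∀ k : ℕ, ∃ b : Fin k → Σ n : ℕ, Matrix (Fin (n + 1)) (Fin (n + 1)) ℂ →⋆ₙₐ[ℂ] A,
      (∀ i, IsBlock (b i).2) ∧ (∀ i j, i ≠ j → (b i).2 1 * (b j).2 1 = 0) := by
    intro k
    induction k with
    | zero => exact ⟨fun i => i.elim0, fun i => i.elim0, fun i => i.elim0⟩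
    | succ k ih =>
      obtain ⟨b, h1, h2⟩ := ih
      have hne := hneg k b h1 h2
      set z := ∑ i, (b i).2 1 with hz
      have hbz : ∀ i, (b i).2 1 * z = (b i).2 1 := fun i => by
        rw [hz, Finset.mul_sum, Finset.sum_eq_single i (fun j _ hj => h2 i j hj.symm)
          (fun h => absurd (Finset.mem_univ i) h), ← map_mul, one_mul]
      have hz1 : IsStarProjection z := by
        constructor
        · change z * z = z
          nth_rw 1 [hz]
          rw [Finset.sum_mul, Finset.sum_congr rfl fun i _ => hbz i]
        · change star z = z
          rw [hz, star_sum, Finset.sum_congr rfl fun i _ => IsBlock.star_map_one _]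
      -- The new block grows from a minimal projection under the complement `1 - z` of the blocks
      -- already found.
      obtain ⟨c, hc, hc0, hzc, hmin⟩ := exists_minimal_projection
        (fun x hx => CStarRing.star_mul_self_eq_zero_iff (x : A) |>.1 hx) hz1.one_sub
        (sub_ne_zero.2 hne.symm)
      obtain ⟨n, φ, hφ, hφz⟩ := exists_block_of_minimal_projection hc hc0 hmin
      have hbφ : ∀ i, (b i).2 1 * φ 1 = 0 := fun i =>
        hφz _ (h1 i).central (by rw [← hzc, ← mul_assoc, mul_sub, mul_one, hbz, sub_self,
          zero_mul]) _
      refine ⟨Fin.cons ⟨n, φ⟩ b, fun i => ?_, fun i j hij => ?_⟩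
      · refine Fin.cases ?_ (fun i => ?_) i
        · exact hφ
        · exact h1 i
      · revert hij
        refine Fin.cases ?_ (fun i => ?_) i <;> refine Fin.cases ?_ (fun j => ?_) j
        · exact fun h => absurd rfl h
        · intro _
          have := hbφ j
          rwa [(h1 j).central] at this
        · exact fun _ => hbφ i
        · exact fun h => h2 i j fun h' => h (congrArg _ h')
  obtain ⟨b, h1, h2⟩ := key (Module.finrank ℂ A + 1)
  have hli : LinearIndependent ℂ fun i => (b i).2 1 := by
    rw [Fintype.linearIndependent_iff]
    intro g hg i
    have h3 := congrArg (fun y => (b i).2 1 * y) hg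
    simp only [Finset.mul_sum, mul_smul_comm, mul_zero] at h3
    rw [Finset.sum_eq_single i (fun j _ hj => by rw [h2 i j hj.symm, smul_zero])
      (fun h => absurd (Finset.mem_univ i) h), ← map_mul, one_mul] at h3
    refine (smul_eq_zero.1 h3).resolve_right fun h4 => ?_
    have h5 := (h1 i).injective (h4.trans (map_zero _).symm)
    exact one_ne_zero h5
  have := hli.fintype_card_le_finrank
  simp at this

end

/-! ### A Borel choice of implementing unitaries -/

section implementer

variable {n : ℕ}

/-- The unitary implementing `θ`, as a function of the images `F k = θ (single k 0 1)`. -/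
def implementer (F : Fin (n + 1) → Matrix (Fin (n + 1)) (Fin (n + 1)) ℂ) :
    Matrix (Fin (n + 1)) (Fin (n + 1)) ℂ :=
  -- Only one term survives: the least `j` whose diagonal entry in the projection `F 0` is nonzero.
  -- Column `k` of the result is then `F k` applied to the normalization of `F 0` times the `j`-th
  -- basis vector, whose squared norm is `F 0 j j`. Choosing the least `j` keeps the dependence on
  -- `F` Borel.
  Matrix.of fun i k => ∑ j, if F 0 j j ≠ 0 ∧ ∀ j' < j, F 0 j' j' = 0 then
    F k i j * ((Real.sqrt (F 0 j j).re : ℂ))⁻¹ else 0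

theorem measurable_implementer {X : Type*} [MeasurableSpace X]
    {F : X → Fin (n + 1) → Matrix (Fin (n + 1)) (Fin (n + 1)) ℂ}
    (hF : ∀ k i j, Measurable fun x => F x k i j) (i k : Fin (n + 1)) :
    Measurable fun x => implementer (F x) i k := by
  simp only [implementer, Matrix.of_apply]
  refine Finset.measurable_fun_sum _ fun j _ => Measurable.ite ?_ ?_ measurable_const
  · refine MeasurableSet.inter ?_ ?_
    · exact ((hF 0 j j) (measurableSet_singleton 0)).compl
    · have : {x | ∀ j' < j, F x 0 j' j' = 0} = ⋂ j', ⋂ (_ : j' < j), {x | F x 0 j' j' = 0} := by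
        ext x; simp
      change MeasurableSet {x | ∀ j' < j, F x 0 j' j' = 0}
      rw [this]
      exact MeasurableSet.iInter fun j' => MeasurableSet.iInter fun _ =>
        (hF 0 j' j') (measurableSet_singleton 0)
  · exact (hF k i j).mul
      (Complex.measurable_ofReal.comp (Complex.measurable_re.comp (hF 0 j j)).sqrt).inv

theorem implementer_apply_of_pivot {F : Fin (n + 1) → Matrix (Fin (n + 1)) (Fin (n + 1)) ℂ}
    {j : Fin (n + 1)} (hj : F 0 j j ≠ 0) (hj' : ∀ j' < j, F 0 j' j' = 0) (i k : Fin (n + 1)) :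
    implementer F i k = F k i j * ((Real.sqrt (F 0 j j).re : ℂ))⁻¹ := by
  simp only [implementer, Matrix.of_apply]
  rw [Finset.sum_eq_single j, if_pos ⟨hj, hj'⟩]
  · intro l _ hl
    refine if_neg fun h => ?_
    rcases lt_or_gt_of_ne hl with h1 | h1
    · exact h.1 (hj' l h1)
    · exact hj (h.2 j h1)
  · exact fun h => absurd (Finset.mem_univ j) h

variable (θ : Matrix (Fin (n + 1)) (Fin (n + 1)) ℂ →⋆ₐ[ℂ] Matrix (Fin (n + 1)) (Fin (n + 1)) ℂ)

/-- The projection `q = θ e₀₀` is nonzero, because `1 = ∑ e_k0 e₀₀ e_0k` and `θ` is unital. Since `q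
= qᴴ q`, its diagonal entries are the squared norms of its columns, so they are nonnegative reals
and not all zero. -/
theorem exists_pivot : ∃ j, θ (single 0 0 1) j j ≠ 0 ∧
    (∀ j' < j, θ (single 0 0 1) j' j' = 0) ∧
    0 < (θ (single 0 0 1) j j).re ∧ ((θ (single 0 0 1) j j).re : ℂ) = θ (single 0 0 1) j j := by
  set q := θ (single 0 0 1) with hq
  have hqq : qᴴ * q = q := by
    rw [hq, ← star_eq_conjTranspose, ← map_star, star_eq_conjTranspose, conjTranspose_single,
      ← map_mul, single_mul_single_same]
    simp
  have hd : ∀ j, q j j = ((∑ i, Complex.normSq (q i j) : ℝ) : ℂ) := fun j => by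
    nth_rw 1 [← hqq]
    simp [Matrix.mul_apply, Complex.normSq_eq_conj_mul_self]
  have hq0 : q ≠ 0 := by
    intro h0
    have h1 : θ 1 = 0 := by
      have : (1 : Matrix (Fin (n + 1)) (Fin (n + 1)) ℂ) =
          ∑ k, single k 0 1 * single 0 0 1 * single 0 k 1 := by
        ext i j
        by_cases h : i = j
        · subst h; simp [Matrix.sum_apply, single_apply]
        · have h' : ∀ x, ¬(x = i ∧ x = j) := fun x hx => h (hx.1.symm.trans hx.2)
          simp [Matrix.sum_apply, h, h']
      rw [this, map_sum]
      refine Finset.sum_eq_zero fun k _ => ?_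
      rw [map_mul, map_mul, ← hq, h0, mul_zero, zero_mul]
    rw [map_one] at h1
    exact one_ne_zero h1
  have hex : ∃ j, q j j ≠ 0 := by
    by_contra! h
    refine hq0 ?_
    ext i j
    have h1 := hd j
    rw [h j, eq_comm, Complex.ofReal_eq_zero,
      Finset.sum_eq_zero_iff_of_nonneg fun i _ => Complex.normSq_nonneg _] at h1
    exact Complex.normSq_eq_zero.1 (h1 i (Finset.mem_univ i))
  obtain ⟨j, hj, hmin⟩ := WellFounded.has_min (wellFounded_lt (α := Fin (n + 1)))
    {j | q j j ≠ 0} hex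
  have hre : (q j j).re = ∑ i, Complex.normSq (q i j) := by rw [hd j, Complex.ofReal_re]
  refine ⟨j, hj, fun j' h => by_contra fun h' => hmin j' h' h, ?_, ?_⟩
  · rw [hre]
    refine lt_of_le_of_ne (Finset.sum_nonneg fun i _ => Complex.normSq_nonneg _) fun h => hj ?_
    rw [hd j, ← h, Complex.ofReal_zero]
  · rw [hre, ← hd]

/-- Apply `θ` to `m e_k0 = ∑ m_lk e_l0` and read off the pivot column. -/
theorem implementer_mul (m : Matrix (Fin (n + 1)) (Fin (n + 1)) ℂ) :
    implementer (fun k => θ (single k 0 1)) * m = θ m * implementer fun k => θ (single k 0 1) := by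
  obtain ⟨j, hj, hj', -, -⟩ := exists_pivot θ
  ext i k
  have hm : m * single k 0 1 = ∑ l, m l k • single l 0 1 := by
    ext a b
    simp [Matrix.mul_apply, Matrix.sum_apply, single_apply, Finset.sum_ite_eq, ite_and]
  simp only [Matrix.mul_apply, implementer_apply_of_pivot (F := fun k => θ (single k 0 1)) hj hj']
  have h1 := congrFun (congrFun (congrArg θ hm) i) j
  rw [map_mul, Matrix.mul_apply, map_sum, Matrix.sum_apply] at h1
  simp only [map_smul, Matrix.smul_apply, smul_eq_mul] at h1
  simp only [← mul_assoc]
  rw [← Finset.sum_mul, h1, Finset.sum_mul]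
  exact Finset.sum_congr rfl fun l _ => by ring

/-- Up to normalization, the inner product of columns `k` and `l` is the pivot diagonal entry of `θ
(e_0k e_l0)`, that is, of `θ e₀₀` or of `0`. -/
theorem implementer_unitary :
    implementer (fun k => θ (single k 0 1)) ∈ Matrix.unitaryGroup (Fin (n + 1)) ℂ := by
  obtain ⟨j, hj, hj', hpos, hre⟩ := exists_pivot θ
  rw [Matrix.mem_unitaryGroup_iff', star_eq_conjTranspose]
  ext k l
  have hs : star (θ (single k 0 1)) * θ (single l 0 1) =
      (1 : Matrix (Fin (n + 1)) (Fin (n + 1)) ℂ) k l • θ (single 0 0 1) := by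
    rw [← map_star, star_eq_conjTranspose, conjTranspose_single, ← map_mul, ← map_smul]
    by_cases h : k = l
    · subst h; rw [single_mul_single_same]; simp
    · rw [single_mul_single_of_ne _ _ _ _ h, Matrix.one_apply_ne h, zero_smul]
  have h1 := congrFun (congrFun hs j) j
  rw [Matrix.mul_apply] at h1
  simp only [star_apply, Matrix.smul_apply, smul_eq_mul] at h1
  simp only [Matrix.mul_apply, conjTranspose_apply,
    implementer_apply_of_pivot (F := fun k => θ (single k 0 1)) hj hj', star_mul', star_inv₀]
  have h2 : ∀ i, star (θ (single k 0 1) i j) * (star (Real.sqrt (θ (single 0 0 1) j j).re : ℂ))⁻¹ *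
      (θ (single l 0 1) i j * (Real.sqrt (θ (single 0 0 1) j j).re : ℂ)⁻¹) =
      star (θ (single k 0 1) i j) * θ (single l 0 1) i j * (θ (single 0 0 1) j j)⁻¹ := fun i => by
    have h3 : (star (Real.sqrt (θ (single 0 0 1) j j).re : ℂ))⁻¹ *
        (Real.sqrt (θ (single 0 0 1) j j).re : ℂ)⁻¹ = (θ (single 0 0 1) j j)⁻¹ := by
      rw [Complex.star_def, Complex.conj_ofReal, ← mul_inv, ← Complex.ofReal_mul,
        Real.mul_self_sqrt hpos.le, hre]
    rw [← h3]; ring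
  rw [Finset.sum_congr rfl fun i _ => h2 i, ← Finset.sum_mul, h1, mul_assoc, mul_inv_cancel₀ hj,
    mul_one]

/-- This makes the implementing unitary at the identity of the group equal to `1`, so that the
resulting cocycle is normalized. -/
theorem implementer_id :
    implementer (fun k => (single k 0 1 : Matrix (Fin (n + 1)) (Fin (n + 1)) ℂ)) = 1 := by
  ext i k
  rw [implementer_apply_of_pivot (j := 0) (by simp) (fun j' h => absurd h (Fin.not_lt_zero j'))]
  simp [single_apply, Matrix.one_apply, eq_comm]

end implementer

theorem measurable_circle_of_coe {X : Type*} [MeasurableSpace X] {f : X → Circle}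
    (hf : Measurable fun x => (f x : ℂ)) : @Measurable X Circle _ (borel Circle) f := by
  let _ : MeasurableSpace Circle := borel Circle
  have _ : BorelSpace Circle := ⟨rfl⟩
  have hc : Continuous fun z : Circle => (z : ℂ) := by fun_prop
  have h : Topology.IsClosedEmbedding fun z : Circle => (z : ℂ) :=
    hc.isClosedEmbedding Circle.coe_injective
  exact h.measurableEmbedding.measurable_comp_iff.1 hf

theorem exists_eq_smul_one_of_commute {ι : Type*} [Fintype ι] [DecidableEq ι] [Nonempty ι]
    {V : Matrix ι ι ℂ} (h : ∀ m, V * m = m * V) : ∃ c : ℂ, V = c • 1 := by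
  have h1 : V ∈ Set.range (Matrix.scalar ι : ℂ →+* Matrix ι ι ℂ) :=
    Matrix.mem_range_scalar_of_commute_single fun i j _ => (h (single i j 1)).symm
  obtain ⟨c, rfl⟩ := h1
  exact ⟨c, by simp [Matrix.scalar_apply, Matrix.smul_one_eq_diagonal]⟩

/-- A point-norm continuous family of automorphisms of a matrix algebra is implemented by a Borel
projective representation. -/
theorem exists_projective_implementation {G : Type w} [Group G] [TopologicalSpace G]
    [IsTopologicalGroup G] {n : ℕ}
    (θ : G → (Matrix (Fin (n + 1)) (Fin (n + 1)) ℂ →⋆ₐ[ℂ] Matrix (Fin (n + 1)) (Fin (n + 1)) ℂ))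
    (h1 : ∀ m, θ 1 m = m) (hmul : ∀ g h m, θ (g * h) m = θ g (θ h m))
    (hcont : ∀ m i j, Continuous fun g => θ g m i j) :
    ∃ (lam : TwoCocycle G) (u : G → Matrix (Fin (n + 1)) (Fin (n + 1)) ℂ),
      (∀ g, u g ∈ Matrix.unitaryGroup (Fin (n + 1)) ℂ) ∧
      (∀ i j, @Measurable G ℂ (borel G) _ fun g => u g i j) ∧
      (∀ g h, u g * u h = (lam.toFun g h : ℂ) • u (g * h)) ∧
      ∀ g m, θ g m = u g * m * (u g)ᴴ := by
  set u : G → Matrix (Fin (n + 1)) (Fin (n + 1)) ℂ :=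
    fun g => implementer fun k => θ g (single k 0 1) with hu
  have hU : ∀ g, u g ∈ Matrix.unitaryGroup (Fin (n + 1)) ℂ := fun g => implementer_unitary (θ g)
  have hU1 : ∀ g, u g * (u g)ᴴ = 1 := fun g => Matrix.mem_unitaryGroup_iff.1 (hU g)
  have hU2 : ∀ g, (u g)ᴴ * u g = 1 := fun g => Matrix.mem_unitaryGroup_iff'.1 (hU g)
  have hθ : ∀ g m, u g * m = θ g m * u g := fun g m => implementer_mul (θ g) m
  have hθ' : ∀ g m, (u g)ᴴ * θ g m = m * (u g)ᴴ := fun g m => by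
    calc (u g)ᴴ * θ g m = (u g)ᴴ * (θ g m * u g) * (u g)ᴴ := by
          rw [Matrix.mul_assoc, Matrix.mul_assoc, hU1, Matrix.mul_one]
      _ = m * (u g)ᴴ := by rw [← hθ, ← Matrix.mul_assoc, hU2, Matrix.one_mul]
  have hu1 : u 1 = 1 := by
    simp only [hu, h1]; exact implementer_id
  have hmeas : ∀ i j, @Measurable G ℂ (borel G) _ fun g => u g i j := fun i j => by
    let _ : MeasurableSpace G := borel G
    have _ : BorelSpace G := ⟨rfl⟩
    exact measurable_implementer (F := fun g k => θ g (single k 0 1))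
      (fun k i j => (hcont _ i j).measurable) i j
  -- Both `u (g * h)` and `u g * u h` implement `θ (g * h)`, so their quotient commutes with every
  -- matrix and is scalar.
  have hscal : ∀ g h, ∃ c : ℂ, (u (g * h))ᴴ * (u g * u h) = c • 1 := fun g h =>
    exists_eq_smul_one_of_commute fun m => by
      calc (u (g * h))ᴴ * (u g * u h) * m = (u (g * h))ᴴ * (u g * (u h * m)) := by
            simp only [Matrix.mul_assoc]
        _ = (u (g * h))ᴴ * θ (g * h) m * (u g * u h) := by
            rw [hθ h, ← Matrix.mul_assoc (u g), hθ g (θ h m), hmul]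
            simp only [Matrix.mul_assoc]
        _ = _ := by rw [hθ']; simp only [Matrix.mul_assoc]
  choose c hc using hscal
  have hmulc : ∀ g h, u g * u h = c g h • u (g * h) := fun g h => by
    calc u g * u h = u (g * h) * ((u (g * h))ᴴ * (u g * u h)) := by
          rw [← Matrix.mul_assoc, hU1, Matrix.one_mul]
      _ = c g h • u (g * h) := by rw [hc, Matrix.mul_smul, Matrix.mul_one]
  -- Writing the scalar as a matrix entry makes its measurability visible.
  have hc00 : ∀ g h, c g h = ((u (g * h))ᴴ * (u g * u h)) 0 0 := fun g h => by
    rw [hc]; simp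
  have hsmul : ∀ g (a b : ℂ), a • u g = b • u g → a = b := fun g a b hab => by
    have h2 := congrArg (fun z => ((u g)ᴴ * z) 0 0) hab
    simpa [Matrix.mul_smul, hU2] using h2
  have hnorm : ∀ g h, c g h ∈ Submonoid.unitSphere ℂ := fun g h => by
    have h2 : (u g * u h)ᴴ * (u g * u h) = 1 := by
      rw [conjTranspose_mul, Matrix.mul_assoc, ← Matrix.mul_assoc (u g)ᴴ, hU2, Matrix.one_mul, hU2]
    rw [hmulc, conjTranspose_smul, Matrix.smul_mul, Matrix.mul_smul, hU2, smul_smul] at h2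
    have h3 := congrFun (congrFun h2 0) 0
    simp only [Matrix.smul_apply, Matrix.one_apply_eq, smul_eq_mul, mul_one, Complex.star_def,
      ← Complex.normSq_eq_conj_mul_self] at h3
    change c g h ∈ Metric.sphere (0 : ℂ) 1
    rw [mem_sphere_zero_iff_norm, ← sq_eq_sq₀ (norm_nonneg _) zero_le_one, one_pow,
      ← Complex.normSq_eq_norm_sq]
    exact_mod_cast h3
  let lam : TwoCocycle G :=
    { toFun := fun g h => ⟨c g h, hnorm g h⟩
      measurable_toFun := by
        let _ : MeasurableSpace (G × G) := borel (G × G)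
        have _ : BorelSpace (G × G) := ⟨rfl⟩
        let _ : MeasurableSpace G := borel G
        have _ : BorelSpace G := ⟨rfl⟩
        refine measurable_circle_of_coe ?_
        change Measurable fun p : G × G => c p.1 p.2
        simp only [hc00, Matrix.mul_apply, conjTranspose_apply]
        -- The σ-algebra on `G × G` is the Borel one, which may be larger than the product
        -- σ-algebra. Measurability comes from composing Borel functions on `G` with the continuous
        -- maps `p.1`, `p.2` and `p.1 * p.2`.
        have k1 : ∀ i j, Measurable fun p : G × G => u p.1 i j := fun i j =>
          (hmeas i j).comp continuous_fst.measurable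
        have k2 : ∀ i j, Measurable fun p : G × G => u p.2 i j := fun i j =>
          (hmeas i j).comp continuous_snd.measurable
        have k3 : ∀ i j, Measurable fun p : G × G => u (p.1 * p.2) i j := fun i j =>
          (hmeas i j).comp continuous_mul.measurable
        exact Finset.measurable_fun_sum _ fun i _ => (continuous_star.measurable.comp (k3 i 0)).mul
          (Finset.measurable_fun_sum _ fun j _ => (k1 i j).mul (k2 j 0))
      one_right := fun g => Circle.ext (hsmul g _ _ (by
        have := hmulc g 1
        rw [hu1, Matrix.mul_one, mul_one] at this
        change c g 1 • u g = ((1 : Circle) : ℂ) • u g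
        rw [← this, Circle.coe_one, one_smul]))
      one_left := fun g => Circle.ext (hsmul g _ _ (by
        have := hmulc 1 g
        rw [hu1, Matrix.one_mul, one_mul] at this
        change c 1 g • u g = ((1 : Circle) : ℂ) • u g
        rw [← this, Circle.coe_one, one_smul]))
      -- Both sides are the coefficient of `u (g * h * k)` in the associative product `u g * u h * u
      -- k`.
      cocycle := fun g h k => Circle.ext (hsmul (g * h * k) _ _ (by
        change (c g h * c (g * h) k) • _ = (c g (h * k) * c h k) • _
        rw [mul_smul, ← hmulc, ← Matrix.smul_mul, ← hmulc, mul_comm, mul_smul, mul_assoc g, ← hmulc,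
          ← Matrix.mul_smul, ← hmulc, Matrix.mul_assoc])) }
  refine ⟨lam, u, hU, hmeas, hmulc, fun g m => ?_⟩
  rw [hθ, Matrix.mul_assoc, hU1, Matrix.mul_one]

/-! ### Decomposition of an action into implemented blocks -/

section

variable {G : Type w} [Group G] [TopologicalSpace G] {A : Type u} [CStarAlgebra A]

namespace IsBlock

variable {ι : Type} [Fintype ι] [DecidableEq ι] {φ : Matrix ι ι ℂ →⋆ₙₐ[ℂ] A}

/-- The representation of `A` on `ℂ^ι` defined by a block. -/
def rep (h : IsBlock φ) : A →⋆ₐ[ℂ] (EuclideanSpace ℂ ι →L[ℂ] EuclideanSpace ℂ ι) :=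
  StarAlgHom.comp
    ((Matrix.toEuclideanCLM (n := ι) (𝕜 := ℂ)) :
      Matrix ι ι ℂ →⋆ₐ[ℂ] (EuclideanSpace ℂ ι →L[ℂ] EuclideanSpace ℂ ι)) h.coord

theorem rep_apply (h : IsBlock φ) (a : A) (x : EuclideanSpace ℂ ι) :
    h.rep a x = WithLp.toLp 2 (h.coord a *ᵥ x.ofLp) := rfl

variable [Nonempty ι]

theorem isIrreducibleRep (h : IsBlock φ) : IsIrreducibleRep h.rep := by
  refine ⟨inferInstance, fun W _ hW => or_iff_not_imp_left.2 fun hbot => ?_⟩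
  obtain ⟨x, hxW, hx0⟩ := W.ne_bot_iff.1 hbot
  obtain ⟨k, hk⟩ : ∃ k, x.ofLp k ≠ 0 := by
    by_contra! hx
    exact hx0 (by ext k; simpa using hx k)
  rw [eq_top_iff]
  intro y _
  -- This matrix is supported in column `k` and scaled by the inverse of `x k`, so that it carries
  -- `x` to `y`.
  have h1 := hW (φ (Matrix.of fun i j => if j = k then y.ofLp i * (x.ofLp k)⁻¹ else 0)) x hxW
  convert h1
  rw [rep_apply, coord_map]
  ext i
  simp [Matrix.mulVec, dotProduct, hk]

theorem coord_ne_zero (h : IsBlock φ) : h.coord (φ 1) ≠ 0 := by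
  rw [coord_map]; exact one_ne_zero

theorem map_one_ne_zero (h : IsBlock φ) : φ 1 ≠ 0 := fun h0 =>
  h.coord_ne_zero (by rw [h0, map_zero])

/-- The block representation kills `1 - φ 1`, hence so does its equivalent composition with `α.aut
g`. This says that `φ 1` lies below `α.aut g (φ 1)`, and the case of `g⁻¹` gives the reverse
inequality. -/
theorem aut_map_one_of_spectrallyTrivial (h : IsBlock φ) {α : CStarAction G A}
    (hα : α.SpectrallyTrivial) (g : G) : α.aut g (φ 1) = φ 1 := by
  have key : ∀ g, φ 1 * α.aut g (φ 1) = φ 1 := fun g => by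
    obtain ⟨U, hU⟩ := hα _ h.rep h.isIrreducibleRep g
    have h1 : h.rep (1 - φ 1) = 0 := by
      have : h.coord (1 - φ 1) = 0 := by rw [map_sub, coord_map, map_one, sub_self]
      ext1 x
      rw [rep_apply, this]; simp
    have h2 : h.rep (α.aut g (1 - φ 1)) = 0 := by
      ext1 x
      have h3 := hU (1 - φ 1) x
      rw [h1] at h3
      exact U.map_eq_zero_iff.1 h3
    have h4 : h.coord (α.aut g (1 - φ 1)) = 0 :=
      (Matrix.toEuclideanCLM (n := ι) (𝕜 := ℂ)).injective (h2.trans (map_zero _).symm)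
    have h5 := h.map_coord (α.aut g (1 - φ 1))
    rw [h4, map_zero, map_sub, map_one (α.aut g), mul_sub, mul_one, eq_comm, sub_eq_zero] at h5
    exact h5.symm
  have h1 := congrArg (α.aut g) (key g⁻¹)
  have h2 : α.aut g (α.aut g⁻¹ (φ 1)) = φ 1 := by
    change (α.aut g * α.aut g⁻¹) (φ 1) = φ 1
    rw [← map_mul, mul_inv_cancel, map_one]; rfl
  rw [map_mul, h2, ← h.central, key] at h1
  exact h1.symm

/-- The unit of a block is a nonzero central idempotent, and the centre of a full matrix algebra
consists of the scalars. -/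
theorem map_one_eq_one_of_isFullMatrixAlgebra (h : IsBlock φ) (hA : IsFullMatrixAlgebra A) :
    φ 1 = 1 := by
  obtain ⟨n, ⟨e⟩⟩ := hA
  have h0 : e (φ 1) ≠ 0 := fun h' => h.map_one_ne_zero (e.injective (h'.trans (map_zero e).symm))
  have : Nonempty (Fin n) := by
    by_contra hn
    rw [not_nonempty_iff] at hn
    exact h0 (Subsingleton.elim _ _)
  obtain ⟨c, hc⟩ := exists_eq_smul_one_of_commute (V := e (φ 1)) fun m => by
    rw [← e.apply_symm_apply m, ← map_mul, h.central, map_mul]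
  have hcc : e (φ 1) * e (φ 1) = e (φ 1) := by rw [← map_mul, ← map_mul, one_mul]
  have hc0 : c ≠ 0 := by rintro rfl; exact h0 (by rw [hc, zero_smul])
  rw [hc, Matrix.smul_mul, Matrix.one_mul] at hcc
  have h1 : c • (1 : Matrix (Fin n) (Fin n) ℂ) = 1 := smul_right_injective _ hc0 hcc
  exact EquivLike.injective e (by rw [hc, h1, map_one])

end IsBlock

/-- A decomposition of `A` into matrix blocks on which the action is implemented by cocycle
representations. -/
structure BlockDecomposition (α : CStarAction G A) where
  I : Type
  [fintype : Fintype I]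
  [decEq : DecidableEq I]
  lam : I → TwoCocycle G
  u : ∀ i, CocycleRep (lam i)
  [nonempty : ∀ i, Nonempty (u i).ι]
  φ : ∀ i, Matrix (u i).ι (u i).ι ℂ →⋆ₙₐ[ℂ] A
  isBlock : ∀ i, IsBlock (φ i)
  orthogonal : ∀ i j, i ≠ j → φ i 1 * φ j 1 = 0
  sum_one : ∑ i, φ i 1 = 1
  equivariant : ∀ g i m, α.aut g (φ i m) = φ i ((u i).mat g * m * ((u i).mat g)ᴴ)

attribute [instance] BlockDecomposition.fintype BlockDecomposition.decEq
  BlockDecomposition.nonempty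

theorem IsBlock.exists_implementation [IsTopologicalGroup G] [FiniteDimensional ℂ A]
    (α : CStarAction G A) {n : ℕ} {φ : Matrix (Fin (n + 1)) (Fin (n + 1)) ℂ →⋆ₙₐ[ℂ] A}
    (h : IsBlock φ) (hφ : ∀ g, α.aut g (φ 1) = φ 1) :
    ∃ (lam : TwoCocycle G) (u : G → Matrix (Fin (n + 1)) (Fin (n + 1)) ℂ),
      (∀ g, u g ∈ Matrix.unitaryGroup (Fin (n + 1)) ℂ) ∧
      (∀ i j, @Measurable G ℂ (borel G) _ fun g => u g i j) ∧
      (∀ g h, u g * u h = (lam.toFun g h : ℂ) • u (g * h)) ∧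
      ∀ g m, α.aut g (φ m) = φ (u g * m * (u g)ᴴ) := by
  have hmap : ∀ g m, φ (h.coord (α.aut g (φ m))) = α.aut g (φ m) := fun g m => by
    rw [h.map_coord, ← hφ g, ← map_mul, ← map_mul, one_mul]
  let θ : G → (Matrix (Fin (n + 1)) (Fin (n + 1)) ℂ →⋆ₐ[ℂ] Matrix (Fin (n + 1)) (Fin (n + 1)) ℂ) :=
    fun g =>
      { toFun := fun m => h.coord (α.aut g (φ m))
        map_one' := by rw [hφ, h.coord_map]
        map_mul' := fun m m' => by rw [map_mul, map_mul, map_mul]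
        map_zero' := by rw [map_zero, map_zero, map_zero]
        map_add' := fun m m' => by rw [map_add, map_add, map_add]
        commutes' := fun t => by
          rw [Algebra.algebraMap_eq_smul_one, map_smul, map_smul, map_smul, hφ, h.coord_map]
        map_star' := fun m => by rw [map_star, map_star, map_star] }
  have hθ : ∀ g m, θ g m = h.coord (α.aut g (φ m)) := fun _ _ => rfl
  obtain ⟨lam, u, h1, h2, h3, h4⟩ := exists_projective_implementation θ
    (fun m => by rw [hθ, map_one]; exact h.coord_map m)
    (fun g k m => by
      rw [hθ, hθ, hθ, hmap, map_mul]; rfl)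
    -- Entries of `coord` are linear functionals on a finite-dimensional space, hence continuous,
    -- and point-norm continuity of the action passes to `θ`.
    (fun m i j => by
      let L : A →ₗ[ℂ] ℂ := (Matrix.entryLinearMap ℂ ℂ i j).comp h.coord.toAlgHom.toLinearMap
      exact (LinearMap.continuous_of_finiteDimensional L).comp (α.continuous_aut (φ m)))
  exact ⟨lam, u, h1, h2, h3, fun g m => by rw [← h4, hθ, hmap]⟩

/-- The alternative in the hypothesis serves to show that every block unit is fixed; each block is
then implemented separately, with its own cocycle. -/
theorem exists_blockDecomposition [IsTopologicalGroup G] [FiniteDimensional ℂ A]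
    (α : CStarAction G A) (hα : α.SpectrallyTrivial ∨ IsFullMatrixAlgebra A) :
    Nonempty (BlockDecomposition α) := by
  obtain ⟨k, b, h1, h2, h3⟩ := exists_blocks A
  have hfix : ∀ i g, α.aut g ((b i).2 1) = (b i).2 1 := fun i g => by
    rcases hα with hα | hα
    · exact (h1 i).aut_map_one_of_spectrallyTrivial hα g
    · rw [(h1 i).map_one_eq_one_of_isFullMatrixAlgebra hα, map_one]
  choose lam u hu hm hmul heq using fun i => (h1 i).exists_implementation α (hfix i)
  exact ⟨{
    I := Fin k
    lam := lam
    u := fun i => ⟨Fin ((b i).1 + 1), u i, hu i, hm i, hmul i⟩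
    nonempty := fun i => ⟨(0 : Fin ((b i).1 + 1))⟩
    φ := fun i => (b i).2
    isBlock := h1
    orthogonal := h2
    sum_one := h3
    equivariant := fun g i m => heq i g m }⟩

end

/-! ### Conjugate representations and change of cocycle -/

section

variable {G : Type w} [Group G] [TopologicalSpace G] {A : Type u} [CStarAlgebra A]
  {lam mu : TwoCocycle G} {α : CStarAction G A}

namespace TwoCocycle

/-- The inverse cocycle. -/
def conj (lam : TwoCocycle G) : TwoCocycle G where
  toFun g h := (lam.toFun g h)⁻¹
  measurable_toFun := by
    let _ : MeasurableSpace (G × G) := borel (G × G)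
    let _ : MeasurableSpace Circle := borel Circle
    have _ : BorelSpace Circle := ⟨rfl⟩
    exact lam.measurable_toFun.inv
  one_right g := by rw [lam.one_right, inv_one]
  one_left g := by rw [lam.one_left, inv_one]
  cocycle g h k := by rw [← mul_inv, lam.cocycle, mul_inv]

theorem mul_conj (lam : TwoCocycle G) : lam * lam.conj = 1 := by
  ext g h
  rw [mul_apply, one_apply, conj, mul_inv_cancel]

theorem mul_mul_conj (mu lam : TwoCocycle G) : mu * lam * lam.conj = mu := by
  ext g h
  rw [mul_apply, mul_apply, conj, mul_inv_cancel_right]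

theorem mul_mul_conj_left (mu lam : TwoCocycle G) : lam * (mu * lam.conj) = mu := by
  ext g h
  rw [mul_apply, mul_apply, conj, mul_comm, inv_mul_cancel_right]

end TwoCocycle

namespace CocycleRep

/-- The complex conjugate of a representation. -/
abbrev conj (π : CocycleRep lam) : CocycleRep lam.conj where
  ι := π.ι
  mat g := (π.mat g).map (starRingEnd ℂ)
  unitary_mat g := by
    rw [Matrix.mem_unitaryGroup_iff, star_eq_conjTranspose]
    have h := congrArg (fun M => M.map (starRingEnd ℂ)) (π.mat_mul_conjTranspose g)
    simp only [Matrix.map_mul] at h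
    rw [← conjTranspose_map (f := starRingEnd ℂ) (fun _ => rfl), h]
    simp
  measurable_mat i j := by
    let _ : MeasurableSpace G := borel G
    exact Complex.continuous_conj.measurable.comp (π.measurable_mat i j)
  mat_mul g h := by
    rw [← Matrix.map_mul, π.mat_mul, TwoCocycle.conj, Circle.coe_inv_eq_conj]
    ext i j
    simp

/-- Transport along an equality of cocycles. -/
abbrev cast (h : lam = mu) (π : CocycleRep lam) : CocycleRep mu where
  ι := π.ι
  mat := π.mat
  unitary_mat := π.unitary_mat
  measurable_mat := π.measurable_mat
  mat_mul := by subst h; exact π.mat_mul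

/-- The restriction of a representation to the range of an isometry `S`. -/
abbrev compress (π : CocycleRep lam) {T : Type} [Fintype T] [DecidableEq T] (S : Matrix π.ι T ℂ)
    (hS : Sᴴ * S = 1) (hcomm : ∀ g, π.mat g * (S * Sᴴ) = S * Sᴴ * π.mat g) : CocycleRep lam where
  ι := T
  mat g := Sᴴ * π.mat g * S
  unitary_mat g := by
    rw [Matrix.mem_unitaryGroup_iff, star_eq_conjTranspose, conjTranspose_mul, conjTranspose_mul,
      conjTranspose_conjTranspose]
    calc Sᴴ * π.mat g * S * (Sᴴ * ((π.mat g)ᴴ * S))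
        = Sᴴ * (π.mat g * (S * Sᴴ)) * (π.mat g)ᴴ * S := by simp only [Matrix.mul_assoc]
      _ = Sᴴ * (S * Sᴴ) * (π.mat g * (π.mat g)ᴴ) * S := by
          rw [hcomm]; simp only [Matrix.mul_assoc]
      _ = (Sᴴ * S) * (Sᴴ * S) := by
          rw [mat_mul_conjTranspose, Matrix.mul_one]; simp only [Matrix.mul_assoc]
      _ = 1 := by rw [hS, Matrix.one_mul]
  measurable_mat i j := by
    let _ : MeasurableSpace G := borel G
    simp only [Matrix.mul_apply]
    exact Finset.measurable_fun_sum _ fun k _ => (Finset.measurable_fun_sum _ fun l _ =>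
      measurable_const.mul (π.measurable_mat l k)).mul measurable_const
  mat_mul g h := by
    calc Sᴴ * π.mat g * S * (Sᴴ * π.mat h * S)
        = Sᴴ * (π.mat g * (S * Sᴴ)) * π.mat h * S := by simp only [Matrix.mul_assoc]
      _ = (Sᴴ * S) * Sᴴ * (π.mat g * π.mat h) * S := by
          rw [hcomm]; simp only [Matrix.mul_assoc]
      _ = _ := by
          rw [hS, Matrix.one_mul, π.mat_mul, Matrix.mul_smul, Matrix.smul_mul]

theorem mat_mul_compress (π : CocycleRep lam) {T : Type} [Fintype T] [DecidableEq T]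
    (S : Matrix π.ι T ℂ) (hS : Sᴴ * S = 1)
    (hcomm : ∀ g, π.mat g * (S * Sᴴ) = S * Sᴴ * π.mat g) (g : G) :
    π.mat g * S * ((π.compress S hS hcomm).mat g)ᴴ = S := by
  change π.mat g * S * (Sᴴ * π.mat g * S)ᴴ = S
  rw [conjTranspose_mul, conjTranspose_mul, conjTranspose_conjTranspose]
  calc π.mat g * S * (Sᴴ * ((π.mat g)ᴴ * S))
      = π.mat g * (S * Sᴴ) * (π.mat g)ᴴ * S := by simp only [Matrix.mul_assoc]
    _ = S * Sᴴ * (π.mat g * (π.mat g)ᴴ) * S := by rw [hcomm]; simp only [Matrix.mul_assoc]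
    _ = S := by rw [mat_mul_conjTranspose, Matrix.mul_one, Matrix.mul_assoc, hS, Matrix.mul_one]

end CocycleRep

namespace ProjPair

/-- Transport along an equality of cocycles. -/
abbrev cast (h : lam = mu) (P : ProjPair lam α) : ProjPair mu α where
  rep := P.rep.cast h
  proj := P.proj
  isProj := P.isProj
  invariant := by subst h; exact P.invariant

end ProjPair

/-! ### Entrywise description of invariance -/

theorem diagAct_apply (α : CStarAction G A) (π₁ π₂ : CocycleRep lam) (g : G)
    (x : Matrix π₂.ι π₁.ι A) (i : π₂.ι) (j : π₁.ι) :
    diagAct α π₁ π₂ g x i j =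
      ∑ k, ∑ l, (π₂.mat g i k * star (π₁.mat g j l)) • α.aut g (x k l) := by
  simp only [diagAct, scalarMat, Matrix.mul_apply, Matrix.map_apply, conjTranspose_apply,
    Algebra.algebraMap_eq_smul_one, smul_mul_assoc, one_mul, mul_smul_comm, mul_one]
  rw [Finset.sum_comm]
  refine Finset.sum_congr rfl fun l _ => ?_
  rw [Finset.smul_sum]
  refine Finset.sum_congr rfl fun k _ => ?_
  rw [smul_smul, mul_comm]

theorem isGInvariant_iff {π₁ π₂ : CocycleRep lam} {x : Matrix π₂.ι π₁.ι A} :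
    IsGInvariant α π₁ π₂ x ↔ ∀ g i j,
      ∑ k, ∑ l, (π₂.mat g i k * star (π₁.mat g j l)) • α.aut g (x k l) = x i j := by
  constructor
  · intro h g i j
    rw [← diagAct_apply, h g]
  · intro h g
    ext i j
    rw [diagAct_apply, h]

/-- An orthogonal projection of a finite-dimensional Hilbert space is the range projection of an
isometry. -/
theorem exists_isometry_of_isStarProjection {κ : Type} [Fintype κ] [DecidableEq κ]
    {p : Matrix κ κ ℂ} (hp : IsStarProjection p) :
    ∃ (T : Type) (_ : Fintype T) (_ : DecidableEq T) (S : Matrix κ T ℂ),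
      Sᴴ * S = 1 ∧ S * Sᴴ = p := by
  have hh : p.IsHermitian := hp.isSelfAdjoint
  have hpp : p * p = p := hp.isIdempotentElem
  set V : Matrix κ κ ℂ := (hh.eigenvectorUnitary : Matrix κ κ ℂ)
  have hVV : Vᴴ * V = 1 := Matrix.mem_unitaryGroup_iff'.1 hh.eigenvectorUnitary.2
  set D : Matrix κ κ ℂ := diagonal fun i => (hh.eigenvalues i : ℂ) with hD
  have hspec : p = V * D * Vᴴ := by
    have := hh.spectral_theorem
    rw [Unitary.conjStarAlgAut_apply] at this
    exact this
  have hDD : D * D = D := by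
    calc D * D = Vᴴ * ((V * D * Vᴴ) * (V * D * Vᴴ)) * V := by
          simp only [Matrix.mul_assoc, hVV, Matrix.mul_one]
          simp only [← Matrix.mul_assoc, hVV, Matrix.one_mul]
      _ = Vᴴ * (V * D * Vᴴ) * V := by rw [← hspec, hpp]
      _ = D := by
          simp only [Matrix.mul_assoc, hVV, Matrix.mul_one]
          simp only [← Matrix.mul_assoc, hVV, Matrix.one_mul]
  have hd : ∀ i, hh.eigenvalues i = 0 ∨ (hh.eigenvalues i : ℂ) = 1 := fun i => by
    have h1 := congrFun (congrFun hDD i) i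
    rw [hD, diagonal_mul_diagonal, diagonal_apply_eq, diagonal_apply_eq] at h1
    rcases eq_or_ne (hh.eigenvalues i : ℂ) 0 with h2 | h2
    · exact Or.inl (by exact_mod_cast h2)
    · exact Or.inr (mul_left_cancel₀ h2 (by rw [h1, mul_one]))
  -- The eigenvalues of a projection are `0` and `1`; the columns of `S` are the eigenvectors for
  -- `1`.
  refine ⟨{i // hh.eigenvalues i ≠ 0}, inferInstance, inferInstance,
    V.submatrix id Subtype.val, ?_, ?_⟩
  · rw [conjTranspose_submatrix, ← submatrix_mul Vᴴ V _ id _ Function.bijective_id, hVV]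
    ext i j
    simp [Matrix.one_apply, Subtype.ext_iff]
  · refine Eq.trans ?_ hspec.symm
    ext a b
    have hVD : ∀ i, (V * D) a i = V a i * (hh.eigenvalues i : ℂ) := fun i => mul_diagonal _ _ _ _
    rw [Matrix.mul_apply, Matrix.mul_apply]
    simp only [conjTranspose_apply, submatrix_apply, id, hVD]
    rw [← Finset.sum_subtype (Finset.univ.filter fun i => hh.eigenvalues i ≠ 0) (by simp)
      (fun i => V a i * star (V b i)), Finset.sum_filter]
    refine Finset.sum_congr rfl fun i _ => ?_
    rcases hd i with h | h
    · simp [h]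
    · have h' : hh.eigenvalues i ≠ 0 := fun h0 => by simp [h0] at h
      rw [if_pos h', h, mul_one]

end

section

variable {G : Type w} [Group G] [TopologicalSpace G] {A : Type u} [CStarAlgebra A]
  {lam mu : TwoCocycle G} {α : CStarAction G A}

/-! ### Orthogonal decompositions of a pair -/

theorem isStarProjection_sum {M I : Type*} [NonUnitalRing M] [StarRing M] {q : I → M}
    (hq : ∀ i, IsStarProjection (q i)) (horth : ∀ i j, i ≠ j → q i * q j = 0) (s : Finset I) :
    IsStarProjection (∑ i ∈ s, q i) := by
  classical
  induction s using Finset.induction_on with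
  | empty => rw [Finset.sum_empty]; exact IsStarProjection.zero _
  | insert a s ha ih =>
    rw [Finset.sum_insert ha]
    refine (hq a).add ih ?_
    rw [Finset.mul_sum]
    exact Finset.sum_eq_zero fun i hi => horth a i fun h => ha (h ▸ hi)

theorem IsGInvariant.sum {I : Type*} {π₁ π₂ : CocycleRep lam} {x : I → Matrix π₂.ι π₁.ι A}
    (s : Finset I) (h : ∀ i ∈ s, IsGInvariant α π₁ π₂ (x i)) :
    IsGInvariant α π₁ π₂ (∑ i ∈ s, x i) := by
  classical
  induction s using Finset.induction_on with
  | empty => rw [Finset.sum_empty]; exact IsGInvariant.zero _ _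
  | insert a s ha ih =>
    rw [Finset.sum_insert ha]
    exact (h a (Finset.mem_insert_self a s)).add
      (ih fun i hi => h i (Finset.mem_insert_of_mem hi))

/-- Orthogonal projections over the same representation are embedded in their sum by themselves, so
each step of the induction is an `IsOrthogonalSum`. -/
theorem ProjPair.mk_sum {I : Type*} (P : ProjPair lam α)
    {q : I → Matrix P.rep.ι P.rep.ι A} (hq : ∀ i, IsStarProjection (q i))
    (hinv : ∀ i, IsGInvariant α P.rep P.rep (q i)) (horth : ∀ i j, i ≠ j → q i * q j = 0)
    (s : Finset I) :
    ProjClass.mk (P.withProj (∑ i ∈ s, q i) (isStarProjection_sum hq horth s)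
      (IsGInvariant.sum s fun i _ => hinv i)) =
      ∑ i ∈ s, ProjClass.mk (P.withProj (q i) (hq i) (hinv i)) := by
  classical
  induction s using Finset.induction_on with
  | empty =>
    refine Quotient.sound ⟨0, IsGInvariant.zero _ _, ?_, ?_⟩
    · rw [Matrix.mul_zero]; rfl
    · ext i; exact i.elim
  | insert a s ha ih =>
    refine Eq.trans ?_ (Finset.sum_insert ha).symm
    rw [← ih]
    have hs := isStarProjection_sum hq horth s
    have hqs : q a * ∑ i ∈ s, q i = 0 := by
      rw [Finset.mul_sum]
      exact Finset.sum_eq_zero fun i hi => horth a i fun h => ha (h ▸ hi)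
    have hsq : (∑ i ∈ s, q i) * q a = 0 := by
      rw [Finset.sum_mul]
      exact Finset.sum_eq_zero fun i hi => horth i a fun h => ha (h ▸ hi)
    have h1 : (q a)ᴴ = q a := (hq a).isSelfAdjoint
    have h2 : (∑ i ∈ s, q i)ᴴ = ∑ i ∈ s, q i := hs.isSelfAdjoint
    have hins : (∑ i ∈ insert a s, q i) * (∑ i ∈ s, q i) = ∑ i ∈ s, q i := by
      rw [Finset.sum_insert ha, Matrix.add_mul, hqs, zero_add, hs.isIdempotentElem.eq]
    refine ProjPair.IsOrthogonalSum.mk_eq (V := q a) (W := ∑ i ∈ s, q i)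
      ⟨⟨hinv a, ?_, (hq a).isIdempotentElem⟩,
        ⟨IsGInvariant.sum s fun i _ => hinv i, ?_, hs.isIdempotentElem⟩, ?_, ?_, ?_, ?_⟩
    · change (∑ i ∈ insert a s, q i) * q a = q a
      rw [Finset.sum_insert ha, Matrix.add_mul, hsq, add_zero, (hq a).isIdempotentElem.eq]
    · exact hins
    · change (q a)ᴴ * q a = q a
      rw [h1, (hq a).isIdempotentElem.eq]
    · change (∑ i ∈ s, q i)ᴴ * (∑ i ∈ s, q i) = _
      rw [h2, hs.isIdempotentElem.eq]
    · change (q a)ᴴ * (∑ i ∈ s, q i) = 0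
      rw [h1, hqs]
    · change q a * (q a)ᴴ + (∑ i ∈ s, q i) * (∑ i ∈ s, q i)ᴴ = ∑ i ∈ insert a s, q i
      rw [h1, h2, (hq a).isIdempotentElem.eq, hs.isIdempotentElem.eq, Finset.sum_insert ha]

/-! ### The generators attached to a block decomposition -/

namespace BlockDecomposition

variable (D : BlockDecomposition α)

theorem mul_single_mul {ι : Type*} [Fintype ι] [DecidableEq ι] (u v : Matrix ι ι ℂ) (k l a b : ι)
    (c : ℂ) : (u * single k l c * v) a b = u a k * c * v l b := by
  simp [Matrix.mul_apply, single_apply, Finset.sum_ite_eq, ite_and]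

/-- The dimension of a block, as a complex number. -/
def dim (i : D.I) : ℂ := (Fintype.card (D.u i).ι : ℂ)

theorem dim_ne_zero (i : D.I) : D.dim i ≠ 0 := Nat.cast_ne_zero.2 Fintype.card_ne_zero

/-- The square root of the inverse of the dimension of a block. -/
def scale (i : D.I) : ℂ := ((Real.sqrt (Fintype.card (D.u i).ι) : ℝ) : ℂ)⁻¹

theorem star_scale (i : D.I) : star (D.scale i) = D.scale i := by
  rw [scale, star_inv₀, Complex.star_def, Complex.conj_ofReal]

theorem scale_mul_scale (i : D.I) : D.scale i * D.scale i = (D.dim i)⁻¹ := by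
  rw [scale, dim, ← mul_inv, ← Complex.ofReal_mul, Real.mul_self_sqrt (Nat.cast_nonneg _)]
  simp

theorem aut_map_one (g : G) (i : D.I) : α.aut g (D.φ i 1) = D.φ i 1 := by
  rw [D.equivariant, Matrix.mul_one, (D.u i).mat_mul_conjTranspose]

theorem coord_aut (g : G) (i : D.I) (x : A) : (D.isBlock i).coord (α.aut g x) =
    (D.u i).mat g * (D.isBlock i).coord x * ((D.u i).mat g)ᴴ := by
  apply (D.isBlock i).injective
  rw [(D.isBlock i).map_coord, ← D.equivariant, (D.isBlock i).map_coord, map_mul, D.aut_map_one]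

theorem isGInvariant_map (i : D.I) {π₁ π₂ : CocycleRep lam}
    {M : π₂.ι → π₁.ι → Matrix (D.u i).ι (D.u i).ι ℂ}
    (h : ∀ g a b, ∑ k, ∑ l, (π₂.mat g a k * star (π₁.mat g b l)) •
      ((D.u i).mat g * M k l * ((D.u i).mat g)ᴴ) = M a b) :
    IsGInvariant α π₁ π₂ (Matrix.of fun a b => D.φ i (M a b)) := by
  rw [isGInvariant_iff]
  intro g a b
  simp only [Matrix.of_apply]
  rw [← h g a b, map_sum]
  refine Finset.sum_congr rfl fun k _ => ?_
  rw [map_sum]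
  refine Finset.sum_congr rfl fun l _ => ?_
  rw [map_smul, D.equivariant]

/-- The pair of the conjugate representation of a block and the projection onto its invariant
vector. -/
abbrev gen (i : D.I) : ProjPair (D.lam i).conj α where
  rep := (D.u i).conj
  -- With `d` the dimension of the block, the entries `e_jk / d` are those of the rank-one
  -- projection onto `d^(-1/2) ∑ e_j ⊗ e_j`, the vector fixed by `conj u ⊗ u`.
  proj := Matrix.of fun j k => D.φ i (single j k (D.dim i)⁻¹)
  isProj := by
    constructor
    · ext j k
      simp only [Matrix.mul_apply, Matrix.of_apply, ← map_mul, single_mul_single_same]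
      rw [Finset.sum_const, ← map_nsmul]
      congr 1
      rw [← Nat.cast_smul_eq_nsmul ℂ, smul_single, Finset.card_univ, smul_eq_mul]
      exact congrArg _ (mul_inv_cancel_left₀ (D.dim_ne_zero i) _)
    · ext j k
      simp only [star_apply, Matrix.of_apply]
      rw [← map_star, star_eq_conjTranspose, conjTranspose_single, star_inv₀]
      simp [dim]
  invariant := D.isGInvariant_map i fun g j m => by
    ext a b
    have hu : ∀ a j, ∑ k, (D.u i).mat g a k * star ((D.u i).mat g j k) = if a = j then 1 else 0 :=
      fun a j => by
        have := congrFun (congrFun ((D.u i).mat_mul_conjTranspose g) a) j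
        simpa [Matrix.mul_apply, Matrix.one_apply] using this
    simp only [Matrix.sum_apply, Matrix.smul_apply, mul_single_mul, conjTranspose_apply,
      Matrix.map_apply, smul_eq_mul]
    calc ∑ k, ∑ l, (starRingEnd ℂ) ((D.u i).mat g j k) *
          star ((starRingEnd ℂ) ((D.u i).mat g m l)) *
          ((D.u i).mat g a k * (D.dim i)⁻¹ * star ((D.u i).mat g b l))
        = (∑ k, (D.u i).mat g a k * star ((D.u i).mat g j k)) *
          (∑ l, (D.u i).mat g m l * star ((D.u i).mat g b l)) * (D.dim i)⁻¹ := by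
          rw [Finset.sum_mul_sum, Finset.sum_mul]
          refine Finset.sum_congr rfl fun k _ => ?_
          rw [Finset.sum_mul]
          refine Finset.sum_congr rfl fun l _ => ?_
          simp only [starRingEnd_apply, star_star]
          ring
      _ = single j m (D.dim i)⁻¹ a b := by
          rw [hu, hu, single_apply]
          by_cases h1 : a = j <;> by_cases h2 : m = b <;> simp [h1, h2, eq_comm]
          simp [Ne.symm h1]

/-- The part of a pair supported on a block. -/
abbrev blockPair (P : ProjPair lam α) (i : D.I) : ProjPair lam α :=
  P.withProj (Matrix.of fun a b => D.φ i 1 * P.proj a b)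
    (by
      have hc := (D.isBlock i).central
      constructor
      · ext a b
        simp only [Matrix.mul_apply, Matrix.of_apply]
        have : ∀ k, D.φ i 1 * P.proj a k * (D.φ i 1 * P.proj k b) =
            D.φ i 1 * (P.proj a k * P.proj k b) := fun k => by
          rw [mul_assoc, ← mul_assoc (P.proj a k), ← hc (P.proj a k), ← mul_assoc, ← mul_assoc,
            ← map_mul, mul_one, mul_assoc]
        rw [Finset.sum_congr rfl fun k _ => this k, ← Finset.mul_sum, ← Matrix.mul_apply,
          P.proj_mul_proj]
      · ext a b
        simp only [star_apply, Matrix.of_apply]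
        rw [star_mul, IsBlock.star_map_one, ← hc]
        congr 1
        exact congrFun (congrFun P.conjTranspose_proj a) b)
    (by
      rw [isGInvariant_iff]
      intro g a b
      simp only [Matrix.of_apply, map_mul, D.aut_map_one]
      rw [← isGInvariant_iff.1 P.invariant g a b, Finset.mul_sum]
      refine Finset.sum_congr rfl fun k _ => ?_
      rw [Finset.mul_sum]
      refine Finset.sum_congr rfl fun l _ => ?_
      rw [mul_smul_comm])

theorem mk_eq_sum_blockPair (P : ProjPair lam α) :
    ProjClass.mk P = ∑ i, ProjClass.mk (D.blockPair P i) := by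
  have h := P.mk_sum (q := fun i => (D.blockPair P i).proj) (fun i => (D.blockPair P i).isProj)
    (fun i => (D.blockPair P i).invariant) (fun i j hij => by
      ext a b
      simp only [Matrix.mul_apply, Matrix.of_apply, Matrix.zero_apply]
      refine Finset.sum_eq_zero fun k _ => ?_
      rw [(D.isBlock i).central, mul_assoc, ← mul_assoc (D.φ i 1), D.orthogonal i j hij, zero_mul,
        mul_zero]) Finset.univ
  rw [← h]
  congr 1
  have hsum : ∑ i, (D.blockPair P i).proj = P.proj := by
    ext a b
    simp only [Matrix.sum_apply, Matrix.of_apply]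
    rw [← Finset.sum_mul, D.sum_one, one_mul]
  obtain ⟨rep, proj, hp, hinv⟩ := P
  simp only [ProjPair.withProj]
  congr 1
  exact hsum.symm

/-- A pair over `mu * (lam i)⁻¹` supported on the block `i` is the tensor product of the generator
and a representation whose intertwiner with `π ⊗ u` has range projection `coord p`. -/
theorem equivalent_tensor_gen (i : D.I) (P : ProjPair (mu * (D.lam i).conj) α)
    (hP : ∀ a b, D.φ i 1 * P.proj a b = P.proj a b) (σ : CocycleRep mu)
    (S : Matrix (P.rep.ι × (D.u i).ι) σ.ι ℂ) (hS : Sᴴ * S = 1)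
    (hS' : ∀ a b j k, (S * Sᴴ) (a, j) (b, k) = (D.isBlock i).coord (P.proj a b) j k)
    (hσ : ∀ g, (P.rep.mat g ⊗ₖ (D.u i).mat g) * S * (σ.mat g)ᴴ = S) :
    ProjPair.Equivalent (ProjPair.tensor σ (D.gen i)) P := by
  -- As an operator this is `S` tensored with the functional given by the invariant unit vector of
  -- `conj u ⊗ u`; the factor `D.scale i` normalizes that vector. Its initial projection is
  -- therefore that of `σ ⊗ gen i`, and its final projection is `S Sᴴ`.
  let M : P.rep.ι → (D.u i).ι × σ.ι → Matrix (D.u i).ι (D.u i).ι ℂ := fun h js =>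
    Matrix.of fun a b => if b = js.1 then D.scale i * S (h, a) js.2 else 0
  have hM : ∀ h js a b, M h js a b = if b = js.1 then D.scale i * S (h, a) js.2 else 0 :=
    fun _ _ _ _ => rfl
  refine ⟨Matrix.of fun h js => D.φ i (M h js), D.isGInvariant_map i fun g h js => ?_, ?_, ?_⟩
  · obtain ⟨j, s⟩ := js
    ext a b
    have hu : ∀ b j, ∑ k, (D.u i).mat g j k * star ((D.u i).mat g b k) = if b = j then 1 else 0 :=
      fun b j => by
        have := congrFun (congrFun ((D.u i).mat_mul_conjTranspose g) j) b
        simpa [Matrix.mul_apply, Matrix.one_apply, eq_comm] using this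
    have hSg := congrFun (congrFun (hσ g) (h, a)) s
    simp only [Matrix.mul_apply, conjTranspose_apply, kroneckerMap_apply,
      Fintype.sum_prod_type] at hSg
    rw [hM, ← hSg]
    have hMu : ∀ h js, ((D.u i).mat g * M h js * ((D.u i).mat g)ᴴ) a b =
        D.scale i * (∑ k, (D.u i).mat g a k * S (h, k) js.2) * star ((D.u i).mat g b js.1) := by
      intro h js
      simp only [Matrix.mul_apply, conjTranspose_apply, hM, mul_ite, mul_zero]
      rw [Finset.sum_eq_single js.1]
      · simp only [if_true, Finset.mul_sum]
        congr 1
        exact Finset.sum_congr rfl fun k _ => by ring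
      · intro k _ hk; simp [hk]
      · exact fun h => absurd (Finset.mem_univ _) h
    simp only [Matrix.sum_apply, Matrix.smul_apply, smul_eq_mul, hMu, Fintype.sum_prod_type,
      kroneckerMap_apply, Matrix.map_apply, star_mul', starRingEnd_apply, star_star]
    calc _ = (∑ j', (D.u i).mat g j j' * star ((D.u i).mat g b j')) *
          (D.scale i * ∑ s', (∑ h', ∑ k, P.rep.mat g h h' * (D.u i).mat g a k * S (h', k) s') *
            star (σ.mat g s s')) := by
          rw [Finset.sum_comm, Finset.sum_mul]
          refine Finset.sum_congr rfl fun j' _ => ?_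
          rw [Finset.sum_comm, Finset.mul_sum, Finset.mul_sum]
          refine Finset.sum_congr rfl fun s' _ => ?_
          rw [Finset.sum_mul, Finset.mul_sum, Finset.mul_sum]
          refine Finset.sum_congr rfl fun h' _ => ?_
          rw [Finset.mul_sum, Finset.sum_mul, Finset.mul_sum, Finset.sum_mul, Finset.mul_sum,
            Finset.mul_sum]
          exact Finset.sum_congr rfl fun k _ => by ring
      _ = _ := by rw [hu]; split_ifs <;> simp
  · ext ⟨j, s⟩ ⟨j', s'⟩
    have hSs := congrFun (congrFun hS s) s'
    simp only [Matrix.mul_apply, conjTranspose_apply, Fintype.sum_prod_type] at hSs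
    simp only [tensorMat, kroneckerMap_apply, Matrix.of_apply, Matrix.mul_apply,
      conjTranspose_apply, ← map_star, ← map_mul, ← map_sum, ← map_smul]
    congr 1
    ext b b'
    rw [← hSs]
    simp only [Matrix.sum_apply, star_eq_conjTranspose, Matrix.mul_apply, conjTranspose_apply, hM,
      Matrix.smul_apply, single_apply, smul_eq_mul]
    have h3 : ∀ (h : P.rep.ι) (a : (D.u i).ι),
        star (if b = j then D.scale i * S (h, a) s else 0) *
          (if b' = j' then D.scale i * S (h, a) s' else 0) =
        star (S (h, a) s) * S (h, a) s' * if j = b ∧ j' = b' then (D.dim i)⁻¹ else 0 :=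
      fun h a => by
        by_cases h1 : b = j
        · by_cases h2 : b' = j'
          · rw [if_pos h1, if_pos h2, if_pos ⟨h1.symm, h2.symm⟩, star_mul', D.star_scale,
              ← D.scale_mul_scale]
            ring
          · rw [if_neg h2, if_neg (show ¬(j = b ∧ j' = b') from fun h => h2 h.2.symm), mul_zero,
              mul_zero]
        · rw [if_neg h1, if_neg (show ¬(j = b ∧ j' = b') from fun h => h1 h.1.symm), mul_zero,
            star_zero, zero_mul]
    simp only [h3, Finset.sum_mul]
  · ext h h'
    have hSS := hS' h h'
    rw [← hP h h', ← (D.isBlock i).map_coord]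
    simp only [Matrix.of_apply, Matrix.mul_apply,
      conjTranspose_apply, ← map_star, ← map_mul, ← map_sum]
    congr 1
    ext a a'
    rw [← hSS]
    simp only [Matrix.sum_apply, star_eq_conjTranspose, Matrix.mul_apply, conjTranspose_apply, hM,
      Fintype.sum_prod_type]
    have h3 : ∀ (j : (D.u i).ι) (s : σ.ι), ∑ b, (if b = j then D.scale i * S (h, a) s else 0) *
        star (if b = j then D.scale i * S (h', a') s else 0) =
        (D.dim i)⁻¹ * (S (h, a) s * star (S (h', a') s)) := fun j s => by
      rw [Finset.sum_eq_single j, if_pos rfl, if_pos rfl, star_mul', D.star_scale,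
        ← D.scale_mul_scale]
      · ring
      · intro b _ hb; simp [hb]
      · exact fun h => absurd (Finset.mem_univ _) h
    simp only [h3]
    rw [Finset.sum_const, ← Finset.mul_sum, nsmul_eq_mul, Finset.card_univ]
    exact mul_inv_cancel_left₀ (D.dim_ne_zero i) _

/-- Read through `coord`, the projection of `P` is a scalar projection `p` on the space of `P.rep ⊗
u i`. Invariance under `Ad P.rep ⊗ α` means exactly that `p` commutes with this representation, so
`σ` is its restriction to the range of `p`. -/
theorem exists_equivalent_tensor_gen (i : D.I) (P : ProjPair (mu * (D.lam i).conj) α)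
    (hP : ∀ a b, D.φ i 1 * P.proj a b = P.proj a b) :
    ∃ σ : CocycleRep mu, ProjPair.Equivalent (ProjPair.tensor σ (D.gen i)) P := by
  let p : Matrix (P.rep.ι × (D.u i).ι) (P.rep.ι × (D.u i).ι) ℂ :=
    Matrix.of fun x y => (D.isBlock i).coord (P.proj x.1 y.1) x.2 y.2
  have hp : IsStarProjection p := by
    constructor
    · ext ⟨a, j⟩ ⟨b, k⟩
      have h1 := congrArg (fun M => (D.isBlock i).coord (M a b) j k) P.proj_mul_proj
      simp only [Matrix.mul_apply, map_sum, map_mul, Matrix.sum_apply] at h1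
      simp only [p, Matrix.mul_apply, Matrix.of_apply, Fintype.sum_prod_type, h1]
    · ext ⟨a, j⟩ ⟨b, k⟩
      have h1 := congrArg (fun M => (D.isBlock i).coord (M a b) j k) P.conjTranspose_proj
      simp only [conjTranspose_apply, map_star, star_apply] at h1
      exact h1
  obtain ⟨T, _, _, S, hS, hSp⟩ := exists_isometry_of_isStarProjection hp
  -- Tensoring with `u i` cancels the inverse cocycle: `lam i * (mu * conj (lam i)) = mu`.
  let ρ : CocycleRep mu :=
    ((D.u i).tensor P.rep).cast (TwoCocycle.mul_mul_conj_left mu (D.lam i))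
  have hρ : ∀ g, ρ.mat g * p * (ρ.mat g)ᴴ = p := fun g => by
    ext ⟨a, j⟩ ⟨b, k⟩
    have h1 := congrArg (fun x => (D.isBlock i).coord x j k) (isGInvariant_iff.1 P.invariant g a b)
    simp only [map_sum, map_smul, D.coord_aut, Matrix.sum_apply, Matrix.smul_apply,
      Matrix.mul_apply, conjTranspose_apply, smul_eq_mul] at h1
    simp only [p, Matrix.of_apply]
    rw [← h1]
    simp only [ρ, Matrix.mul_apply, conjTranspose_apply, kroneckerMap_apply, Matrix.of_apply,
      Fintype.sum_prod_type, Finset.mul_sum, Finset.sum_mul]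
    rw [Finset.sum_comm (s := (Finset.univ : Finset P.rep.ι)) (t := (Finset.univ : Finset P.rep.ι))]
    refine Finset.sum_congr rfl fun x _ => ?_
    rw [Finset.sum_comm]
    refine Finset.sum_congr rfl fun y _ => Finset.sum_congr rfl fun z _ =>
      Finset.sum_congr rfl fun t _ => ?_
    rw [star_mul']
    ring
  have hcomm : ∀ g, ρ.mat g * (S * Sᴴ) = S * Sᴴ * ρ.mat g := fun g => by
    rw [hSp]
    calc ρ.mat g * p = ρ.mat g * p * ((ρ.mat g)ᴴ * ρ.mat g) := by
          rw [ρ.conjTranspose_mul_mat, Matrix.mul_one]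
      _ = p * ρ.mat g := by rw [← Matrix.mul_assoc, hρ]
  refine ⟨ρ.compress S hS hcomm, D.equivalent_tensor_gen i P hP _ S hS ?_ fun g => ?_⟩
  · intro a b j k
    rw [hSp]; rfl
  · exact ρ.mat_mul_compress S hS hcomm g

end BlockDecomposition

end

section

variable {G : Type w} [Group G] [TopologicalSpace G] {A : Type u} [CStarAlgebra A]
  {B : Type v} [CStarAlgebra B] {lam mu : TwoCocycle G} {α : CStarAction G A} {β : CStarAction G B}

/-! ### Homomorphisms are determined by the generators -/

theorem EllHom.toHom_cast (Γ : EllHom α β) (h : lam = mu) {P : ProjPair lam α} {Q : ProjPair lam β}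
    (hPQ : Γ.toHom lam (TwistedK.cls P) = TwistedK.cls Q) :
    Γ.toHom mu (TwistedK.cls (P.cast h)) = TwistedK.cls (Q.cast h) := by
  subst h; exact hPQ

theorem TwistedK.cls_tensor (σ : CocycleRep mu) (P : ProjPair lam α) :
    TwistedK.cls (ProjPair.tensor σ P) =
      TwistedK.partialAction mu lam α (Algebra.GrothendieckAddGroup.of (RepClass.mk σ))
        (TwistedK.cls P) :=
  (TwistedK.partialAction_of (α := α) (RepClass.mk σ) (ProjClass.mk P)).symm

theorem TwistedK.cls_eq_of_equivalent {P Q : ProjPair lam α} (h : ProjPair.Equivalent P Q) :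
    TwistedK.cls P = TwistedK.cls Q :=
  congrArg Algebra.GrothendieckAddGroup.of (Quotient.sound h)

namespace BlockDecomposition

variable (D : BlockDecomposition α)

theorem toHom_eq_of_block {Γ Γ' : EllHom α β} {i : D.I}
    (h : Γ.toHom _ (TwistedK.cls (D.gen i)) = Γ'.toHom _ (TwistedK.cls (D.gen i)))
    (P : ProjPair lam α) (hP : ∀ a b, D.φ i 1 * P.proj a b = P.proj a b) :
    Γ.toHom lam (TwistedK.cls P) = Γ'.toHom lam (TwistedK.cls P) := by
  -- Writing `lam` as `(lam * lam i) * conj (lam i)` and substituting puts `P` in the form required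
  -- above without a transport.
  have hlam := TwoCocycle.mul_mul_conj lam (D.lam i)
  generalize lam * D.lam i = mu at hlam
  subst hlam
  obtain ⟨σ, hσ⟩ := D.exists_equivalent_tensor_gen i P hP
  rw [← TwistedK.cls_eq_of_equivalent hσ, TwistedK.cls_tensor, Γ.map_partialAction,
    Γ'.map_partialAction, h]

/-- Every pair is the sum of its block parts, and each block part is a representation acting on a
generator, so commutation with the partial actions leaves no freedom beyond the values on `gen i`.
-/
theorem ellHom_ext {Γ Γ' : EllHom α β}
    (h : ∀ i, Γ.toHom _ (TwistedK.cls (D.gen i)) = Γ'.toHom _ (TwistedK.cls (D.gen i))) :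
    Γ = Γ' := by
  refine EllHom.ext (funext fun lam => grothendieck_hom_ext fun x => ?_)
  induction x using Quotient.inductionOn with | _ P
  change Γ.toHom lam (Algebra.GrothendieckAddGroup.of (ProjClass.mk P)) =
    Γ'.toHom lam (Algebra.GrothendieckAddGroup.of (ProjClass.mk P))
  rw [D.mk_eq_sum_blockPair P, map_sum, map_sum, map_sum]
  refine Finset.sum_congr rfl fun i _ => D.toHom_eq_of_block (h i) (D.blockPair P i) fun a b => ?_
  simp only [Matrix.of_apply]
  rw [← mul_assoc, ← map_mul, one_mul]

/-- The pair of the unit of `A`. -/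
abbrev unitPair (α : CStarAction G A) : ProjPair (1 : TwoCocycle G) α :=
  ProjPair.ofInvariant α 1 (IsStarProjection.one A) fun g => map_one (α.aut g)

/-- The part of the unit pair in block `i` corresponds to the identity of the space of `u i`, so
here `σ = u i` and `S` is the identity matrix. Summed over `i`, this expresses `[1_α]` through the
generators. -/
theorem equivalent_unitPair_block (i : D.I) :
    ProjPair.Equivalent (ProjPair.tensor (D.u i) (D.gen i))
      ((D.blockPair (unitPair α) i).cast (TwoCocycle.mul_conj (D.lam i)).symm) := by
  refine D.equivalent_tensor_gen i _ (fun a b => ?_) (D.u i)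
    (Matrix.of fun (x : Unit × (D.u i).ι) k => if x.2 = k then (1 : ℂ) else 0) ?_ ?_ fun g => ?_
  · change D.φ i 1 * (D.φ i 1 * 1) = D.φ i 1 * 1
    rw [mul_one, ← map_mul, one_mul]
  · ext j k
    simp [Matrix.mul_apply, Fintype.sum_prod_type, Matrix.one_apply, eq_comm]
    split_ifs <;> simp
  · intro a b j k
    change _ = (D.isBlock i).coord (D.φ i 1 * 1) j k
    rw [mul_one, IsBlock.coord_map]
    simp [Matrix.mul_apply, Matrix.one_apply, eq_comm]
  · ext ⟨x, j⟩ k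
    have h := congrFun (congrFun ((D.u i).mat_mul_conjTranspose g) j) k
    simp only [Matrix.mul_apply, conjTranspose_apply] at h
    simp only [Matrix.mul_apply, conjTranspose_apply, kroneckerMap_apply, Fintype.sum_prod_type,
      Matrix.of_apply, mul_ite, mul_one, mul_zero, Finset.sum_ite_eq',
      Finset.mem_univ, if_true]
    simpa [Matrix.one_apply] using h

end BlockDecomposition

/-! ### Orthogonal sums of several pairs -/

theorem ProjPair.exists_orthogonal_family {I : Type*} [DecidableEq I] (R : I → ProjPair lam α)
    (s : Finset I) : ∃ (P : ProjPair lam α) (w : ∀ i, Matrix P.rep.ι (R i).rep.ι A),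
      ProjClass.mk P = ∑ i ∈ s, ProjClass.mk (R i) ∧
      (∀ i ∈ s, w i ∈ ProjPair.homs (R i) P ∧ (w i)ᴴ * w i = (R i).proj) ∧
      (∀ i ∈ s, ∀ j ∈ s, i ≠ j → (w i)ᴴ * w j = 0) ∧ ∑ i ∈ s, w i * (w i)ᴴ = P.proj := by
  induction s using Finset.induction_on with
  | empty => exact ⟨ProjPair.zero lam α, fun i => 0, by simp; rfl, by simp, by simp, by simp⟩
  | insert a s ha ih =>
    obtain ⟨P, w, h1, h2, h3, h4⟩ := ih
    have k := ProjPair.isOrthogonalSum_directSum (R a) P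
    obtain ⟨w', hw'a, hw's⟩ : ∃ w' : ∀ i, Matrix ((R a).directSum P).rep.ι (R i).rep.ι A,
        w' a = ProjPair.inl (R a) P ∧ ∀ i, i ≠ a → w' i = ProjPair.inr (R a) P * w i :=
      ⟨Function.update (fun i => ProjPair.inr (R a) P * w i) a (ProjPair.inl (R a) P),
        Function.update_self .., fun i hi => Function.update_of_ne hi ..⟩
    refine ⟨(R a).directSum P, w', ?_, ?_, ?_, ?_⟩
    · rw [← ProjClass.mk_add, Finset.sum_insert ha, h1]
    · intro i hi
      by_cases hia : i = a
      · subst hia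
        rw [hw'a]
        exact ⟨k.left_mem, k.left_isometry⟩
      · have his := Finset.mem_of_mem_insert_of_ne hi hia
        rw [hw's i hia]
        refine ⟨ProjPair.homs_mul (h2 i his).1 k.right_mem, ?_⟩
        rw [conjTranspose_mul, Matrix.mul_assoc, ← Matrix.mul_assoc (ProjPair.inr (R a) P)ᴴ,
          k.right_isometry, (h2 i his).1.2.1, (h2 i his).2]
    · intro i hi j hj hij
      by_cases hia : i = a
      · subst hia
        rw [hw'a, hw's j (Ne.symm hij), ← Matrix.mul_assoc, k.orthogonal, Matrix.zero_mul]
      · have his := Finset.mem_of_mem_insert_of_ne hi hia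
        by_cases hja : j = a
        · subst hja
          rw [hw'a, hw's i hia, conjTranspose_mul, Matrix.mul_assoc, k.orthogonal',
            Matrix.mul_zero]
        · have hjs := Finset.mem_of_mem_insert_of_ne hj hja
          rw [hw's i hia, hw's j hja, conjTranspose_mul, Matrix.mul_assoc,
            ← Matrix.mul_assoc (ProjPair.inr (R a) P)ᴴ, k.right_isometry, (h2 j hjs).1.2.1,
            h3 i his j hjs hij]
    · rw [Finset.sum_insert ha, hw'a, ← k.sum_eq]
      congr 1
      calc ∑ i ∈ s, w' i * (w' i)ᴴ
          = ProjPair.inr (R a) P * (∑ i ∈ s, w i * (w i)ᴴ) * (ProjPair.inr (R a) P)ᴴ := by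
            rw [Matrix.mul_sum, Matrix.sum_mul]
            refine Finset.sum_congr rfl fun i hi => ?_
            rw [hw's i fun h => ha (h ▸ hi), conjTranspose_mul]
            simp only [Matrix.mul_assoc]
        _ = ProjPair.inr (R a) P * (ProjPair.inr (R a) P)ᴴ := by rw [h4, k.right_mem.2.2]

/-- Cancellation is what turns the identity of K-classes into an equivalence `U` of the direct sum
of the `R i` with `P`; the `w i` are the inclusions of the summands followed by `U`. -/
theorem TwistedK.exists_orthogonal_family [FiniteDimensional ℂ A] {I : Type*} [Fintype I]
    [DecidableEq I] (R : I → ProjPair lam α) (P : ProjPair lam α)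
    (h : TwistedK.cls P = ∑ i, TwistedK.cls (R i)) :
    ∃ w : ∀ i, Matrix P.rep.ι (R i).rep.ι A, (∀ i, w i ∈ ProjPair.homs (R i) P) ∧
      (∀ i, (w i)ᴴ * w i = (R i).proj) ∧ (∀ i j, i ≠ j → (w i)ᴴ * w j = 0) ∧
      ∑ i, w i * (w i)ᴴ = P.proj := by
  obtain ⟨Q, w, h1, h2, h3, h4⟩ := ProjPair.exists_orthogonal_family R Finset.univ
  have hcls : TwistedK.cls Q = TwistedK.cls P := by
    rw [h]
    change Algebra.GrothendieckAddGroup.of (ProjClass.mk Q) = _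
    rw [h1, map_sum]; rfl
  obtain ⟨U, k1, k2, k3⟩ := TwistedK.cls_eq_iff.1 hcls
  have hU := ProjPair.mem_homs_of_equivalent k1 k2 k3
  have hUw : ∀ i j, (U * w i)ᴴ * (U * w j) = (w i)ᴴ * w j := fun i j => by
    rw [conjTranspose_mul, Matrix.mul_assoc, ← Matrix.mul_assoc Uᴴ, k2,
      (h2 j (Finset.mem_univ j)).1.2.1]
  refine ⟨fun i => U * w i, fun i => ProjPair.homs_mul (h2 i (Finset.mem_univ i)).1 hU,
    fun i => by rw [hUw, (h2 i (Finset.mem_univ i)).2],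
    fun i j hij => by rw [hUw, h3 i (Finset.mem_univ i) j (Finset.mem_univ j) hij], ?_⟩
  calc ∑ i, U * w i * (U * w i)ᴴ = U * (∑ i, w i * (w i)ᴴ) * Uᴴ := by
        rw [Matrix.mul_sum, Matrix.sum_mul]
        exact Finset.sum_congr rfl fun i _ => by
          rw [conjTranspose_mul]; simp only [Matrix.mul_assoc]
    _ = P.proj := by rw [h4, hU.2.2, k3]

/-! ### Construction of an equivariant homomorphism -/

/-- The data from which an equivariant homomorphism is assembled: pairs `Q i` and orthogonal
partial isometries `w i` from `Q i ⊗ u i` to an invariant projection of `B`. -/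
structure AssemblyData (D : BlockDecomposition α) (β : CStarAction G B) where
  Q : ∀ i, ProjPair (D.lam i).conj β
  w : ∀ i, Matrix Unit ((Q i).rep.ι × (D.u i).ι) B
  invariant : ∀ i g,
    (w i).map (β.aut g) * scalarMat B ((Q i).rep.mat g ⊗ₖ (D.u i).mat g)ᴴ = w i
  isometry : ∀ i, (w i)ᴴ * w i = tensorMat (Q i).proj 1
  orthogonal : ∀ i j, i ≠ j → (w i)ᴴ * w j = 0

namespace AssemblyData

variable {D : BlockDecomposition α} (X : AssemblyData D β)

theorem map_aut_w (i : D.I) (g : G) : (X.w i).map (β.aut g) =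
    X.w i * scalarMat B ((X.Q i).rep.mat g ⊗ₖ (D.u i).mat g) := by
  have h : ((X.Q i).rep.mat g ⊗ₖ (D.u i).mat g)ᴴ * ((X.Q i).rep.mat g ⊗ₖ (D.u i).mat g) = 1 :=
    ((D.u i).tensor (X.Q i).rep).conjTranspose_mul_mat g
  nth_rw 2 [← X.invariant i g]
  rw [Matrix.mul_assoc, ← scalarMat_mul, h, scalarMat_one, Matrix.mul_one]

theorem isStarProjection_tensor (i : D.I) :
    IsStarProjection (tensorMat (X.Q i).proj (1 : Matrix (D.u i).ι (D.u i).ι ℂ)) :=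
  (ProjPair.tensor (D.u i) (X.Q i)).isProj

theorem w_mul (i : D.I) :
    X.w i * tensorMat (X.Q i).proj (1 : Matrix (D.u i).ι (D.u i).ι ℂ) = X.w i :=
  mul_eq_self_of_conjTranspose_mul (X.isStarProjection_tensor i) (X.isometry i)

/-- The component of the homomorphism on the block `i`. -/
def component (i : D.I) (m : Matrix (D.u i).ι (D.u i).ι ℂ) : Matrix Unit Unit B :=
  X.w i * tensorMat (X.Q i).proj m * (X.w i)ᴴ

theorem component_mul (i : D.I) (m m' : Matrix (D.u i).ι (D.u i).ι ℂ) :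
    X.component i m * X.component i m' = X.component i (m * m') := by
  calc X.component i m * X.component i m'
      = X.w i * (tensorMat (X.Q i).proj m * ((X.w i)ᴴ * X.w i) * tensorMat (X.Q i).proj m') *
        (X.w i)ᴴ := by simp only [component, Matrix.mul_assoc]
    _ = _ := by
      rw [X.isometry, tensorMat_mul, tensorMat_mul, (X.Q i).proj_mul_proj, (X.Q i).proj_mul_proj,
        Matrix.mul_one, component]

theorem component_mul_of_ne {i j : D.I} (h : i ≠ j) (m : Matrix (D.u i).ι (D.u i).ι ℂ)
    (m' : Matrix (D.u j).ι (D.u j).ι ℂ) : X.component i m * X.component j m' = 0 := by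
  calc X.component i m * X.component j m'
      = X.w i * tensorMat (X.Q i).proj m * ((X.w i)ᴴ * X.w j) *
        (tensorMat (X.Q j).proj m' * (X.w j)ᴴ) := by simp only [component, Matrix.mul_assoc]
    _ = 0 := by rw [X.orthogonal i j h, Matrix.mul_zero, Matrix.zero_mul]

theorem component_add (i : D.I) (m m' : Matrix (D.u i).ι (D.u i).ι ℂ) :
    X.component i (m + m') = X.component i m + X.component i m' := by
  have : tensorMat (X.Q i).proj (m + m') =
      tensorMat (X.Q i).proj m + tensorMat (X.Q i).proj m' := by
    ext ⟨a, k⟩ ⟨b, l⟩; simp [tensorMat, add_smul]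
  rw [component, this, Matrix.mul_add, Matrix.add_mul]; rfl

theorem component_smul (i : D.I) (t : ℂ) (m : Matrix (D.u i).ι (D.u i).ι ℂ) :
    X.component i (t • m) = t • X.component i m := by
  have : tensorMat (X.Q i).proj (t • m) = t • tensorMat (X.Q i).proj m := by
    ext ⟨a, k⟩ ⟨b, l⟩; simp [tensorMat, smul_smul]
  rw [component, this, Matrix.mul_smul, Matrix.smul_mul]; rfl

theorem component_star (i : D.I) (m : Matrix (D.u i).ι (D.u i).ι ℂ) :
    X.component i (star m) = (X.component i m)ᴴ := by
  rw [component, component, conjTranspose_mul, conjTranspose_mul, conjTranspose_conjTranspose,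
    tensorMat_conjTranspose, (X.Q i).conjTranspose_proj, star_eq_conjTranspose, Matrix.mul_assoc]

theorem component_one (i : D.I) : X.component i 1 = X.w i * (X.w i)ᴴ := by
  rw [component, X.w_mul]

/-- Applying `β` to `w i` inserts the representation `(Q i).rep ⊗ u i`. Conjugation by its first
factor is absorbed by the invariance of `(Q i).proj`, and what remains is conjugation of `m` by `u
i`. -/
theorem component_aut (i : D.I) (g : G) (m : Matrix (D.u i).ι (D.u i).ι ℂ) :
    (X.component i m).map (β.aut g) =
      X.component i ((D.u i).mat g * m * ((D.u i).mat g)ᴴ) := by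
  have h1 : (X.component i m).map (β.aut g) = (X.w i).map (β.aut g) *
      (tensorMat (X.Q i).proj m).map (β.aut g) * ((X.w i).map (β.aut g))ᴴ := by
    have h2 : ((X.w i).map (β.aut g))ᴴ = (X.w i)ᴴ.map (β.aut g) := by
      ext a b; exact (map_star (β.aut g) _).symm
    rw [h2, component, Matrix.map_mul, Matrix.map_mul]
  have h3 : (tensorMat (X.Q i).proj m).map (β.aut g) =
      tensorMat ((X.Q i).proj.map (β.aut g)) m := by
    ext ⟨a, k⟩ ⟨b, l⟩; simp [tensorMat]
  have h4 : scalarMat B ((X.Q i).rep.mat g) * (X.Q i).proj.map (β.aut g) *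
      scalarMat B ((X.Q i).rep.mat g)ᴴ = (X.Q i).proj := (X.Q i).invariant g
  rw [h1, X.map_aut_w, h3, conjTranspose_mul, scalarMat_conjTranspose, conjTranspose_kronecker,
    ← tensorMat_scalarMat, ← tensorMat_scalarMat]
  calc X.w i * tensorMat (scalarMat B ((X.Q i).rep.mat g)) ((D.u i).mat g) *
        tensorMat ((X.Q i).proj.map (β.aut g)) m *
        (tensorMat (scalarMat B ((X.Q i).rep.mat g)ᴴ) ((D.u i).mat g)ᴴ * (X.w i)ᴴ)
      = X.w i * (tensorMat (scalarMat B ((X.Q i).rep.mat g)) ((D.u i).mat g) *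
        tensorMat ((X.Q i).proj.map (β.aut g)) m *
        tensorMat (scalarMat B ((X.Q i).rep.mat g)ᴴ) ((D.u i).mat g)ᴴ) * (X.w i)ᴴ := by
        simp only [Matrix.mul_assoc]
    _ = _ := by rw [tensorMat_mul, tensorMat_mul, h4, component]

/-- The homomorphism with values in `1 × 1` matrices. -/
def total (a : A) : Matrix Unit Unit B := ∑ i, X.component i ((D.isBlock i).coord a)

theorem total_mul (a b : A) : X.total a * X.total b = X.total (a * b) := by
  unfold total
  rw [Matrix.sum_mul]
  refine Finset.sum_congr rfl fun i _ => ?_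
  rw [Matrix.mul_sum, Finset.sum_eq_single i (fun j _ hj => X.component_mul_of_ne hj.symm _ _)
    (fun h => absurd (Finset.mem_univ i) h), X.component_mul, map_mul]

theorem total_map (i : D.I) (m : Matrix (D.u i).ι (D.u i).ι ℂ) :
    X.total (D.φ i m) = X.component i m := by
  unfold total
  rw [Finset.sum_eq_single i, IsBlock.coord_map]
  · intro j _ hj
    have h0 : (D.isBlock j).coord (D.φ i m) = 0 := by
      apply (D.isBlock j).injective
      rw [IsBlock.map_coord, map_zero, ← one_mul m, map_mul, ← mul_assoc, D.orthogonal j i hj,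
        zero_mul]
    rw [h0, ← zero_smul ℂ (0 : Matrix (D.u j).ι (D.u j).ι ℂ), X.component_smul, zero_smul]
  · exact fun h => absurd (Finset.mem_univ i) h

/-- The equivariant homomorphism `a ↦ ∑ i, w i (q i ⊗ a i) (w i)ᴴ`. -/
def hom : EquivariantHom α β where
  toHom :=
    { toFun := fun a => X.total a () ()
      map_mul' := fun a b => by
        rw [← X.total_mul, Matrix.mul_apply, Finset.univ_unique, Finset.sum_singleton]
      map_zero' := by
        have : X.total 0 = 0 := Finset.sum_eq_zero fun i _ => by
          rw [map_zero, ← zero_smul ℂ (0 : Matrix (D.u i).ι (D.u i).ι ℂ), X.component_smul,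
            zero_smul]
        rw [this]; rfl
      map_add' := fun a b => by
        have : X.total (a + b) = X.total a + X.total b := by
          unfold total
          rw [← Finset.sum_add_distrib]
          exact Finset.sum_congr rfl fun i _ => by rw [map_add, X.component_add]
        rw [this]; rfl
      map_smul' := fun t a => by
        have : X.total (t • a) = t • X.total a := by
          unfold total
          rw [Finset.smul_sum]
          exact Finset.sum_congr rfl fun i _ => by rw [map_smul, X.component_smul]
        rw [this]; rfl
      map_star' := fun a => by
        have : X.total (star a) = (X.total a)ᴴ := by
          unfold total
          rw [conjTranspose_sum]
          exact Finset.sum_congr rfl fun i _ => by rw [map_star, X.component_star]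
        rw [this]; rfl }
  equivariant := fun g a => by
    have : X.total (α.aut g a) = (X.total a).map (β.aut g) := by
      unfold total
      ext x y
      simp only [Matrix.sum_apply, Matrix.map_apply, map_sum]
      refine Finset.sum_congr rfl fun i _ => ?_
      rw [D.coord_aut, ← X.component_aut]; rfl
    change X.total (α.aut g a) () () = β.aut g (X.total a () ())
    rw [this]; rfl

theorem hom_apply (a : A) : X.hom.toHom a = X.total a () () := rfl

theorem hom_one : X.hom.toHom 1 = (∑ i, X.w i * (X.w i)ᴴ) () () := by
  have h : X.total 1 = ∑ i, X.w i * (X.w i)ᴴ :=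
    Finset.sum_congr rfl fun i _ => by rw [map_one, X.component_one]
  rw [hom_apply, h]

/-- The row `w i`, indexed by the basis of `(Q i).rep ⊗ u i`, is reshaped by moving the `u i` index
to the row side, where it transforms under `conj (u i)`. The factor `D.scale i` compensates for the
`d` equal terms in the sum over that index. -/
theorem equivalent_mapPair_gen (i : D.I) :
    ProjPair.Equivalent (X.Q i) (X.hom.mapPair (D.gen i)) := by
  refine ⟨Matrix.of fun (j : (D.u i).ι) h => D.scale i • X.w i () (h, j), ?_, ?_, ?_⟩
  · rw [isGInvariant_iff]
    intro g j h
    have h1 := congrFun (congrFun (X.invariant i g) ()) (h, j)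
    simp only [Matrix.mul_apply, scalarMat, Matrix.map_apply, conjTranspose_apply,
      kroneckerMap_apply, Fintype.sum_prod_type, Algebra.algebraMap_eq_smul_one, mul_smul_comm,
      mul_one] at h1
    rw [Matrix.of_apply, ← h1, Finset.sum_comm, Finset.smul_sum]
    refine Finset.sum_congr rfl fun l _ => ?_
    rw [Finset.smul_sum]
    refine Finset.sum_congr rfl fun k _ => ?_
    rw [Matrix.of_apply, map_smul, smul_smul, smul_smul, star_mul']
    congr 1
    change star ((D.u i).mat g j k) * star ((X.Q i).rep.mat g h l) * D.scale i = _
    ring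
  · ext h h'
    simp only [Matrix.mul_apply, conjTranspose_apply, Matrix.of_apply, star_smul,
      smul_mul_smul_comm, D.star_scale, D.scale_mul_scale]
    have h1 : ∀ j, star (X.w i () (h, j)) * X.w i () (h', j) = (X.Q i).proj h h' := fun j => by
      have h2 := congrFun (congrFun (X.isometry i) (h, j)) (h', j)
      simpa [Matrix.mul_apply, tensorMat] using h2
    simp only [h1]
    rw [Finset.sum_const, ← Nat.cast_smul_eq_nsmul ℂ, smul_smul, Finset.card_univ,
      show ((Fintype.card (D.u i).ι : ℕ) : ℂ) = D.dim i from rfl, mul_inv_cancel₀ (D.dim_ne_zero i),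
      one_smul]
  · ext j k
    change _ = X.hom.toHom (D.φ i (single j k (D.dim i)⁻¹))
    have h1 : X.component i (single j k (D.dim i)⁻¹) =
        X.w i * tensorMat (1 : Matrix (X.Q i).rep.ι (X.Q i).rep.ι B)
          (single j k (D.dim i)⁻¹ : Matrix (D.u i).ι (D.u i).ι ℂ) * (X.w i)ᴴ := by
      -- Since `w i` already absorbs `(Q i).proj ⊗ 1`, the projection in the middle may be replaced
      -- by `1`.
      nth_rw 1 [← X.w_mul i]
      rw [Matrix.mul_assoc (X.w i), tensorMat_mul, Matrix.mul_one, Matrix.one_mul, component]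
    rw [hom_apply, total_map, h1, ← D.scale_mul_scale]
    have h2 : ∀ (h : (X.Q i).rep.ι) (b : (D.u i).ι), (X.w i * tensorMat
        (1 : Matrix (X.Q i).rep.ι (X.Q i).rep.ι B)
        (single j k (D.scale i * D.scale i) : Matrix (D.u i).ι (D.u i).ι ℂ)) () (h, b) =
        if b = k then (D.scale i * D.scale i) • X.w i () (h, j) else 0 := fun h b => by
      simp only [Matrix.mul_apply, tensorMat, kroneckerMap_apply, Fintype.sum_prod_type,
        Matrix.one_apply, single_apply]
      rw [Finset.sum_eq_single h (fun h' _ hh => by simp [hh])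
        (fun hh => absurd (Finset.mem_univ _) hh), Finset.sum_eq_single j
        (fun j' _ hj => by simp [hj.symm]) (fun hh => absurd (Finset.mem_univ _) hh)]
      by_cases hb : b = k
      · simp [hb]
      · simp [hb, Ne.symm hb]
    rw [Matrix.mul_apply, Matrix.mul_apply, Fintype.sum_prod_type]
    refine Finset.sum_congr rfl fun h _ => ?_
    simp only [h2]
    rw [Finset.sum_eq_single k (fun b _ hb => by rw [if_neg hb, zero_mul])
      (fun hh => absurd (Finset.mem_univ _) hh), if_pos rfl]
    simp only [conjTranspose_apply, Matrix.of_apply, star_smul, D.star_scale, smul_mul_assoc,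
      mul_smul_comm, smul_smul]

theorem ell_hom_gen (i : D.I) :
    X.hom.ell.toHom _ (TwistedK.cls (D.gen i)) = TwistedK.cls (X.Q i) := by
  rw [TwistedK.cls_eq_of_equivalent (X.equivalent_mapPair_gen i)]
  exact X.hom.mapK_of _

end AssemblyData

/-- Positivity represents each `Γ [gen i]` by a pair `Q i`. Compatibility with the partial actions
turns the block formula for `[1_α]` into `[p] = ∑ [u i ⊗ Q i]`; the partial isometries this provides
assemble to `T`, which agrees with `Γ` on the generators. -/
theorem EllHom.exists_equivariantHom [FiniteDimensional ℂ B] (D : BlockDecomposition α)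
    (Γ : EllHom α β) {p : B} (hp : IsStarProjection p) (hinv : ∀ g, β.aut g p = p)
    (h : Γ.toHom 1 (TwistedK.unitClass α) = TwistedK.cls (ProjPair.ofInvariant β p hp hinv)) :
    ∃ T : EquivariantHom α β, T.toHom 1 = p ∧ T.ell = Γ := by
  choose Q hQ using fun i => Γ.map_positive _ (TwistedK.cls (D.gen i)) ⟨D.gen i, rfl⟩
  -- The cocycle of `u i ⊗ Q i` is `lam i * conj (lam i)`, which equals the trivial one by a proof
  -- rather than by definition, hence the transport.
  let R : D.I → ProjPair (1 : TwoCocycle G) β := fun i =>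
    (ProjPair.tensor (D.u i) (Q i)).cast (TwoCocycle.mul_conj (D.lam i))
  have hR : ∀ i, Γ.toHom 1 (TwistedK.cls (D.blockPair (BlockDecomposition.unitPair α) i)) =
      TwistedK.cls (R i) := fun i =>
    Γ.toHom_cast (TwoCocycle.mul_conj (D.lam i))
      (P := (D.blockPair (BlockDecomposition.unitPair α) i).cast
        (TwoCocycle.mul_conj (D.lam i)).symm) (by
        rw [← TwistedK.cls_eq_of_equivalent (D.equivalent_unitPair_block i), TwistedK.cls_tensor,
          Γ.map_partialAction, ← hQ, ← TwistedK.cls_tensor])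
  have hsum : TwistedK.cls (ProjPair.ofInvariant β p hp hinv) = ∑ i, TwistedK.cls (R i) := by
    rw [← h]
    change Γ.toHom 1 (Algebra.GrothendieckAddGroup.of
      (ProjClass.mk (BlockDecomposition.unitPair α))) = _
    rw [D.mk_eq_sum_blockPair, map_sum, map_sum]
    exact Finset.sum_congr rfl fun i _ => hR i
  obtain ⟨w, h1, h2, h3, h4⟩ := TwistedK.exists_orthogonal_family R _ hsum
  let X : AssemblyData D β :=
    { Q := Q
      w := w
      invariant := fun i g => by
        have h5 : scalarMat B (1 : Matrix Unit Unit ℂ) * (w i).map (β.aut g) *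
            scalarMat B ((Q i).rep.mat g ⊗ₖ (D.u i).mat g)ᴴ = w i := (h1 i).1 g
        rwa [scalarMat_one, Matrix.one_mul] at h5
      isometry := h2
      orthogonal := h3 }
  refine ⟨X.hom, ?_, D.ellHom_ext fun i => ?_⟩
  · rw [X.hom_one]
    exact congrFun (congrFun h4 ()) ()
  · rw [X.ell_hom_gen, ← hQ]

end

/-! ### Uniqueness up to unitary equivalence -/

/-- The relations with the matrix units `H` make distinct diagonal entries of `v` orthogonal, and
give all entries of a column the same `star (v a j) * v a j`. Column `j` therefore yields `star (v j
j) * v j j = n⁻² F j j`, and the factor `n` on the trace restores `F j j`. -/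
theorem star_trace_mul_trace {B : Type*} [Ring B] [StarRing B] [Algebra ℂ B] [StarModule ℂ B]
    {ι : Type*} [Fintype ι] [DecidableEq ι] {F H : ι → ι → B} {v : Matrix ι ι B} {n : ℂ}
    (hn : star n = n) (hn0 : n ≠ 0) (hcard : (Fintype.card ι : ℂ) = n)
    (hH : ∀ j k l m, H j k * H l m = if k = l then H j m else 0)
    (hHs : ∀ j k, star (H j k) = H k j)
    (hHv : ∀ l m j k, H l m * v j k = if m = j then v l k else 0)
    (hv : ∀ j, ∑ a, star (v a j) * v a j = n⁻¹ • F j j) :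
    star (n • ∑ j, v j j) * (n • ∑ j, v j j) = ∑ j, F j j := by
  have hdiag : ∀ j k, j ≠ k → star (v j j) * v k k = 0 := fun j k hjk => by
    have h1 : H k k * v k k = v k k := by rw [hHv, if_pos rfl]
    rw [← h1, ← mul_assoc, ← hHs, ← star_mul, hHv, if_neg hjk.symm, star_zero, zero_mul]
  have hcol : ∀ a j, star (v a j) * v a j = star (v j j) * v j j := fun a j => by
    have h1 : v a j = H a j * v j j := by rw [hHv, if_pos rfl]
    rw [h1, star_mul, hHs, mul_assoc, ← mul_assoc (H j a), hH, if_pos rfl, hHv, if_pos rfl]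
  rw [star_smul, smul_mul_smul_comm, star_sum, Finset.sum_mul_sum, hn, Finset.smul_sum]
  refine Finset.sum_congr rfl fun j _ => ?_
  rw [Finset.sum_eq_single j (fun k _ hk => hdiag j k hk.symm)
    (fun h => absurd (Finset.mem_univ j) h)]
  have h2 := hv j
  simp only [hcol] at h2
  rw [Finset.sum_const, ← Nat.cast_smul_eq_nsmul ℂ, Finset.card_univ, hcard] at h2
  rw [← smul_smul, h2, smul_smul, mul_inv_cancel₀ hn0, one_smul]

section

variable {G : Type w} [Group G] [TopologicalSpace G] {A : Type u} [CStarAlgebra A]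
  {B : Type v} [CStarAlgebra B] {lam mu : TwoCocycle G} {α : CStarAction G A} {β : CStarAction G B}

/-- Let `v` implement the equivalence of the two images of `gen i`, and let `E T j k` be the image
of the matrix unit `e_jk` under `T`. Absorbing the two projections gives `v j k * E T₁ k m = v j m`
and `E T₂ l j * v j k = v l k`. With `d` the dimension of the block, `V = d ∑ v j j` then satisfies
`E T₂ k l * V = d v k l = V * E T₁ k l`, so it intertwines. Its initial and final projections follow
from `star_trace_mul_trace` applied to `v` and to `vᴴ`. -/
theorem BlockDecomposition.exists_block_intertwiner (D : BlockDecomposition α)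
    (T₁ T₂ : EquivariantHom α β) (i : D.I)
    (h : ProjPair.Equivalent (T₁.mapPair (D.gen i)) (T₂.mapPair (D.gen i))) :
    ∃ V : B, (∀ g, β.aut g V = V) ∧ (∀ a, T₂.toHom a * V = V * T₁.toHom a) ∧
      V * T₁.toHom (D.φ i 1) = V ∧ T₂.toHom (D.φ i 1) * V = V ∧
      star V * V = T₁.toHom (D.φ i 1) ∧ V * star V = T₂.toHom (D.φ i 1) := by
  obtain ⟨v, hinv, hv1, hv2⟩ : ∃ v : Matrix (D.u i).ι (D.u i).ι B,
      IsGInvariant β (D.u i).conj (D.u i).conj v ∧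
      vᴴ * v = Matrix.of (fun j k => T₁.toHom (D.φ i (single j k (D.dim i)⁻¹))) ∧
      v * vᴴ = Matrix.of (fun j k => T₂.toHom (D.φ i (single j k (D.dim i)⁻¹))) := h
  have hmem := ProjPair.mem_homs_of_equivalent (P := T₁.mapPair (D.gen i))
    (Q := T₂.mapPair (D.gen i)) hinv hv1 hv2
  have hr : v * Matrix.of (fun j k => T₁.toHom (D.φ i (single j k (D.dim i)⁻¹))) = v := hmem.2.2
  have hl : Matrix.of (fun j k => T₂.toHom (D.φ i (single j k (D.dim i)⁻¹))) * v = v := hmem.2.1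
  have hd0 := D.dim_ne_zero i
  let E : EquivariantHom α β → (D.u i).ι → (D.u i).ι → B := fun T j k =>
    T.toHom (D.φ i (single j k 1))
  have hE : ∀ (T : EquivariantHom α β) (j k : (D.u i).ι) (c : ℂ),
      T.toHom (D.φ i (single j k c)) = c • E T j k := fun T j k c => by
    rw [← map_smul, ← map_smul, smul_single, smul_eq_mul, mul_one]
  have hEE : ∀ (T : EquivariantHom α β) (j k l m : (D.u i).ι),
      E T j k * E T l m = if k = l then E T j m else 0 := fun T j k l m => by
    change T.toHom _ * T.toHom _ = _
    rw [← map_mul, ← map_mul]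
    split_ifs with hkl
    · rw [hkl, single_mul_single_same, mul_one]
    · rw [single_mul_single_of_ne _ _ _ _ hkl, map_zero, map_zero]
  have hEs : ∀ (T : EquivariantHom α β) (j k : (D.u i).ι), star (E T j k) = E T k j :=
    fun T j k => by
      change star (T.toHom _) = T.toHom _
      rw [← map_star, ← map_star, star_eq_conjTranspose, conjTranspose_single, star_one]
  have hE1 : ∀ T : EquivariantHom α β, ∑ j, E T j j = T.toHom (D.φ i 1) := fun T => by
    rw [← map_sum, ← map_sum]
    congr 2
    ext a b
    simp [Matrix.sum_apply, single_apply, Matrix.one_apply, ite_and]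
  have hvF : ∀ j k l m, v j k * E T₁ l m = if k = l then v j m else 0 := fun j k l m => by
    nth_rw 1 [← hr]
    rw [Matrix.mul_apply, Finset.sum_mul]
    simp only [Matrix.of_apply, hE, mul_smul_comm, smul_mul_assoc, mul_assoc, hEE]
    split_ifs with hkl
    · conv_rhs => rw [← hr]
      simp only [Matrix.mul_apply, Matrix.of_apply, hE, mul_smul_comm]
    · simp
  have hHv : ∀ l m j k, E T₂ l m * v j k = if m = j then v l k else 0 := fun l m j k => by
    nth_rw 1 [← hl]
    rw [Matrix.mul_apply, Finset.mul_sum]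
    simp only [Matrix.of_apply, hE, mul_smul_comm, smul_mul_assoc, ← mul_assoc, hEE]
    split_ifs with hkl
    · conv_rhs => rw [← hl]
      simp only [Matrix.mul_apply, Matrix.of_apply, hE, smul_mul_assoc]
    · simp
  have hdim : star (D.dim i) = D.dim i := by simp [BlockDecomposition.dim]
  have hV1 := star_trace_mul_trace (F := E T₁) (H := E T₂) (v := v) hdim hd0 rfl (hEE T₂) (hEs T₂)
    hHv fun j => by
      have h1 := congrFun (congrFun hv1 j) j
      rwa [Matrix.of_apply, hE, Matrix.mul_apply] at h1
  have hV2 := star_trace_mul_trace (F := E T₂) (H := E T₁) (v := vᴴ) hdim hd0 rfl (hEE T₁)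
    (hEs T₁)
    (fun l m j k => by
      rw [conjTranspose_apply, ← hEs, ← star_mul, hvF, apply_ite star, star_zero]
      simp only [conjTranspose_apply, eq_comm])
    fun j => by
      have h1 := congrFun (congrFun hv2 j) j
      rw [Matrix.of_apply, hE, Matrix.mul_apply] at h1
      rw [← h1]
      exact Finset.sum_congr rfl fun a _ => by rw [conjTranspose_apply, star_star]
  have hstar : (D.dim i) • ∑ j, vᴴ j j = star ((D.dim i) • ∑ j, v j j) := by
    rw [star_smul, hdim, star_sum]; rfl
  rw [hstar, star_star, hE1] at hV2
  rw [hE1] at hV1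
  have hVF : ∀ k l, ((D.dim i) • ∑ j, v j j) * E T₁ k l = (D.dim i) • v k l := fun k l => by
    rw [smul_mul_assoc, Finset.sum_mul]
    simp only [hvF]
    simp
  have hHV : ∀ k l, E T₂ k l * ((D.dim i) • ∑ j, v j j) = (D.dim i) • v k l := fun k l => by
    rw [mul_smul_comm, Finset.mul_sum]
    simp only [hHv]
    simp
  have hVone : ((D.dim i) • ∑ j, v j j) * T₁.toHom (D.φ i 1) = (D.dim i) • ∑ j, v j j := by
    rw [← hE1, Finset.mul_sum]
    simp only [hVF]
    rw [Finset.smul_sum]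
  generalize hW : (D.dim i) • ∑ j, v j j = W at *
  have hint : ∀ m, T₂.toHom (D.φ i m) * W = W * T₁.toHom (D.φ i m) := fun m => by
    rw [matrix_eq_sum_single m]
    simp only [map_sum, Finset.sum_mul, Finset.mul_sum, hE, smul_mul_assoc, mul_smul_comm, hVF, hHV]
  have honeV : T₂.toHom (D.φ i 1) * W = W := by rw [hint, hVone]
  refine ⟨W, fun g => ?_, fun a => ?_, hVone, honeV, hV1, hV2⟩
  · rw [← hW, map_smul]
    congr 1
    -- The trace of an invariant matrix is invariant: summing over `j` collapses the coefficients by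
    -- unitarity of `u i`.
    have hu : ∀ k l, ∑ j, star ((D.u i).mat g j k) * (D.u i).mat g j l = if k = l then 1 else 0 :=
      fun k l => by
        have := congrFun (congrFun ((D.u i).conjTranspose_mul_mat g) k) l
        simpa [Matrix.mul_apply, Matrix.one_apply] using this
    have h1 : ∀ j, v j j = ∑ k, ∑ l, (star ((D.u i).mat g j k) * (D.u i).mat g j l) •
        β.aut g (v k l) := fun j => by
      rw [← isGInvariant_iff.1 hinv g j j]
      refine Finset.sum_congr rfl fun k _ => Finset.sum_congr rfl fun l _ => ?_
      change (star ((D.u i).mat g j k) * star (star ((D.u i).mat g j l))) • β.aut g (v k l) = _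
      rw [star_star]
    conv_rhs => rw [Finset.sum_congr rfl fun j _ => h1 j, Finset.sum_comm]
    rw [map_sum]
    refine Finset.sum_congr rfl fun k _ => ?_
    rw [Finset.sum_comm]
    simp only [← Finset.sum_smul, hu]
    simp
  · calc T₂.toHom a * W = T₂.toHom (D.φ i ((D.isBlock i).coord a)) * W := by
          nth_rw 1 [← honeV]
          rw [← mul_assoc, ← map_mul, (D.isBlock i).map_coord, (D.isBlock i).central]
      _ = W * T₁.toHom a := by
          rw [hint, (D.isBlock i).map_coord, map_mul, ← mul_assoc, hVone]

/-- In the K-group `[1 - p] = [1] - [p]`, so the complements have equal classes, and cancellation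
makes them equivalent. -/
theorem ProjPair.exists_complement_equivalence [FiniteDimensional ℂ B] {p q : B}
    (hp : IsStarProjection p) (hpinv : ∀ g, β.aut g p = p) (hq : IsStarProjection q)
    (hqinv : ∀ g, β.aut g q = q)
    (h : TwistedK.cls (ofInvariant β p hp hpinv) = TwistedK.cls (ofInvariant β q hq hqinv)) :
    ∃ V : B, (∀ g, β.aut g V = V) ∧ V * (1 - p) = V ∧ (1 - q) * V = V ∧ star V * V = 1 - p ∧
      V * star V = 1 - q := by
  have key : ∀ {p : B} (hp : IsStarProjection p) (hpinv : ∀ g, β.aut g p = p),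
      TwistedK.cls (ofInvariant β (1 - p) hp.one_sub fun g => by rw [map_sub, map_one, hpinv]) +
        TwistedK.cls (ofInvariant β p hp hpinv) = TwistedK.unitClass β := by
    intro p hp hpinv
    have hs : IsOrthogonalSum (ofInvariant β (1 - p) hp.one_sub fun g => by
        rw [map_sub, map_one, hpinv]) (ofInvariant β p hp hpinv)
        (BlockDecomposition.unitPair β) (Matrix.of fun _ _ => 1 - p : Matrix Unit Unit B)
        (Matrix.of fun _ _ => p : Matrix Unit Unit B) := by
      have h1 : p * p = p := hp.isIdempotentElem
      have h2 : (1 - p) * (1 - p) = 1 - p := hp.one_sub.isIdempotentElem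
      have h3 : star p = p := hp.isSelfAdjoint
      have h4 : (1 - p) * p = 0 := by rw [sub_mul, one_mul, h1, sub_self]
      refine ⟨⟨(ofInvariant β (1 - p) _ _).invariant, ?_, ?_⟩,
        ⟨(ofInvariant β p hp hpinv).invariant, ?_, ?_⟩, ?_, ?_, ?_, ?_⟩ <;> ext ⟨⟩ ⟨⟩ <;>
        simp [Matrix.mul_apply, h1, h2, h3, h4]
    rw [TwistedK.unitClass, TwistedK.cls, TwistedK.cls, TwistedK.cls, ← map_add, ← hs.mk_eq]
  have h1 := add_right_cancel (((key hp hpinv).trans (key hq hqinv).symm).trans (by rw [h]))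
  obtain ⟨U, h2, h3, h4⟩ := TwistedK.cls_eq_iff.1 h1
  have hm := mem_homs_of_equivalent h2 h3 h4
  refine ⟨U () (), fun g => ?_, ?_, ?_, ?_, ?_⟩
  · have h5 := isGInvariant_iff.1 h2 g () ()
    simpa using h5
  · simpa [Matrix.mul_apply] using congrFun (congrFun hm.2.2 ()) ()
  · simpa [Matrix.mul_apply] using congrFun (congrFun hm.2.1 ()) ()
  · simpa [Matrix.mul_apply] using congrFun (congrFun h3 ()) ()
  · simpa [Matrix.mul_apply] using congrFun (congrFun h4 ()) ()

theorem EquivariantHom.isStarProjection_one (T : EquivariantHom α β) :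
    IsStarProjection (T.toHom 1) :=
  (IsStarProjection.one A).map T.toHom

theorem EquivariantHom.aut_one (T : EquivariantHom α β) (g : G) :
    β.aut g (T.toHom 1) = T.toHom 1 := by
  rw [← T.equivariant, map_one]

theorem EquivariantHom.mapK_unitClass (T : EquivariantHom α β) :
    T.ell.toHom 1 (TwistedK.unitClass α) =
      TwistedK.cls (ProjPair.ofInvariant β (T.toHom 1) T.isStarProjection_one T.aut_one) :=
  T.mapK_of _

/-- The sum `S` of the block intertwiners is a partial isometry from `T₁ 1` to `T₂ 1` that
intertwines `T₁` and `T₂`. A partial isometry `W` between the complements, which both homomorphisms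
annihilate on the relevant side, completes it to the unitary `S + W`. -/
theorem EquivariantHom.exists_unitary [FiniteDimensional ℂ B] (D : BlockDecomposition α)
    {T₁ T₂ : EquivariantHom α β} (h : T₁.ell = T₂.ell) :
    ∃ U ∈ unitary B, (∀ g, β.aut g U = U) ∧ ∀ a, T₂.toHom a = U * T₁.toHom a * star U := by
  have hcls : ∀ i, TwistedK.cls (T₁.mapPair (D.gen i)) = TwistedK.cls (T₂.mapPair (D.gen i)) :=
    fun i => (T₁.mapK_of (ProjClass.mk (D.gen i))).symm.trans
      ((DFunLike.congr_fun (congrFun (congrArg EllHom.toHom h) _) _).trans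
        (T₂.mapK_of (ProjClass.mk (D.gen i))))
  choose V hV1 hV2 hV3 hV4 hV5 hV6 using fun i =>
    D.exists_block_intertwiner T₁ T₂ i (TwistedK.cls_eq_iff.1 (hcls i))
  have hone : TwistedK.cls (ProjPair.ofInvariant β _ T₁.isStarProjection_one T₁.aut_one) =
      TwistedK.cls (ProjPair.ofInvariant β _ T₂.isStarProjection_one T₂.aut_one) := by
    rw [← T₁.mapK_unitClass, ← T₂.mapK_unitClass, h]
  obtain ⟨W, hW1, hW2, hW3, hW4, hW5⟩ := ProjPair.exists_complement_equivalence _ _ _ _ hone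
  let S := ∑ i, V i
  have hS1 : ∀ g, β.aut g S = S := fun g => by simp only [S, map_sum, hV1]
  have hS2 : ∀ a, T₂.toHom a * S = S * T₁.toHom a := fun a => by
    simp only [S, Finset.mul_sum, Finset.sum_mul, hV2]
  have hsum : ∀ T : EquivariantHom α β, ∑ i, T.toHom (D.φ i 1) = T.toHom 1 := fun T => by
    rw [← map_sum, D.sum_one]
  have hSS1 : star S * S = T₁.toHom 1 := by
    rw [← hsum, star_sum, Finset.sum_mul_sum]
    refine Finset.sum_congr rfl fun i _ => ?_
    rw [Finset.sum_eq_single i _ fun hi => absurd (Finset.mem_univ i) hi, hV5]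
    intro j _ hj
    rw [← hV4 i, ← hV4 j, star_mul, ← map_star, IsBlock.star_map_one, mul_assoc,
      ← mul_assoc (T₂.toHom _), ← map_mul, D.orthogonal i j hj.symm, map_zero, zero_mul, mul_zero]
  have hSS2 : S * star S = T₂.toHom 1 := by
    rw [← hsum, star_sum, Finset.sum_mul_sum]
    refine Finset.sum_congr rfl fun i _ => ?_
    rw [Finset.sum_eq_single i _ fun hi => absurd (Finset.mem_univ i) hi, hV6]
    intro j _ hj
    rw [← hV3 i, ← hV3 j, star_mul, ← map_star, IsBlock.star_map_one, mul_assoc,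
      ← mul_assoc (T₁.toHom _), ← map_mul, D.orthogonal i j hj.symm, map_zero, zero_mul, mul_zero]
  have hS3 : T₂.toHom 1 * S = S := by
    simp only [S, Finset.mul_sum]
    refine Finset.sum_congr rfl fun i _ => ?_
    nth_rw 1 [← hV4 i]
    rw [← mul_assoc, ← map_mul, one_mul, hV4]
  have hS4 : S * T₁.toHom 1 = S := by rw [← hS2, hS3]
  have hTW : T₂.toHom 1 * W = 0 := by
    rw [sub_mul, one_mul] at hW3; exact sub_eq_self.1 hW3
  have hWT : W * T₁.toHom 1 = 0 := by
    rw [mul_sub, mul_one] at hW2; exact sub_eq_self.1 hW2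
  have hs : ∀ T : EquivariantHom α β, star (T.toHom 1) = T.toHom 1 := fun T =>
    T.isStarProjection_one.isSelfAdjoint
  have hSW : star S * W = 0 := by
    rw [← hS3, star_mul, hs, mul_assoc, hTW, mul_zero]
  have hWS : star W * S = 0 := by
    rw [← star_star S, ← star_mul, hSW, star_zero]
  have hSW' : S * star W = 0 := by
    rw [← hS4, mul_assoc, ← hs, ← star_mul, hWT, star_zero, mul_zero]
  have hWS' : W * star S = 0 := by
    rw [← star_star W, ← star_mul, hSW', star_zero]
  have hU1 : star (S + W) * (S + W) = 1 := by
    rw [star_add, add_mul, mul_add, mul_add, hSS1, hW4, hSW, hWS]; abel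
  have hU2 : (S + W) * star (S + W) = 1 := by
    rw [star_add, add_mul, mul_add, mul_add, hSS2, hW5, hSW', hWS']; abel
  refine ⟨S + W, ⟨hU1, hU2⟩, fun g => by rw [map_add, hS1, hW1], fun a => ?_⟩
  have h1 : T₂.toHom a * W = 0 := by
    rw [← mul_one a, map_mul, mul_assoc, hTW, mul_zero]
  have h2 : W * T₁.toHom a = 0 := by
    rw [← one_mul a, map_mul, ← mul_assoc, hWT, zero_mul]
  calc T₂.toHom a = T₂.toHom a * ((S + W) * star (S + W)) := by rw [hU2, mul_one]
    _ = (S + W) * T₁.toHom a * star (S + W) := by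
      rw [← mul_assoc, mul_add, h1, hS2, add_mul S, h2]

end

/-! ### The proposition. -/

theorem mainTheorem3 {G : Type w} [Group G] [TopologicalSpace G] [IsTopologicalGroup G]
    [CompactSpace G] {A : Type u} [CStarAlgebra A] [FiniteDimensional ℂ A]
    {B : Type v} [CStarAlgebra B] [FiniteDimensional ℂ B]
    (α : CStarAction G A) (β : CStarAction G B)
    (h : (α.SpectrallyTrivial ∧ β.SpectrallyTrivial) ∨
      (IsFullMatrixAlgebra A ∧ IsFullMatrixAlgebra B)) :
    (∀ Γ : EllHom α β, Γ.Contractive → ∃ T : EquivariantHom α β, T.ell = Γ) ∧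
    (∀ Γ : EllHom α β, Γ.Unital → ∃ T : EquivariantHom α β, T.toHom 1 = 1 ∧ T.ell = Γ) ∧
    (∀ T₁ T₂ : EquivariantHom α β, T₁.ell = T₂.ell →
      ∃ U ∈ unitary B, (∀ g, β.aut g U = U) ∧ ∀ a, T₂.toHom a = U * T₁.toHom a * star U) := by
  obtain ⟨D⟩ := exists_blockDecomposition α (h.imp And.left And.left)
  refine ⟨fun Γ hΓ => ?_, fun Γ hΓ => ?_, fun T₁ T₂ hT => EquivariantHom.exists_unitary D hT⟩
  -- The class `[1_α]` lies in the scale, so contractivity represents its image by an invariant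
  -- projection `p` of `B`, which becomes `T 1`.
  · obtain ⟨p, hp, hinv, hpΓ⟩ := hΓ _ ⟨1, IsStarProjection.one A, fun g => map_one (α.aut g), rfl⟩
    obtain ⟨T, -, hT⟩ := Γ.exists_equivariantHom D hp hinv hpΓ
    exact ⟨T, hT⟩
  · exact Γ.exists_equivariantHom D (IsStarProjection.one B) (fun g => map_one (β.aut g)) hΓ
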